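/- Let $S^1\times S^2$ have coordinates $(t,\theta,\varphi)$ with $t,\varphi\in\mathbb R/2\pi\mathbb Z$ and $\theta\in[0,\pi]$, and orient it by $-\sin\theta\,dt\wedge d\theta\wedge d\varphi$. Let $a=(a_1,a_2):[0,\pi]\to\mathbb R^2$ be smooth and such that $\lambda=a_1(\theta)\,dt+a_2(\theta)\,d\varphi$ is a smooth positive contact form on $S^1\times S^2$ (that is, $\lambda\wedge d\lambda>0$). Suppose that $$a'\times a''(\theta_0):=a_1'(\theta_0)a_2''(\theta_0)-a_2'(\theta_0)a_1''(\theta_0)<0$$ for every $\theta_0\in(0,\pi)$ with $a_1'(\theta_0)/a_2'(\theta_0)\in\mathbb Q\cup\{\pm\infty\}$. For such $\theta_0$ the torus $T(\theta_0)=\{\theta=\theta_0\}$ is foliated by closed Reeb orbits of $\lambda$; as embedded orbits they all have the same action $\mathcal A(\theta_0)=\int\lambda>0$ and the same class in $H_1(T(\theta_0);\mathbb Z)$. The exceptional orbits are the closed Reeb orbits $\{\theta=0\}$ and $\{\theta=\pi\}$. Then for every $L>0$ there is $\delta_0>0$ such that for every $\delta\in(0,\delta_0)$ there is $f\in C^\infty(S^1\times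 S^2)$ with the following properties. 1. $\|f\|_{C^0}<\delta$. 2. $e^{f}\lambda$ agrees with $\lambda$ in a neighborhood of the exceptional orbits. 3. Each torus $T(\theta_0)$, $\theta_0\in(0,\pi)$, with $\mathcal A(\theta_0)<L$ is replaced by two embedded Reeb orbits of $e^f\lambda$: a positive hyperbolic orbit $h_{\theta_0}$ and an $L$-positive elliptic orbit $e_{\theta_0}$. Both have action less than $L$ and within $\delta$ of $\mathcal A(\theta_0)$, and both lie in $T(\theta_0)$ and represent in $H_1(T(\theta_0);\mathbb Z)$ the class of the embedded Reeb orbits of $\lambda$ in $T(\theta_0)$. 4. Apart from the exceptional orbits and the orbits $h_{\theta_0},e_{\theta_0}$ of item 3, $e^f\lambda$ has no embedded Reeb orbits of action less than $L$. Here an embedded Reeb orbit $\gamma$ of a contact form $\alpha$ is positive hyperbolic if the linearized return map of the Reeb flow on $\ker\alpha$ along $\gamma$ has positive real eigenvalues different from $1$. It is elliptic with rotation number $\rho\in\mathbb R\setminus\mathbb Q$ (determined modulo $1$) if this map is conjugate to the rotation by the angle $2\pi\rho$ in a basis that is positive for the orientation of $\ker\alpha$ by $d\alpha$. It is $L$-positive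 if moreover its action satisfies $\mathcal A(\gamma)<L$ and $\rho\in(0,\mathcal A(\gamma)/L)$ modulo $1$. -/

import Mathlib

open scoped ContDiff

/-- The ambient space `ℂ × ℂ × ℝ ≅ ℝ² × ℝ³` in which `S¹ × S²` is embedded. -/
abbrev Amb : Type := ℂ × ℂ × ℝ

namespace Amb

/-- `S¹ × S² = {(w, u, z) : |w| = 1, |u|² + z² = 1}`. -/
def S1S2 : Set Amb := {p | ‖p.1‖ = 1 ∧ ‖p.2.1‖ ^ 2 + p.2.2 ^ 2 = 1}

/-- The real inner product of two complex numbers, `Re (conj a * b)`. -/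
def cdot (a b : ℂ) : ℝ := a.re * b.re + a.im * b.im

/-- `v` is tangent to `S¹ × S²` at `p` (for `p ∈ S1S2`). -/
def IsTangent (p v : Amb) : Prop :=
  cdot p.1 v.1 = 0 ∧ cdot p.2.1 v.2.1 + p.2.2 * v.2.2 = 0

/-- The coordinates `(t, θ, φ) ↦ (e^{it}, sin θ e^{iφ}, cos θ)` on `S¹ × S²`. -/
noncomputable def coord (q : ℝ × ℝ × ℝ) : Amb :=
  (Complex.exp (q.1 * Complex.I),
   (Real.sin q.2.1 : ℂ) * Complex.exp (q.2.2 * Complex.I),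
   Real.cos q.2.1)

/-- The torus `T(θ)`: the slice of `S¹ × S²` of constant `θ`. -/
noncomputable def torus (θ : ℝ) : Set Amb := {p | p ∈ S1S2 ∧ p.2.2 = Real.cos θ}

/-- The circle over the pole `z = c`, for `c = 1` (`θ = 0`) and `c = -1` (`θ = π`). -/
def poleCircle (c : ℝ) : Set Amb := {p | p ∈ S1S2 ∧ p.2.2 = c}

/-- The 1-form `dt` on `S¹`. -/
def dt (p v : Amb) : ℝ := p.1.re * v.1.im - p.1.im * v.1.re

/-- The area form `sin θ dθ ∧ dφ` on `S²`: the determinant with first row the outward normal. -/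
noncomputable def area (p v w : Amb) : ℝ :=
  Matrix.det !![p.2.1.re, p.2.1.im, p.2.2; v.2.1.re, v.2.1.im, v.2.2; w.2.1.re, w.2.1.im, w.2.2]

/-- The volume form `- sin θ dt ∧ dθ ∧ dφ` that orients `S¹ × S²`. -/
noncomputable def vol (p v₁ v₂ v₃ : Amb) : ℝ :=
  -(dt p v₁ * area p v₂ v₃ + dt p v₂ * area p v₃ v₁ + dt p v₃ * area p v₁ v₂)

end Amb

open Amb

/-- A 1-form on `S¹ × S²` is represented by a 1-form on the ambient space, of which only the
values on tangent vectors at points of `S¹ × S²` matter. -/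
abbrev Form1 : Type := Amb → (Amb →L[ℝ] ℝ)

namespace Form1

/-- The exterior derivative `dα_p (v, w)`. -/
noncomputable def d (α : Form1) (p v w : Amb) : ℝ := fderiv ℝ α p v w - fderiv ℝ α p w v

/-- `α` is a smooth positive contact form on `S¹ × S²`: `α ∧ dα > 0` on positive frames. -/
def IsPosContact (α : Form1) : Prop :=
  ContDiff ℝ ∞ α ∧
  ∀ p ∈ S1S2, ∀ v₁ v₂ v₃ : Amb, IsTangent p v₁ → IsTangent p v₂ → IsTangent p v₃ →
    0 < vol p v₁ v₂ v₃ →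
    0 < α p v₁ * α.d p v₂ v₃ + α p v₂ * α.d p v₃ v₁ + α p v₃ * α.d p v₁ v₂

/-- In the coordinates `(t, θ, φ)`, the form `α` reads `a₁(θ) dt + a₂(θ) dφ`. -/
def HasCoordExpr (α : Form1) (a₁ a₂ : ℝ → ℝ) : Prop :=
  ∀ q : ℝ × ℝ × ℝ, q.2.1 ∈ Set.Icc 0 Real.pi → ∀ v : ℝ × ℝ × ℝ,
    α (coord q) (fderiv ℝ coord q v) = a₁ q.2.1 * v.1 + a₂ q.2.1 * v.2.2

/-- The form `e^f α`. -/
noncomputable def rescale (f : Amb → ℝ) (α : Form1) : Form1 := fun p => Real.exp (f p) • α p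

/-- `R` is the value at `p ∈ S¹ × S²` of the Reeb field of `α`. -/
def IsReeb (α : Form1) (p R : Amb) : Prop :=
  IsTangent p R ∧ α p R = 1 ∧ ∀ v, IsTangent p v → α.d p R v = 0

/-- `v` lies in the contact plane `ker α_p ⊆ T_p (S¹ × S²)`. -/
def InPlane (α : Form1) (p v : Amb) : Prop := IsTangent p v ∧ α p v = 0

end Form1

/-- A (parametrized) embedded Reeb orbit `ℝ / Tℤ → S¹ × S²` of `α`. Two such are the same orbit
modulo reparametrization iff they have the same range. -/
structure EmbReebOrbit (α : Form1) where
  γ : ℝ → Amb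
  T : ℝ
  T_pos : 0 < T
  mem : ∀ s, γ s ∈ S1S2
  reeb : ∀ s, ∃ R, α.IsReeb (γ s) R ∧ HasDerivAt γ R s
  periodic : Function.Periodic γ T
  inj : Set.InjOn γ (Set.Ico 0 T)

namespace EmbReebOrbit

variable {α : Form1}

/-- The image of the orbit. -/
def image (o : EmbReebOrbit α) : Set Amb := Set.range o.γ

/-- The symplectic action `∫_γ α`. -/
noncomputable def action (o : EmbReebOrbit α) : ℝ := ∫ s in (0 : ℝ)..o.T, α (o.γ s) (deriv o.γ s)

/-- The orbit lies in `T(θ)` and represents the class `m [t-circle] + n [φ-circle]` in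
`H₁(T(θ); ℤ)`. -/
def HasClass (o : EmbReebOrbit α) (θ : ℝ) (m n : ℤ) : Prop :=
  ∃ t φ : ℝ → ℝ, Continuous t ∧ Continuous φ ∧
    (∀ s, o.γ s = coord (t s, θ, φ s)) ∧
    (∀ s, t (s + o.T) = t s + 2 * Real.pi * m) ∧
    (∀ s, φ (s + o.T) = φ s + 2 * Real.pi * n)

/-- The linearized Reeb flow along the orbit, once around from `γ(0)`, takes the tangent vector
`v` to `w`. Here `X` is a smooth extension of the Reeb field to a neighbourhood of the orbit in
the ambient space, and `V` solves the equation of the Reeb flow linearized along the orbit; for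
`v` tangent to `S¹ × S²` the vector `w` does not depend on the extension. -/
def LinReturn (o : EmbReebOrbit α) (v w : Amb) : Prop :=
  ∃ (U : Set Amb) (X : Amb → Amb) (V : ℝ → Amb), IsOpen U ∧ o.image ⊆ U ∧
    ContDiffOn ℝ ∞ X U ∧ (∀ p ∈ U ∩ S1S2, α.IsReeb p (X p)) ∧
    V 0 = v ∧ V o.T = w ∧ ∀ s, HasDerivAt V (fderiv ℝ X (o.γ s) (V s)) s

/-- The orbit is (nondegenerate and) positive hyperbolic: the linearized return map on the contact
plane has real positive eigenvalues `μ, μ⁻¹` different from `1`. -/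
def IsPosHyperbolic (o : EmbReebOrbit α) : Prop :=
  ∃ (μ : ℝ) (v w : Amb), 0 < μ ∧ μ ≠ 1 ∧
    α.InPlane (o.γ 0) v ∧ α.InPlane (o.γ 0) w ∧ LinearIndependent ℝ ![v, w] ∧
    o.LinReturn v (μ • v) ∧ o.LinReturn w (μ⁻¹ • w)

/-- The orbit is elliptic with rotation number `ρ`, an irrational number that is determined modulo
`1`: in a basis of the contact plane that is positive for `dα`, the linearized return map is the
rotation by the angle `2πρ`. In particular the orbit and all its covers are nondegenerate. -/
def IsEllipticWith (o : EmbReebOrbit α) (ρ : ℝ) : Prop :=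
  Irrational ρ ∧ ∃ v w : Amb,
    α.InPlane (o.γ 0) v ∧ α.InPlane (o.γ 0) w ∧ 0 < α.d (o.γ 0) v w ∧
    o.LinReturn v (Real.cos (2 * Real.pi * ρ) • v + Real.sin (2 * Real.pi * ρ) • w) ∧
    o.LinReturn w (-Real.sin (2 * Real.pi * ρ) • v + Real.cos (2 * Real.pi * ρ) • w)

/-- The orbit is an `L`-positive elliptic orbit: its action is less than `L`, and its rotation
class is in `(0, action / L)` modulo `1`. -/
def IsLPositive (o : EmbReebOrbit α) (L : ℝ) : Prop :=
  o.action < L ∧ ∃ ρ ∈ Set.Ioo 0 (o.action / L), o.IsEllipticWith ρ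

end EmbReebOrbit

/-- `a₁'(θ) / a₂'(θ) ∈ ℚ ∪ {±∞}`. -/
def RationalSlope (a₁ a₂ : ℝ → ℝ) (θ : ℝ) : Prop :=
  deriv a₂ θ = 0 ∨ ∃ q : ℚ, deriv a₁ θ / deriv a₂ θ = q

/-- The condition `a' × a'' < 0` at all `θ ∈ (0, π)` at which the slope is rational. -/
def TechnicalCondition (a₁ a₂ : ℝ → ℝ) : Prop :=
  ∀ θ ∈ Set.Ioo 0 Real.pi, RationalSlope a₁ a₂ θ →
    deriv a₁ θ * deriv (deriv a₂) θ - deriv a₂ θ * deriv (deriv a₁) θ < 0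

/-- The angles `θ ∈ (0, π)` for which `T(θ)` carries closed Reeb orbits of `α` whose embedded
orbits have action less than `L`. -/
def lowTori (α : Form1) (L : ℝ) : Set ℝ :=
  {θ | θ ∈ Set.Ioo 0 Real.pi ∧ ∃ o : EmbReebOrbit α, o.image ⊆ torus θ ∧ o.action < L}

/-! Write `b = m a₁ + n a₂` and `Δ = a₁ a₂' - a₂ a₁'`; the orientation makes `Δ < 0` on `(0, π)`.
The Reeb field of `λ` is `(a₂' ∂_t - a₁' ∂_φ) / Δ`. Hence a torus with closed orbits of primitive
class `(m, n)` is a critical point of `b`, its orbits have period `2π b`, and the condition on `a' ×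
a''` becomes `b'' < 0` (`Form1.ClosedTorus.deriv_deriv_neg`). Only finitely many tori have action
below `L` (`finite_lowTori`): the contact condition, uniform up to the poles, bounds `m` and `n`,
and for fixed `(m, n)` the direction of `a'` can pass through the prescribed slope in one sense
only.

Near each of these tori let `f = -ε χ (1 + cos y)` with `y = n t - m φ` and a bump function `χ` of
`cos θ`. The Reeb flow then induces an autonomous system in `(θ, y)`, with `θ'` of order `ε` and
`y'` equal to `b' / Δ` up to order `ε`. Its equilibria with `θ = θ₀` and `sin y = 0` are closed Reeb
orbits of class `(m, n)`. With `E = e^{-f}`, the linearization on the contact plane is `Y' = (E b''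
/ Δ) Θ`, `Θ' = -cos y (E ε b / Δ) Y`: a saddle at `y = 0` and a centre at `y = π`. At the centre `f`
vanishes, so the action does not change, and the rotation number `ρ` satisfies `ρ² = ε (-b'') b³ /
Δ²`. Choosing `ε` makes `ρ` irrational, positive and smaller than action over `L`
(`exists_strength`).

There are no other short orbits. A periodic solution of period at most `L` of this slow system must
be constant (`eventually_equilibrium_of_periodic`): each speed vanishes once per period, so it is
bounded by its own oscillation, and iterating this estimate forces it to be zero. In a narrow strip
around `θ₀` the variable `y` is too slow to wind around the circle, and the only equilibria are the
expected ones (`eventually_rigid`). Where `f` vanishes the flow preserves `z`, so an orbit that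
meets this region lies in a torus of `λ` or over a pole (`EmbReebOrbit.vanishing_or_mem`); the torus
would be a low one, and low tori lie inside the supports. -/

/-! ### The coordinate map -/

namespace Amb

/-- The tangent vector `∂_t`, as a vector field on the ambient space. -/
noncomputable def vecT (p : Amb) : Amb := (Complex.I * p.1, 0, 0)

/-- The tangent vector `∂_φ`, as a vector field on the ambient space. -/
noncomputable def vecPhi (p : Amb) : Amb := (0, Complex.I * p.2.1, 0)

/-- The tangent vector `∂_θ`, as a vector field on the region `|z| < 1` of the ambient space. -/
noncomputable def vecTheta (p : Amb) : Amb :=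
  (0, ((p.2.2 / √(1 - p.2.2 ^ 2) : ℝ) : ℂ) * p.2.1, -√(1 - p.2.2 ^ 2))

theorem contDiff_coord : ContDiff ℝ ∞ coord := by
  have h : ∀ g : ℝ × ℝ × ℝ → ℝ, ContDiff ℝ ∞ g →
      ContDiff ℝ ∞ (fun q => Complex.exp ((g q : ℂ) * Complex.I)) := fun g hg =>
    ((Complex.ofRealCLM.contDiff.comp hg).mul contDiff_const).cexp
  unfold coord
  refine (h _ contDiff_fst).prodMk (ContDiff.prodMk ?_ ?_)
  · exact (Complex.ofRealCLM.contDiff.comp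
      (Real.contDiff_sin.comp (contDiff_fst.comp contDiff_snd))).mul
      (h _ (contDiff_snd.comp contDiff_snd))
  · exact Real.contDiff_cos.comp (contDiff_fst.comp contDiff_snd)

theorem hasFDerivAt_coord (q : ℝ × ℝ × ℝ) : HasFDerivAt coord (fderiv ℝ coord q) q :=
  (contDiff_coord.differentiable (by simp) q).hasFDerivAt

theorem fderiv_coord_apply (q v : ℝ × ℝ × ℝ) :
    fderiv ℝ coord q v =
      (Complex.I * v.1 * Complex.exp (q.1 * Complex.I),
       (Real.cos q.2.1 * v.2.1 : ℝ) * Complex.exp (q.2.2 * Complex.I) +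
         Complex.I * ((Real.sin q.2.1 * v.2.2 : ℝ) * Complex.exp (q.2.2 * Complex.I)),
       -Real.sin q.2.1 * v.2.1) := by
  have hline : HasDerivAt (fun s : ℝ => q + s • v) v 0 := by
    simpa using ((hasDerivAt_id (0 : ℝ)).smul_const v).const_add q
  have h1 : HasDerivAt (fun s : ℝ => coord (q + s • v)) (fderiv ℝ coord q v) 0 := by
    refine HasFDerivAt.comp_hasDerivAt (0 : ℝ) (l := coord) (f := fun s : ℝ => q + s • v) ?_ hline
    simpa using hasFDerivAt_coord q
  have hl : ∀ a b : ℝ, HasDerivAt (fun s : ℝ => a + s * b) b 0 := fun a b => by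
    simpa using ((hasDerivAt_id (0 : ℝ)).mul_const b).const_add a
  have he : ∀ a b : ℝ, HasDerivAt (fun s : ℝ => Complex.exp (((a + s * b : ℝ) : ℂ) * Complex.I))
      (Complex.exp (a * Complex.I) * (b * Complex.I)) 0 := fun a b => by
    simpa using ((hl a b).ofReal_comp.mul_const Complex.I).cexp
  have hs : HasDerivAt (fun s : ℝ => ((Real.sin (q.2.1 + s * v.2.1) : ℝ) : ℂ))
      ((Real.cos q.2.1 * v.2.1 : ℝ) : ℂ) 0 := by
    simpa using (hl q.2.1 v.2.1).sin.ofReal_comp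
  have hc : HasDerivAt (fun s : ℝ => Real.cos (q.2.1 + s * v.2.1))
      (-Real.sin q.2.1 * v.2.1) 0 := by
    simpa using (hl q.2.1 v.2.1).cos
  have h2 := (he q.1 v.1).prodMk ((hs.mul (he q.2.2 v.2.2)).prodMk hc)
  have h3 := h1.unique h2
  rw [h3]
  ext1
  · simp; ring
  · ext1
    · simp; ring
    · simp

theorem vecT_coord (q : ℝ × ℝ × ℝ) : vecT (coord q) = fderiv ℝ coord q (1, 0, 0) := by
  rw [fderiv_coord_apply]; simp [vecT, coord]

theorem vecPhi_coord (q : ℝ × ℝ × ℝ) : vecPhi (coord q) = fderiv ℝ coord q (0, 0, 1) := by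
  rw [fderiv_coord_apply]; simp [vecPhi, coord]

theorem sqrt_one_sub_cos_sq {θ : ℝ} (h : θ ∈ Set.Icc 0 Real.pi) :
    √(1 - Real.cos θ ^ 2) = Real.sin θ := by
  rw [← Real.sin_sq, Real.sqrt_sq (Real.sin_nonneg_of_mem_Icc h)]

theorem vecTheta_coord {q : ℝ × ℝ × ℝ} (h : q.2.1 ∈ Set.Ioo 0 Real.pi) :
    vecTheta (coord q) = fderiv ℝ coord q (0, 1, 0) := by
  have hs : (Real.sin q.2.1 : ℂ) ≠ 0 := by
    exact_mod_cast (Real.sin_pos_of_mem_Ioo h).ne'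
  rw [fderiv_coord_apply]
  simp only [vecTheta, coord, sqrt_one_sub_cos_sq (Set.Ioo_subset_Icc_self h)]
  ext1
  · simp
  · ext1
    · push_cast at hs ⊢
      field_simp
      simp
    · simp

theorem coord_mem (q : ℝ × ℝ × ℝ) : coord q ∈ S1S2 := by
  constructor
  · simp [coord, Complex.norm_exp_ofReal_mul_I]
  · simp only [coord, norm_mul, Complex.norm_exp_ofReal_mul_I, Complex.norm_real, mul_one,
      Real.norm_eq_abs, sq_abs, Real.sin_sq_add_cos_sq]

theorem exists_exp_eq_of_norm_eq_one {w : ℂ} (hw : ‖w‖ = 1) :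
    ∃ t : ℝ, w = Complex.exp (t * Complex.I) :=
  ⟨w.arg, by simpa [hw] using (Complex.norm_mul_exp_arg_mul_I w).symm⟩

theorem norm_snd_eq {p : Amb} (hp : p ∈ S1S2) : ‖p.2.1‖ = Real.sin (Real.arccos p.2.2) := by
  rw [Real.sin_arccos, ← hp.2]; simp

theorem abs_z_le_one {p : Amb} (hp : p ∈ S1S2) : |p.2.2| ≤ 1 := by
  rw [← sq_le_one_iff_abs_le_one]; nlinarith [hp.2, sq_nonneg ‖p.2.1‖]

theorem exists_coord_eq {p : Amb} (hp : p ∈ S1S2) (hz : |p.2.2| < 1) :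
    ∃ q : ℝ × ℝ × ℝ, q.2.1 ∈ Set.Ioo 0 Real.pi ∧ p = coord q := by
  obtain ⟨hz1, hz2⟩ := abs_lt.mp hz
  have hθ : Real.arccos p.2.2 ∈ Set.Ioo 0 Real.pi :=
    ⟨Real.arccos_pos.2 hz2, (Real.arccos_lt_pi).2 hz1⟩
  obtain ⟨t, ht⟩ := exists_exp_eq_of_norm_eq_one hp.1
  have hpos := Real.sin_pos_of_mem_Ioo hθ
  obtain ⟨φ, hφ⟩ := exists_exp_eq_of_norm_eq_one
    (w := p.2.1 / (Real.sin (Real.arccos p.2.2) : ℂ)) (by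
      rw [norm_div, norm_snd_eq hp, Complex.norm_real, Real.norm_of_nonneg hpos.le,
        div_self hpos.ne'])
  refine ⟨(t, Real.arccos p.2.2, φ), hθ, ?_⟩
  ext1
  · exact ht
  ext1
  · have : (Real.sin (Real.arccos p.2.2) : ℂ) ≠ 0 := by exact_mod_cast hpos.ne'
    simp only [coord]
    rw [← hφ, mul_div_cancel₀ _ this]
  · simp only [coord]
    rw [Real.cos_arccos hz1.le hz2.le]

theorem isTangent_fderiv_coord (q v : ℝ × ℝ × ℝ) : IsTangent (coord q) (fderiv ℝ coord q v) := by
  rw [fderiv_coord_apply]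
  constructor
  · simp [coord, cdot, Complex.exp_ofReal_mul_I_re, Complex.exp_ofReal_mul_I_im]; ring
  · simp only [coord, cdot, Complex.add_re, Complex.add_im, Complex.mul_re, Complex.mul_im,
      Complex.I_re, Complex.I_im, Complex.ofReal_re, Complex.ofReal_im,
      Complex.exp_ofReal_mul_I_re, Complex.exp_ofReal_mul_I_im]
    linear_combination (Real.sin q.2.1 * Real.cos q.2.1 * v.2.1) *
      Real.sin_sq_add_cos_sq q.2.2

theorem exists_fderiv_coord_eq {q : ℝ × ℝ × ℝ} (h : q.2.1 ∈ Set.Ioo 0 Real.pi) {v : Amb}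
    (hv : IsTangent (coord q) v) : ∃ ξ, v = fderiv ℝ coord q ξ := by
  have hs := (Real.sin_pos_of_mem_Ioo h).ne'
  obtain ⟨h1, h2⟩ := hv
  simp only [coord, cdot, Complex.mul_re, Complex.mul_im,
    Complex.ofReal_re, Complex.ofReal_im,
    Complex.exp_ofReal_mul_I_re, Complex.exp_ofReal_mul_I_im] at h1 h2
  have e1 := Real.sin_sq_add_cos_sq q.1
  have e2 := Real.sin_sq_add_cos_sq q.2.1
  have e3 := Real.sin_sq_add_cos_sq q.2.2
  refine ⟨(Real.cos q.1 * v.1.im - Real.sin q.1 * v.1.re, -v.2.2 / Real.sin q.2.1,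
    (Real.cos q.2.2 * v.2.1.im - Real.sin q.2.2 * v.2.1.re) / Real.sin q.2.1), ?_⟩
  rw [fderiv_coord_apply]
  -- Tangency to the sphere fixes the component of `v.2.1` along `e^{iφ}` in terms of `v.2.2`; the
  -- orthogonal component is the free `φ`-direction.
  have k : Real.cos q.2.2 * v.2.1.re + Real.sin q.2.2 * v.2.1.im =
      -(Real.cos q.2.1 / Real.sin q.2.1) * v.2.2 := by
    field_simp; linear_combination h2
  ext1
  · apply Complex.ext <;>
    simp only [Complex.mul_re, Complex.mul_im, Complex.I_re, Complex.I_im, Complex.ofReal_re,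
      Complex.ofReal_im, Complex.exp_ofReal_mul_I_re, Complex.exp_ofReal_mul_I_im]
    · linear_combination (-v.1.re) * e1 + Real.cos q.1 * h1
    · linear_combination (-v.1.im) * e1 + Real.sin q.1 * h1
  ext1
  · apply Complex.ext <;>
    simp only [Complex.add_re, Complex.add_im, Complex.mul_re, Complex.mul_im, Complex.I_re,
      Complex.I_im, Complex.ofReal_re, mul_div_cancel₀ _ hs,
      Complex.ofReal_im, Complex.exp_ofReal_mul_I_re, Complex.exp_ofReal_mul_I_im]
    · linear_combination (-v.2.1.re) * e3 + Real.cos q.2.2 * k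
    · linear_combination (-v.2.1.im) * e3 + Real.sin q.2.2 * k
  · simp only []
    field_simp

end Amb

/-! ### The Reeb field of `e^f λ` in coordinates -/

theorem contDiff_fderiv_coord : ContDiff ℝ ∞ (fderiv ℝ coord) :=
  contDiff_coord.fderiv_right (by simp)

theorem fderiv_fderiv_coord_symm (q v w : ℝ × ℝ × ℝ) :
    fderiv ℝ (fderiv ℝ coord) q v w = fderiv ℝ (fderiv ℝ coord) q w v :=
  second_derivative_symmetric (fun q => hasFDerivAt_coord q)
    (contDiff_fderiv_coord.differentiable (by simp) q).hasFDerivAt v w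

namespace Form1

/-- The exterior derivative commutes with the pullback by the coordinate map. -/
theorem d_coord {α : Form1} {q : ℝ × ℝ × ℝ} (hα : DifferentiableAt ℝ α (coord q))
    (v w : ℝ × ℝ × ℝ) :
    α.d (coord q) (fderiv ℝ coord q v) (fderiv ℝ coord q w) =
      fderiv ℝ (fun q => α (coord q) (fderiv ℝ coord q w)) q v -
      fderiv ℝ (fun q => α (coord q) (fderiv ℝ coord q v)) q w := by
  have key : ∀ v w : ℝ × ℝ × ℝ, fderiv ℝ (fun q => α (coord q) (fderiv ℝ coord q w)) q v =
      fderiv ℝ α (coord q) (fderiv ℝ coord q v) (fderiv ℝ coord q w) +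
      α (coord q) (fderiv ℝ (fderiv ℝ coord) q v w) := by
    intro v w
    have h1 : HasFDerivAt (fun q => α (coord q))
        ((fderiv ℝ α (coord q)).comp (fderiv ℝ coord q)) q :=
      hα.hasFDerivAt.comp q (hasFDerivAt_coord q)
    have h2 : HasFDerivAt (fderiv ℝ coord) (fderiv ℝ (fderiv ℝ coord) q) q :=
      (contDiff_fderiv_coord.differentiable (by simp) q).hasFDerivAt
    have h3 := h1.clm_apply (h2.clm_apply (hasFDerivAt_const w q))
    rw [h3.fderiv]
    simp [add_comm]
  -- The second derivative of `coord` enters both terms symmetrically and cancels.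
  rw [key, key, fderiv_fderiv_coord_symm q v w, d]
  ring

theorem rescale_zero (α : Form1) : rescale 0 α = α := by
  funext p; simp [rescale]

theorem contDiff_rescale {f : Amb → ℝ} {α : Form1} (hf : ContDiff ℝ ∞ f) (hα : ContDiff ℝ ∞ α) :
    ContDiff ℝ ∞ (rescale f α) :=
  (Real.contDiff_exp.comp hf).smul hα

/-- The form `α` is smooth and reads `a₁ dt + a₂ dφ` with `a₁`, `a₂` smooth on the whole line and
`a₁ a₂' - a₂ a₁'` negative on `(0, π)`. -/
structure Toric (α : Form1) (a₁ a₂ : ℝ → ℝ) : Prop where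
  smooth : ContDiff ℝ ∞ α
  smooth₁ : ContDiff ℝ ∞ a₁
  smooth₂ : ContDiff ℝ ∞ a₂
  coordExpr : α.HasCoordExpr a₁ a₂
  cross_neg : ∀ θ ∈ Set.Ioo 0 Real.pi, a₁ θ * deriv a₂ θ - a₂ θ * deriv a₁ θ < 0

/-- The components in the coordinates `(t, θ, φ)` of the Reeb field of `e^f (a₁ dt + a₂ dφ)`,
where `F` is `f` in coordinates. -/
noncomputable def reebVec (a₁ a₂ : ℝ → ℝ) (F : ℝ × ℝ × ℝ → ℝ) (q : ℝ × ℝ × ℝ) : ℝ × ℝ × ℝ :=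
  (Real.exp (-F q) / (a₁ q.2.1 * deriv a₂ q.2.1 - a₂ q.2.1 * deriv a₁ q.2.1)) •
    (deriv a₂ q.2.1 + fderiv ℝ F q (0, 1, 0) * a₂ q.2.1,
     a₁ q.2.1 * fderiv ℝ F q (0, 0, 1) - a₂ q.2.1 * fderiv ℝ F q (1, 0, 0),
     -deriv a₁ q.2.1 - fderiv ℝ F q (0, 1, 0) * a₁ q.2.1)

variable {lam : Form1} {a₁ a₂ : ℝ → ℝ} {f : Amb → ℝ} {q : ℝ × ℝ × ℝ}

theorem rescale_coord (h : lam.HasCoordExpr a₁ a₂) (hq : q.2.1 ∈ Set.Icc 0 Real.pi)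
    (v : ℝ × ℝ × ℝ) : rescale f lam (coord q) (fderiv ℝ coord q v) =
      Real.exp (f (coord q)) * (a₁ q.2.1 * v.1 + a₂ q.2.1 * v.2.2) := by
  simp [rescale, h q hq v]

theorem d_rescale_coord (hlam : ContDiff ℝ ∞ lam) (h₁ : ContDiff ℝ ∞ a₁) (h₂ : ContDiff ℝ ∞ a₂)
    (hc : lam.HasCoordExpr a₁ a₂) (hf : ContDiff ℝ ∞ f)
    (hq : q.2.1 ∈ Set.Ioo 0 Real.pi) (v w : ℝ × ℝ × ℝ) :
    (rescale f lam).d (coord q) (fderiv ℝ coord q v) (fderiv ℝ coord q w) =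
      Real.exp (f (coord q)) *
        (fderiv ℝ (f ∘ coord) q v * (a₁ q.2.1 * w.1 + a₂ q.2.1 * w.2.2)
        - fderiv ℝ (f ∘ coord) q w * (a₁ q.2.1 * v.1 + a₂ q.2.1 * v.2.2)
        + v.2.1 * (deriv a₁ q.2.1 * w.1 + deriv a₂ q.2.1 * w.2.2)
        - w.2.1 * (deriv a₁ q.2.1 * v.1 + deriv a₂ q.2.1 * v.2.2)) := by
  rw [d_coord ((contDiff_rescale hf hlam).differentiable (by simp) _)]
  have hU : ∀ᶠ q' in nhds q, q'.2.1 ∈ Set.Ioo 0 Real.pi :=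
    (continuous_fst.comp continuous_snd).continuousAt.eventually (isOpen_Ioo.mem_nhds hq)
  have key : ∀ v w : ℝ × ℝ × ℝ,
      fderiv ℝ (fun q => rescale f lam (coord q) (fderiv ℝ coord q w)) q v =
      Real.exp (f (coord q)) *
        (fderiv ℝ (f ∘ coord) q v * (a₁ q.2.1 * w.1 + a₂ q.2.1 * w.2.2)
        + v.2.1 * (deriv a₁ q.2.1 * w.1 + deriv a₂ q.2.1 * w.2.2)) := by
    intro v w
    have he : (fun q => rescale f lam (coord q) (fderiv ℝ coord q w)) =ᶠ[nhds q]
        fun q => Real.exp ((f ∘ coord) q) * (a₁ q.2.1 * w.1 + a₂ q.2.1 * w.2.2) := by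
      filter_upwards [hU] with q' hq'
      exact rescale_coord hc (Set.Ioo_subset_Icc_self hq') w
    rw [he.fderiv_eq]
    have hF : HasFDerivAt (f ∘ coord) (fderiv ℝ (f ∘ coord) q) q :=
      ((hf.comp contDiff_coord).differentiable (by simp) q).hasFDerivAt
    have hθ : HasFDerivAt (fun q : ℝ × ℝ × ℝ => q.2.1)
        ((ContinuousLinearMap.fst ℝ ℝ ℝ).comp (ContinuousLinearMap.snd ℝ ℝ (ℝ × ℝ))) q :=
      ((ContinuousLinearMap.fst ℝ ℝ ℝ).comp (ContinuousLinearMap.snd ℝ ℝ (ℝ × ℝ))).hasFDerivAt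
    have h1 : HasFDerivAt (fun q : ℝ × ℝ × ℝ => a₁ q.2.1) _ q :=
      ((h₁.differentiable (by simp) q.2.1).hasDerivAt).comp_hasFDerivAt q hθ
    have h2 : HasFDerivAt (fun q : ℝ × ℝ × ℝ => a₂ q.2.1) _ q :=
      ((h₂.differentiable (by simp) q.2.1).hasDerivAt).comp_hasFDerivAt q hθ
    have hprod : HasFDerivAt
        (fun q => Real.exp ((f ∘ coord) q) * (a₁ q.2.1 * w.1 + a₂ q.2.1 * w.2.2)) _ q :=
      hF.exp.mul ((h1.mul_const w.1).add (h2.mul_const w.2.2))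
    rw [hprod.fderiv]
    simp
    ring
  rw [key, key]
  ring

/-- Normalization and the equation against `∂_θ` form a linear system for the `t`- and
`φ`-components with determinant `Δ`. Combining the equations against `∂_t` and `∂_φ` with weights
`-a₂` and `a₁` eliminates `df(R)` and leaves the `θ`-component. -/
theorem eq_reebVec_of_isReeb (h : lam.Toric a₁ a₂) (hf : ContDiff ℝ ∞ f)
    (hq : q.2.1 ∈ Set.Ioo 0 Real.pi) {ξ : ℝ × ℝ × ℝ}
    (hR : (rescale f lam).IsReeb (coord q) (fderiv ℝ coord q ξ)) :
    ξ = reebVec a₁ a₂ (f ∘ coord) q := by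
  obtain ⟨-, h1, h2⟩ := hR
  have hΔ := (h.cross_neg _ hq).ne
  rw [rescale_coord h.coordExpr (Set.Ioo_subset_Icc_self hq)] at h1
  have hθ := h2 _ (isTangent_fderiv_coord q (0, 1, 0))
  have ht := h2 _ (isTangent_fderiv_coord q (1, 0, 0))
  have hφ := h2 _ (isTangent_fderiv_coord q (0, 0, 1))
  rw [d_rescale_coord h.smooth h.smooth₁ h.smooth₂ h.coordExpr hf hq] at hθ ht hφ
  have hE := (Real.exp_pos (f (coord q))).ne'
  have hl : a₁ q.2.1 * ξ.1 + a₂ q.2.1 * ξ.2.2 = Real.exp (-f (coord q)) := by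
    rw [Real.exp_neg]; field_simp; linear_combination h1
  replace hθ := (mul_eq_zero.mp hθ).resolve_left hE
  replace ht := (mul_eq_zero.mp ht).resolve_left hE
  replace hφ := (mul_eq_zero.mp hφ).resolve_left hE
  simp only [mul_zero, mul_one, add_zero, zero_add, zero_mul, sub_zero, one_mul, hl] at hθ ht hφ
  simp only [reebVec, Prod.smul_mk, smul_eq_mul, Function.comp_apply]
  generalize fderiv ℝ (f ∘ coord) q = dF at *
  ext1
  · simp only []
    rw [div_mul_eq_mul_div, eq_div_iff hΔ]
    linear_combination deriv a₂ q.2.1 * hl + a₂ q.2.1 * hθ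
  ext1
  · simp only []
    rw [div_mul_eq_mul_div, eq_div_iff hΔ]
    linear_combination (-a₂ q.2.1) * ht + a₁ q.2.1 * hφ
  · simp only []
    rw [div_mul_eq_mul_div, eq_div_iff hΔ]
    linear_combination (-deriv a₁ q.2.1) * hl - a₁ q.2.1 * hθ

theorem fderiv_apply_eq (F : ℝ × ℝ × ℝ → ℝ) (q v : ℝ × ℝ × ℝ) :
    fderiv ℝ F q v = v.1 * fderiv ℝ F q (1, 0, 0) + v.2.1 * fderiv ℝ F q (0, 1, 0) +
      v.2.2 * fderiv ℝ F q (0, 0, 1) := by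
  have : v = v.1 • ((1 : ℝ), (0 : ℝ), (0 : ℝ)) + v.2.1 • ((0 : ℝ), (1 : ℝ), (0 : ℝ)) +
      v.2.2 • ((0 : ℝ), (0 : ℝ), (1 : ℝ)) := by
    ext1
    · simp
    · ext1 <;> simp
  conv_lhs => rw [this]
  simp only [map_add, map_smul, smul_eq_mul]

theorem isReeb_reebVec (h : lam.Toric a₁ a₂) (hf : ContDiff ℝ ∞ f)
    (hq : q.2.1 ∈ Set.Ioo 0 Real.pi) :
    (rescale f lam).IsReeb (coord q) (fderiv ℝ coord q (reebVec a₁ a₂ (f ∘ coord) q)) := by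
  have hΔ := (h.cross_neg _ hq).ne
  refine ⟨isTangent_fderiv_coord _ _, ?_, ?_⟩
  · rw [rescale_coord h.coordExpr (Set.Ioo_subset_Icc_self hq)]
    simp only [reebVec, Prod.smul_mk, smul_eq_mul, Function.comp_apply, Real.exp_neg]
    field_simp
    ring
  · intro v hv
    obtain ⟨w, rfl⟩ := exists_fderiv_coord_eq hq hv
    rw [d_rescale_coord h.smooth h.smooth₁ h.smooth₂ h.coordExpr hf hq, fderiv_apply_eq (f ∘ coord) q w,
      fderiv_apply_eq (f ∘ coord) q (reebVec a₁ a₂ (f ∘ coord) q)]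
    simp only [reebVec, Prod.smul_mk, smul_eq_mul]
    generalize fderiv ℝ (f ∘ coord) q = dF at *
    field_simp
    ring

/-- The Reeb field of `e^f λ`, extended to the region `|z| < 1` of the ambient space. -/
noncomputable def reebField (a₁ a₂ : ℝ → ℝ) (f : Amb → ℝ) (p : Amb) : Amb :=
  (Real.exp (-f p) / (a₁ (Real.arccos p.2.2) * deriv a₂ (Real.arccos p.2.2) -
    a₂ (Real.arccos p.2.2) * deriv a₁ (Real.arccos p.2.2))) •
    ((deriv a₂ (Real.arccos p.2.2) + fderiv ℝ f p (vecTheta p) * a₂ (Real.arccos p.2.2)) • vecT p +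
     (a₁ (Real.arccos p.2.2) * fderiv ℝ f p (vecPhi p) -
      a₂ (Real.arccos p.2.2) * fderiv ℝ f p (vecT p)) • vecTheta p +
     (-deriv a₁ (Real.arccos p.2.2) - fderiv ℝ f p (vecTheta p) * a₁ (Real.arccos p.2.2)) •
      vecPhi p)

theorem reebField_coord (hf : ContDiff ℝ ∞ f) (hq : q.2.1 ∈ Set.Ioo 0 Real.pi) :
    reebField a₁ a₂ f (coord q) = fderiv ℝ coord q (reebVec a₁ a₂ (f ∘ coord) q) := by
  have hcos : Real.arccos (coord q).2.2 = q.2.1 := Real.arccos_cos hq.1.le hq.2.le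
  have hv : ∀ x y z : ℝ, fderiv ℝ coord q (x, y, z) = x • fderiv ℝ coord q (1, 0, 0) +
      y • fderiv ℝ coord q (0, 1, 0) + z • fderiv ℝ coord q (0, 0, 1) := by
    intro x y z
    rw [← map_smul, ← map_smul, ← map_smul, ← map_add, ← map_add]
    simp
  have hF : ∀ v, fderiv ℝ f (coord q) (fderiv ℝ coord q v) = fderiv ℝ (f ∘ coord) q v := by
    intro v
    rw [((hf.differentiable (by simp) _).hasFDerivAt.comp q (hasFDerivAt_coord q)).fderiv]
    rfl
  rw [reebField, hcos, vecT_coord, vecPhi_coord, vecTheta_coord hq, hF, hF, hF, reebVec,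
    map_smul, hv (_ + _)]
  rfl

/-- `LinReturn` asks for a field that is smooth on an ambient open set. The region `|z| < 1` serves
for all orbits off the poles, because `arccos z` and `√(1 - z²)` are smooth there. -/
theorem contDiffOn_reebField (h : lam.Toric a₁ a₂) (hf : ContDiff ℝ ∞ f) :
    ContDiffOn ℝ ∞ (reebField a₁ a₂ f) {p | |p.2.2| < 1} := by
  intro p hp
  apply ContDiffAt.contDiffWithinAt
  replace hp : |p.2.2| < 1 := hp
  obtain ⟨h1, h2⟩ := abs_lt.mp hp
  have hθ : Real.arccos p.2.2 ∈ Set.Ioo 0 Real.pi := ⟨Real.arccos_pos.2 h2, Real.arccos_lt_pi.2 h1⟩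
  have hz : ContDiffAt ℝ ∞ (fun p : Amb => p.2.2) p :=
    (contDiff_snd.comp contDiff_snd).contDiffAt
  have hu : ContDiffAt ℝ ∞ (fun p : Amb => p.2.1) p :=
    (contDiff_fst.comp contDiff_snd).contDiffAt
  have hac : ContDiffAt ℝ ∞ (fun p : Amb => Real.arccos p.2.2) p :=
    ContDiffAt.comp (g := Real.arccos) p (Real.contDiffAt_arccos h1.ne' h2.ne) hz
  have hd : ∀ {g : ℝ → ℝ}, ContDiff ℝ ∞ g → ContDiff ℝ ∞ (deriv g) := fun {g} hg =>
    (contDiff_infty_iff_deriv.mp hg).2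
  have hg : ∀ {g : ℝ → ℝ}, ContDiff ℝ ∞ g →
      ContDiffAt ℝ ∞ (fun p : Amb => g (Real.arccos p.2.2)) p := fun {g} hg =>
    hg.contDiffAt.comp p hac
  have hsq : ContDiffAt ℝ ∞ (fun p : Amb => √(1 - p.2.2 ^ 2)) p := by
    refine (contDiffAt_const.sub (hz.pow 2)).sqrt ?_
    have : p.2.2 ^ 2 < 1 := by rw [sq_lt_one_iff_abs_lt_one]; exact hp
    exact (sub_pos.2 this).ne'
  have hsq0 : √(1 - p.2.2 ^ 2) ≠ 0 := by
    have : p.2.2 ^ 2 < 1 := by rw [sq_lt_one_iff_abs_lt_one]; exact hp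
    exact (Real.sqrt_pos.2 (sub_pos.2 this)).ne'
  have hT : ContDiffAt ℝ ∞ vecT p :=
    (contDiffAt_const.mul contDiffAt_fst).prodMk contDiffAt_const
  have hPhi : ContDiffAt ℝ ∞ vecPhi p :=
    contDiffAt_const.prodMk ((contDiffAt_const.mul hu).prodMk contDiffAt_const)
  have hTheta : ContDiffAt ℝ ∞ vecTheta p :=
    contDiffAt_const.prodMk (((Complex.ofRealCLM.contDiff.contDiffAt.comp p
      (hz.div hsq hsq0)).mul hu).prodMk hsq.neg)
  have hdf : ∀ {v : Amb → Amb}, ContDiffAt ℝ ∞ v p →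
      ContDiffAt ℝ ∞ (fun p => fderiv ℝ f p (v p)) p := fun {v} hv =>
    (hf.fderiv_right (m := ∞) (by simp)).contDiffAt.clm_apply hv
  have s1 := hg h.smooth₁
  have s2 := hg h.smooth₂
  have d1 := hg (hd h.smooth₁)
  have d2 := hg (hd h.smooth₂)
  unfold reebField
  refine ContDiffAt.smul (ContDiffAt.div (Real.contDiff_exp.contDiffAt.comp p hf.contDiffAt.neg)
    ((s1.mul d2).sub (s2.mul d1)) (h.cross_neg _ hθ).ne) ?_
  exact (((d2.add ((hdf hTheta).mul s2)).smul hT).add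
    (((s1.mul (hdf hPhi)).sub (s2.mul (hdf hT))).smul hTheta)).add
    ((d1.neg.sub ((hdf hTheta).mul s1)).smul hPhi)

theorem isReeb_reebField (h : lam.Toric a₁ a₂) (hf : ContDiff ℝ ∞ f) {p : Amb} (hp : p ∈ S1S2)
    (hz : |p.2.2| < 1) : (rescale f lam).IsReeb p (reebField a₁ a₂ f p) := by
  obtain ⟨q, hq, rfl⟩ := exists_coord_eq hp hz
  rw [reebField_coord hf hq]
  exact isReeb_reebVec h hf hq

end Form1

section orbits

/-! ### Lifting Reeb orbits to coordinates -/

/-- The covering `exp` gives a continuous lift; near each `s` it equals `g s + log (w / w s)`, hence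
it is differentiable. -/
theorem exists_differentiable_lift_circle {w : ℝ → ℂ} (hw : Differentiable ℝ w)
    (h1 : ∀ s, ‖w s‖ = 1) :
    ∃ t : ℝ → ℝ, Differentiable ℝ t ∧ ∀ s, w s = Complex.exp (t s * Complex.I) := by
  have h0 : ∀ s, w s ≠ 0 := fun s hs => by simpa [hs] using h1 s
  obtain ⟨⟨g, hgc⟩, ⟨-, hg⟩, -⟩ := Complex.isCoveringMapOn_exp.existsUnique_continuousMap_lifts
    ⟨w, hw.continuous⟩ (a₀ := (0 : ℝ)) (Complex.exp_log (h0 0)) h0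
  replace hg : ∀ s, Complex.exp (g s) = w s := fun s => congrFun hg s
  have hre : ∀ s, (g s).re = 0 := fun s => by
    have := h1 s
    rw [← hg s, Complex.norm_exp] at this
    exact Real.exp_eq_one_iff _ |>.mp this
  have hgd : Differentiable ℝ g := by
    intro s
    have hev : ∀ᶠ x in nhds s, g x = g s + Complex.log (w x / w s) := by
      have : ∀ᶠ x in nhds s, ‖g x - g s‖ < 1 := by
        have hc : Continuous fun x => ‖g x - g s‖ := (hgc.sub continuous_const).norm
        exact hc.continuousAt.eventually_lt continuousAt_const (by simp)
      filter_upwards [this] with x hx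
      have him : |(g x - g s).im| < 1 := (Complex.abs_im_le_norm _).trans_lt hx
      obtain ⟨hi1, hi2⟩ := abs_lt.mp him
      rw [← hg x, ← hg s, ← Complex.exp_sub, Complex.log_exp]
      · ring
      · linarith [Real.pi_gt_three]
      · linarith [Real.pi_gt_three]
    refine DifferentiableAt.congr_of_eventuallyEq ?_ hev
    refine (differentiableAt_const _).add
      (HasDerivAt.clog_real ((hw s).hasDerivAt.div_const _) ?_).differentiableAt
    rw [div_self (h0 s)]
    exact Complex.one_mem_slitPlane
  refine ⟨fun s => (g s).im, fun s => Complex.imCLM.differentiableAt.comp s (hgd s), fun s => ?_⟩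
  rw [← hg s]
  congr 1
  apply Complex.ext <;> simp [hre]

namespace Amb

theorem exists_differentiable_lift {γ : ℝ → Amb} (hγ : Differentiable ℝ γ)
    (hmem : ∀ s, γ s ∈ S1S2) (hz : ∀ s, |(γ s).2.2| < 1) :
    ∃ q : ℝ → ℝ × ℝ × ℝ, Differentiable ℝ q ∧ (∀ s, γ s = coord (q s)) ∧
      ∀ s, (q s).2.1 = Real.arccos (γ s).2.2 := by
  have hzd : Differentiable ℝ fun s => (γ s).2.2 := hγ.snd.snd
  have hud : Differentiable ℝ fun s => (γ s).2.1 := hγ.snd.fst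
  have hθ : ∀ s, Real.arccos (γ s).2.2 ∈ Set.Ioo 0 Real.pi := fun s =>
    ⟨Real.arccos_pos.2 (abs_lt.mp (hz s)).2, Real.arccos_lt_pi.2 (abs_lt.mp (hz s)).1⟩
  have hθd : Differentiable ℝ fun s => Real.arccos (γ s).2.2 := fun s =>
    DifferentiableAt.comp (g := Real.arccos) s
      (Real.differentiableAt_arccos.2 ⟨(abs_lt.mp (hz s)).1.ne', (abs_lt.mp (hz s)).2.ne⟩) (hzd s)
  have hpos := fun s => Real.sin_pos_of_mem_Ioo (hθ s)
  have hne : ∀ s, ((Real.sin (Real.arccos (γ s).2.2) : ℝ) : ℂ) ≠ 0 := fun s => by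
    exact_mod_cast (hpos s).ne'
  obtain ⟨t, htd, ht⟩ := exists_differentiable_lift_circle hγ.fst (fun s => (hmem s).1)
  obtain ⟨φ, hφd, hφ⟩ := exists_differentiable_lift_circle
    (w := fun s => (γ s).2.1 / ((Real.sin (Real.arccos (γ s).2.2) : ℝ) : ℂ))
    (fun s => (hud s).div (Complex.ofRealCLM.differentiableAt.comp s (hθd s).sin) (hne s))
    (fun s => by
      rw [norm_div, norm_snd_eq (hmem s), Complex.norm_real, Real.norm_of_nonneg (hpos s).le,
        div_self (hpos s).ne'])
  refine ⟨fun s => (t s, Real.arccos (γ s).2.2, φ s), htd.prodMk (hθd.prodMk hφd), fun s => ?_,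
    fun s => rfl⟩
  ext1
  · exact ht s
  ext1
  · simp only [coord]
    rw [← hφ s, mul_div_cancel₀ _ (hne s)]
  · simp only [coord]
    rw [Real.cos_arccos (abs_lt.mp (hz s)).1.le (abs_lt.mp (hz s)).2.le]

theorem exp_ofReal_mul_I_eq_iff {x y : ℝ} :
    Complex.exp (x * Complex.I) = Complex.exp (y * Complex.I) ↔
      ∃ k : ℤ, x = y + 2 * Real.pi * k := by
  rw [Complex.exp_eq_exp_iff_exists_int]
  refine exists_congr fun k => ⟨fun h => ?_, fun h => ?_⟩
  · have := congrArg Complex.im h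
    simp at this
    linarith
  · rw [h]; push_cast; ring

theorem coord_eq_coord_iff {q q' : ℝ × ℝ × ℝ} (hq : q.2.1 ∈ Set.Ioo 0 Real.pi)
    (hq' : q'.2.1 ∈ Set.Ioo 0 Real.pi) :
    coord q = coord q' ↔ q.2.1 = q'.2.1 ∧ (∃ k : ℤ, q.1 = q'.1 + 2 * Real.pi * k) ∧
      ∃ k : ℤ, q.2.2 = q'.2.2 + 2 * Real.pi * k := by
  rw [← exp_ofReal_mul_I_eq_iff, ← exp_ofReal_mul_I_eq_iff]
  constructor
  · intro h
    have h1 := congrArg (fun p : Amb => p.1) h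
    have h2 := congrArg (fun p : Amb => p.2.1) h
    have h3 := congrArg (fun p : Amb => p.2.2) h
    simp only [coord] at h1 h2 h3
    have hθ := Real.injOn_cos (Set.Ioo_subset_Icc_self hq) (Set.Ioo_subset_Icc_self hq') h3
    refine ⟨hθ, h1, ?_⟩
    rw [hθ] at h2
    exact mul_left_cancel₀ (by exact_mod_cast (Real.sin_pos_of_mem_Ioo hq').ne') h2
  · rintro ⟨h1, h2, h3⟩
    simp only [coord, h1, h2, h3]

end Amb

namespace EmbReebOrbit

theorem differentiable {α : Form1} (o : EmbReebOrbit α) : Differentiable ℝ o.γ := fun s => by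
  obtain ⟨R, -, hR⟩ := o.reeb s
  exact hR.differentiableAt

theorem isReeb_deriv {α : Form1} (o : EmbReebOrbit α) (s : ℝ) :
    α.IsReeb (o.γ s) (deriv o.γ s) := by
  obtain ⟨R, h, hR⟩ := o.reeb s
  rwa [hR.deriv]

theorem action_eq {α : Form1} (o : EmbReebOrbit α) : o.action = o.T := by
  have : ∀ s, α (o.γ s) (deriv o.γ s) = 1 := fun s => (o.isReeb_deriv s).2.1
  simp [action, this]

variable {lam : Form1} {a₁ a₂ : ℝ → ℝ} {f : Amb → ℝ}

theorem exists_lift (h : lam.Toric a₁ a₂) (hf : ContDiff ℝ ∞ f)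
    (o : EmbReebOrbit (Form1.rescale f lam)) (hz : ∀ s, |(o.γ s).2.2| < 1) :
    ∃ q : ℝ → ℝ × ℝ × ℝ, (∀ s, o.γ s = coord (q s)) ∧ (∀ s, (q s).2.1 ∈ Set.Ioo 0 Real.pi) ∧
      (∀ s, (q s).2.1 = Real.arccos (o.γ s).2.2) ∧
      ∀ s, HasDerivAt q (Form1.reebVec a₁ a₂ (f ∘ coord) (q s)) s := by
  obtain ⟨q, hqd, hq, hθ⟩ := exists_differentiable_lift o.differentiable o.mem hz
  have hI : ∀ s, (q s).2.1 ∈ Set.Ioo 0 Real.pi := fun s => by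
    rw [hθ]
    exact ⟨Real.arccos_pos.2 (abs_lt.mp (hz s)).2, Real.arccos_lt_pi.2 (abs_lt.mp (hz s)).1⟩
  refine ⟨q, hq, hI, hθ, fun s => ?_⟩
  have hd := (hqd s).hasDerivAt
  have hγ : HasDerivAt o.γ (fderiv ℝ coord (q s) (deriv q s)) s := by
    have := (hasFDerivAt_coord (q s)).comp_hasDerivAt s hd
    rwa [← (funext hq : o.γ = coord ∘ q)] at this
  have hR := o.isReeb_deriv s
  rw [hγ.deriv, hq] at hR
  rwa [← Form1.eq_reebVec_of_isReeb h hf (hI s) hR]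

theorem exists_int_of_lift {α : Form1} (o : EmbReebOrbit α) {q : ℝ → ℝ × ℝ × ℝ}
    (hq : ∀ s, o.γ s = coord (q s)) (hI : ∀ s, (q s).2.1 ∈ Set.Ioo 0 Real.pi) (s : ℝ) :
    (q (s + o.T)).2.1 = (q s).2.1 ∧ (∃ k : ℤ, (q (s + o.T)).1 = (q s).1 + 2 * Real.pi * k) ∧
      ∃ k : ℤ, (q (s + o.T)).2.2 = (q s).2.2 + 2 * Real.pi * k := by
  rw [← coord_eq_coord_iff (hI _) (hI _), ← hq, ← hq, o.periodic]

end EmbReebOrbit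

theorem eq_add_mul_of_hasDerivAt_const {g : ℝ → ℝ} {c : ℝ} (h : ∀ s, HasDerivAt g c s) (s : ℝ) :
    g s = g 0 + c * s := by
  have h2 : ∀ s, HasDerivAt (fun s => g s - c * s) 0 s := fun s => by
    have := (h s).sub ((hasDerivAt_id s).const_mul c)
    rw [mul_one, sub_self] at this
    exact this
  have := is_const_of_deriv_eq_zero (fun s => (h2 s).differentiableAt) (fun s => (h2 s).deriv) s 0
  simp only [mul_zero, sub_zero] at this
  linarith

/-! ### Reeb orbits of `λ` in the tori `T(θ)` -/

namespace Form1

theorem reebVec_zero (a₁ a₂ : ℝ → ℝ) (q : ℝ × ℝ × ℝ) : reebVec a₁ a₂ ((0 : Amb → ℝ) ∘ coord) q =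
    (deriv a₂ q.2.1 / (a₁ q.2.1 * deriv a₂ q.2.1 - a₂ q.2.1 * deriv a₁ q.2.1), 0,
     -deriv a₁ q.2.1 / (a₁ q.2.1 * deriv a₂ q.2.1 - a₂ q.2.1 * deriv a₁ q.2.1)) := by
  have : ((0 : Amb → ℝ) ∘ coord) = fun _ => 0 := rfl
  simp [reebVec, this, div_eq_inv_mul]

/-- The torus `T(θ)` is foliated by closed orbits in the primitive class `(m, n)`; their period is
`2 π (m a₁(θ) + n a₂(θ))`. -/
structure ClosedTorus (a₁ a₂ : ℝ → ℝ) (θ : ℝ) (m n : ℤ) : Prop where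
  mem : θ ∈ Set.Ioo 0 Real.pi
  coprime : IsCoprime m n
  pos : 0 < m * a₁ θ + n * a₂ θ
  reeb₁ : deriv a₂ θ / (a₁ θ * deriv a₂ θ - a₂ θ * deriv a₁ θ) = m / (m * a₁ θ + n * a₂ θ)
  reeb₂ : -deriv a₁ θ / (a₁ θ * deriv a₂ θ - a₂ θ * deriv a₁ θ) = n / (m * a₁ θ + n * a₂ θ)

end Form1

variable {lam : Form1} {a₁ a₂ : ℝ → ℝ} {θ : ℝ}

theorem abs_cos_lt_one {θ : ℝ} (h : θ ∈ Set.Ioo 0 Real.pi) : |Real.cos θ| < 1 := by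
  rw [← sq_lt_one_iff_abs_lt_one]
  nlinarith [Real.sin_sq_add_cos_sq θ, Real.sin_pos_of_mem_Ioo h]

theorem EmbReebOrbit.exists_linear_lift (h : lam.Toric a₁ a₂) (hθ : θ ∈ Set.Ioo 0 Real.pi)
    (o : EmbReebOrbit lam) (ho : o.image ⊆ torus θ) :
    ∃ t₀ φ₀ : ℝ, ∀ s, o.γ s =
      coord (t₀ + deriv a₂ θ / (a₁ θ * deriv a₂ θ - a₂ θ * deriv a₁ θ) * s, θ,
        φ₀ + -deriv a₁ θ / (a₁ θ * deriv a₂ θ - a₂ θ * deriv a₁ θ) * s) := by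
  have hz : ∀ s, (o.γ s).2.2 = Real.cos θ := fun s => (ho ⟨s, rfl⟩).2
  obtain ⟨q, hq, hI, hac, hd⟩ : ∃ q : ℝ → ℝ × ℝ × ℝ, (∀ s, o.γ s = coord (q s)) ∧
      (∀ s, (q s).2.1 ∈ Set.Ioo 0 Real.pi) ∧
      (∀ s, (q s).2.1 = Real.arccos (o.γ s).2.2) ∧
      ∀ s, HasDerivAt q (Form1.reebVec a₁ a₂ ((0 : Amb → ℝ) ∘ coord) (q s)) s := by
    -- The lifting result concerns orbits of a rescaled form, so `λ` is read as its rescaling by `f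
    -- = 0`.
    revert o
    rw [← lam.rescale_zero]
    intro o ho hz
    exact o.exists_lift h contDiff_const (fun s => by rw [hz]; exact abs_cos_lt_one hθ)
  have hθ' : ∀ s, (q s).2.1 = θ := fun s => by
    rw [hac, hz, Real.arccos_cos hθ.1.le hθ.2.le]
  simp only [Form1.reebVec_zero, hθ'] at hd
  refine ⟨(q 0).1, (q 0).2.2, fun s => ?_⟩
  rw [hq, ← eq_add_mul_of_hasDerivAt_const (fun s => (hd s).fst),
    ← eq_add_mul_of_hasDerivAt_const (fun s => (hd s).snd.snd), ← hθ' s]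

theorem coord_line_eq_iff (hθ : θ ∈ Set.Ioo 0 Real.pi) {t₀ φ₀ A B s s' : ℝ} :
    coord (t₀ + A * s, θ, φ₀ + B * s) = coord (t₀ + A * s', θ, φ₀ + B * s') ↔
      (∃ k : ℤ, A * (s - s') = 2 * Real.pi * k) ∧ ∃ k : ℤ, B * (s - s') = 2 * Real.pi * k := by
  rw [coord_eq_coord_iff hθ hθ]
  simp only [true_and]
  refine and_congr (exists_congr fun k => ?_) (exists_congr fun k => ?_) <;>
  constructor <;> intro h <;> linarith

theorem EmbReebOrbit.exists_closedTorus (h : lam.Toric a₁ a₂) (hθ : θ ∈ Set.Ioo 0 Real.pi)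
    (o : EmbReebOrbit lam) (ho : o.image ⊆ torus θ) :
    ∃ m n : ℤ, Form1.ClosedTorus a₁ a₂ θ m n := by
  obtain ⟨t₀, φ₀, hγ⟩ := o.exists_linear_lift h hθ ho
  have hΔ := h.cross_neg θ hθ
  set Δ := a₁ θ * deriv a₂ θ - a₂ θ * deriv a₁ θ with hΔ'
  set A := deriv a₂ θ / Δ with hA
  set B := -deriv a₁ θ / Δ with hB
  have hAB : a₁ θ * A + a₂ θ * B = 1 := by
    rw [hA, hB]; field_simp [hΔ.ne]; rw [hΔ']; ring
  have hT := o.T_pos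
  have hper : o.γ o.T = o.γ 0 := by simpa using o.periodic 0
  rw [hγ, hγ, coord_line_eq_iff hθ] at hper
  obtain ⟨⟨m, hm⟩, n, hn⟩ := hper
  rw [sub_zero] at hm hn
  have hpi := Real.pi_pos
  have hb : 2 * Real.pi * (m * a₁ θ + n * a₂ θ) = o.T := by
    linear_combination (-a₁ θ) * hm - a₂ θ * hn + o.T * hAB
  have hbpos : 0 < m * a₁ θ + n * a₂ θ := by
    by_contra hcon
    push Not at hcon
    nlinarith
  refine ⟨m, n, hθ, ?_, hbpos, ?_, ?_⟩
  · rw [Int.isCoprime_iff_gcd_eq_one]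
    have hd0 : Int.gcd m n ≠ 0 := by
      intro h0
      rw [Int.gcd_eq_zero_iff] at h0
      simp [h0.1, h0.2] at hbpos
    -- If `d = gcd (m, n)` were at least `2`, the orbit would already close up at time `T / d`,
    -- against injectivity.
    by_contra h1
    have hd2 : 2 ≤ Int.gcd m n := by omega
    obtain ⟨m', hm'⟩ := Int.gcd_dvd_left m n
    obtain ⟨n', hn'⟩ := Int.gcd_dvd_right m n
    set d := Int.gcd m n
    have hdr : (2 : ℝ) ≤ d := by exact_mod_cast hd2
    have hd0' : (d : ℝ) ≠ 0 := by positivity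
    have e : o.γ (o.T / d) = o.γ 0 := by
      rw [hγ, hγ, coord_line_eq_iff hθ]
      refine ⟨⟨m', ?_⟩, ⟨n', ?_⟩⟩
      · rw [sub_zero, ← mul_div_assoc, hm, hm']; push_cast; field_simp
      · rw [sub_zero, ← mul_div_assoc, hn, hn']; push_cast; field_simp
    have hlt : o.T / d < o.T := div_lt_self hT (by linarith)
    have := o.inj ⟨by positivity, hlt⟩ ⟨le_rfl, hT⟩ e
    have hp : 0 < o.T / d := by positivity
    exact hp.ne' this
  · rw [eq_div_iff hbpos.ne']
    have : 2 * Real.pi * (A * (m * a₁ θ + n * a₂ θ)) = 2 * Real.pi * m := by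
      rw [← hm, ← hb]; ring
    exact mul_left_cancel₀ (by positivity) this
  · rw [eq_div_iff hbpos.ne']
    have : 2 * Real.pi * (B * (m * a₁ θ + n * a₂ θ)) = 2 * Real.pi * n := by
      rw [← hn, ← hb]; ring
    exact mul_left_cancel₀ (by positivity) this

namespace Form1.ClosedTorus

variable {m n : ℤ}

theorem period_eq (hc : ClosedTorus a₁ a₂ θ m n) (h : lam.Toric a₁ a₂) (o : EmbReebOrbit lam)
    (ho : o.image ⊆ torus θ) : o.T = 2 * Real.pi * (m * a₁ θ + n * a₂ θ) := by
  obtain ⟨t₀, φ₀, hγ⟩ := o.exists_linear_lift h hc.mem ho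
  rw [hc.reeb₁, hc.reeb₂] at hγ
  have hb := hc.pos
  set b := m * a₁ θ + n * a₂ θ
  have hT := o.T_pos
  have hpi := Real.pi_pos
  have key : ∀ s s', o.γ s = o.γ s' ↔ ∃ k : ℤ, s - s' = 2 * Real.pi * b * k := by
    intro s s'
    rw [hγ, hγ, coord_line_eq_iff hc.mem]
    constructor
    · rintro ⟨⟨k, hk⟩, l, hl⟩
      -- Bézout coefficients merge the two integrality conditions, on the `t`- and
      -- `φ`-displacements, into one multiple of `2π b`.
      obtain ⟨p, q, hpq⟩ := hc.coprime
      have hpq' : (p * m + q * n : ℝ) = 1 := by exact_mod_cast hpq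
      refine ⟨p * k + q * l, ?_⟩
      push_cast
      field_simp at hk hl
      linear_combination p * hk + q * hl - (s - s') * hpq'
    · rintro ⟨k, hk⟩
      refine ⟨⟨m * k, ?_⟩, ⟨n * k, ?_⟩⟩ <;> rw [hk] <;> push_cast <;> field_simp
  obtain ⟨k, hk⟩ := (key o.T 0).mp (by simpa using o.periodic 0)
  rw [sub_zero] at hk
  have hbp : 0 < 2 * Real.pi * b := by positivity
  have hk1 : 1 ≤ k := by
    by_contra hcon
    have : (k : ℝ) ≤ 0 := by exact_mod_cast (by omega : k ≤ 0)
    nlinarith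
  have hk2 : k ≤ 1 := by
    by_contra hcon
    have h2 : (2 : ℝ) ≤ k := by exact_mod_cast (by omega : 2 ≤ k)
    have hlt : 2 * Real.pi * b < o.T := by rw [hk]; nlinarith
    have := o.inj ⟨hbp.le, hlt⟩ ⟨le_rfl, hT⟩ ((key _ _).2 ⟨1, by simp⟩)
    exact hbp.ne' this
  have : k = 1 := le_antisymm hk2 hk1
  rw [hk, this]; simp

theorem hasClass (hc : ClosedTorus a₁ a₂ θ m n) (h : lam.Toric a₁ a₂) (o : EmbReebOrbit lam)
    (ho : o.image ⊆ torus θ) : o.HasClass θ m n := by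
  obtain ⟨t₀, φ₀, hγ⟩ := o.exists_linear_lift h hc.mem ho
  rw [hc.reeb₁, hc.reeb₂] at hγ
  have hb := hc.pos.ne'
  refine ⟨_, _, ?_, ?_, hγ, fun s => ?_, fun s => ?_⟩
  · fun_prop
  · fun_prop
  · rw [hc.period_eq h o ho]; field_simp; ring
  · rw [hc.period_eq h o ho]; field_simp; ring

/-- The Reeb direction `(a₂', -a₁')` is parallel to `(m, n)`, which says that `θ` is critical for `b
= m a₁ + n a₂`. -/
theorem deriv_eq_zero (hc : ClosedTorus a₁ a₂ θ m n) (h : lam.Toric a₁ a₂) :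
    m * deriv a₁ θ + n * deriv a₂ θ = 0 := by
  have hΔ := (h.cross_neg θ hc.mem).ne
  have h1 := hc.reeb₁
  have h2 := hc.reeb₂
  have hb := hc.pos.ne'
  rw [div_eq_div_iff hΔ hb] at h1 h2
  have := mul_left_cancel₀ hΔ (a := a₁ θ * deriv a₂ θ - a₂ θ * deriv a₁ θ)
    (b := m * deriv a₁ θ + n * deriv a₂ θ) (c := 0)
    (by linear_combination (-deriv a₁ θ) * h1 - deriv a₂ θ * h2)
  exact this

/-- Substituting the closing relations `a₂' b = m Δ` and `-a₁' b = n Δ` gives `Δ b'' = -b (a' ×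
a'')`. The right side is positive and `Δ < 0`. -/
theorem deriv_deriv_neg (hc : ClosedTorus a₁ a₂ θ m n) (h : lam.Toric a₁ a₂)
    (htech : TechnicalCondition a₁ a₂) :
    m * deriv (deriv a₁) θ + n * deriv (deriv a₂) θ < 0 := by
  have hΔ := h.cross_neg θ hc.mem
  have h1 := hc.reeb₁
  have h2 := hc.reeb₂
  have hb := hc.pos
  rw [div_eq_div_iff hΔ.ne hb.ne'] at h1 h2
  have hrat : RationalSlope a₁ a₂ θ := by
    by_cases h0 : deriv a₂ θ = 0
    · exact Or.inl h0
    · right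
      have hm : (m : ℝ) ≠ 0 := by
        intro hm
        have hz : deriv a₂ θ * (m * a₁ θ + n * a₂ θ) = 0 := by rw [h1, hm, zero_mul]
        exact mul_ne_zero h0 hb.ne' hz
      refine ⟨-n / m, ?_⟩
      push_cast
      rw [div_eq_div_iff h0 hm]
      linear_combination hc.deriv_eq_zero h
  have ht := htech θ hc.mem hrat
  set b := m * a₁ θ + n * a₂ θ
  set Δ := a₁ θ * deriv a₂ θ - a₂ θ * deriv a₁ θ
  have : Δ * (m * deriv (deriv a₁) θ + n * deriv (deriv a₂) θ) =
      -b * (deriv a₁ θ * deriv (deriv a₂) θ - deriv a₂ θ * deriv (deriv a₁) θ) := by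
    linear_combination (-deriv (deriv a₁) θ) * h1 - deriv (deriv a₂) θ * h2
  have hpos : 0 < Δ * (m * deriv (deriv a₁) θ + n * deriv (deriv a₂) θ) := by
    rw [this]; nlinarith
  by_contra hcon
  push Not at hcon
  nlinarith

end Form1.ClosedTorus

end orbits

/-! ### Smooth extension of the coefficients, and their behaviour at the poles -/

theorem deriv_eq_zero_of_symm {g : ℝ → ℝ} {c : ℝ} (hg : DifferentiableAt ℝ g c)
    (h : ∀ᶠ x in nhds 0, g (c + x) = g (c - x)) : deriv g c = 0 := by
  have h1 : HasDerivAt (fun x => g (c + x)) (deriv g c) 0 := by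
    have hg' : HasDerivAt g (deriv g c) (c + 0) := by simpa using hg.hasDerivAt
    exact hg'.comp_const_add c 0
  have h2 : HasDerivAt (fun x => g (c - x)) (-deriv g c) 0 := by
    have hg' : HasDerivAt g (deriv g c) (c - 0) := by simpa using hg.hasDerivAt
    exact hg'.comp_const_sub c 0
  have := (h1.congr_of_eventuallyEq (h.mono fun x hx => hx.symm)).unique h2
  linarith

/-- The mean value inequality bounds `g` by a multiple of the distance to either endpoint, and
Jordan's inequality bounds the distance to the nearer endpoint by `(π / 2) sin θ`. -/
theorem abs_le_mul_sin_of_deriv {g : ℝ → ℝ} (hg : ContDiff ℝ ∞ g) (h0 : g 0 = 0)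
    (hpi : g Real.pi = 0) :
    ∃ C > 0, ∀ θ ∈ Set.Icc 0 Real.pi, |g θ| ≤ C * Real.sin θ := by
  have hp := Real.pi_pos
  have hc : Continuous (deriv g) := (contDiff_infty_iff_deriv.mp hg).2.continuous
  obtain ⟨C, hC⟩ := isCompact_Icc.exists_bound_of_continuousOn (s := Set.Icc 0 Real.pi)
    hc.continuousOn
  have hC0 : 0 ≤ C := (norm_nonneg _).trans (hC 0 ⟨le_rfl, hp.le⟩)
  have hlip : ∀ x ∈ Set.Icc 0 Real.pi, ∀ y ∈ Set.Icc 0 Real.pi, |g y - g x| ≤ C * |y - x| :=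
    fun x hx y hy => (convex_Icc 0 Real.pi).norm_image_sub_le_of_norm_deriv_le
      (fun z _ => hg.differentiable (by simp) z) hC hx hy
  refine ⟨(C + 1) * (Real.pi / 2), by positivity, fun θ hθ => ?_⟩
  have l0 := hlip 0 ⟨le_rfl, hp.le⟩ θ hθ
  have l1 := hlip Real.pi ⟨hp.le, le_rfl⟩ θ hθ
  rw [h0, sub_zero, sub_zero, abs_of_nonneg hθ.1] at l0
  rw [hpi, sub_zero, abs_sub_comm, abs_of_nonneg (sub_nonneg.2 hθ.2)] at l1
  have hs := Real.sin_nonneg_of_mem_Icc hθ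
  have key : ∀ x, 0 ≤ x → x ≤ Real.pi / 2 → x ≤ Real.pi / 2 * Real.sin x := by
    intro x hx hx2
    have := Real.mul_le_sin hx hx2
    calc x = Real.pi / 2 * (2 / Real.pi * x) := by field_simp
      _ ≤ _ := by gcongr
  rcases le_total θ (Real.pi / 2) with h | h
  · have := key θ hθ.1 h
    nlinarith
  · have := key (Real.pi - θ) (by linarith [hθ.2]) (by linarith)
    rw [Real.sin_pi_sub] at this
    nlinarith

namespace Form1

/-- The data of a toric contact form together with the vanishing of its coefficients at the
poles. -/
structure PolarToric (α : Form1) (a₁ a₂ : ℝ → ℝ) : Prop extends Toric α a₁ a₂ where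
  a₂_zero : a₂ 0 = 0
  a₂_pi : a₂ Real.pi = 0
  bound₁ : ∃ C > 0, ∀ θ ∈ Set.Icc 0 Real.pi, |deriv a₁ θ| ≤ C * Real.sin θ
  bound₂ : ∃ C > 0, ∀ θ ∈ Set.Icc 0 Real.pi, |deriv a₂ θ| ≤ C * Real.sin θ
  cross_le : ∃ c > 0, ∀ θ ∈ Set.Ioo 0 Real.pi,
    a₁ θ * deriv a₂ θ - a₂ θ * deriv a₁ θ ≤ -(c * Real.sin θ)

variable {lam : Form1} {a₁ a₂ : ℝ → ℝ}

/-- Evaluating `λ` along the full meridian circle gives a function smooth on all of `ℝ`. It is even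
about both poles, whence the vanishing derivatives there. -/
theorem exists_extension (hlam : ContDiff ℝ ∞ lam) (hc : lam.HasCoordExpr a₁ a₂)
    (v : ℝ × ℝ × ℝ) (hv : v.2.1 = 0) :
    ∃ b : ℝ → ℝ, ContDiff ℝ ∞ b ∧
      (∀ θ ∈ Set.Icc 0 Real.pi, b θ = a₁ θ * v.1 + a₂ θ * v.2.2) ∧
      deriv b 0 = 0 ∧ deriv b Real.pi = 0 := by
  have hline : ContDiff ℝ ∞ fun θ : ℝ => ((0 : ℝ), θ, (0 : ℝ)) := by fun_prop
  set b : ℝ → ℝ := fun θ => lam (coord (0, θ, 0)) (fderiv ℝ coord (0, θ, 0) v) with hb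
  have hsm : ContDiff ℝ ∞ b :=
    (hlam.comp (contDiff_coord.comp hline)).clm_apply
      ((contDiff_fderiv_coord.comp hline).clm_apply contDiff_const)
  have heq : ∀ θ ∈ Set.Icc 0 Real.pi, b θ = a₁ θ * v.1 + a₂ θ * v.2.2 := fun θ hθ =>
    hc (0, θ, 0) hθ v
  -- Crossing a pole along the meridian amounts to reflecting `θ` and replacing `φ = 0` by `φ = π`,
  -- and the coefficients of `λ` do not depend on `φ`.
  have hneg : ∀ θ θ', Real.sin θ' = -Real.sin θ → Real.cos θ' = Real.cos θ →
      θ ∈ Set.Icc 0 Real.pi → b θ' = b θ := by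
    intro θ θ' hs hco hθ
    rw [heq θ hθ, ← hc (0, θ, Real.pi) hθ v, hb]
    simp only [fderiv_coord_apply]
    simp only [coord, hs, hco, hv, Complex.exp_pi_mul_I]
    simp
  have hnear : ∀ᶠ x : ℝ in nhds 0, |x| < Real.pi :=
    continuous_abs.continuousAt.eventually_lt continuousAt_const (by simpa using Real.pi_pos)
  refine ⟨b, hsm, heq, ?_, ?_⟩
  · refine deriv_eq_zero_of_symm (hsm.differentiable (by simp) 0) ?_
    filter_upwards [hnear] with x hx
    obtain ⟨h1, h2⟩ := abs_lt.mp hx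
    rcases le_total 0 x with h | h
    · exact (hneg _ _ (by simp) (by simp) ⟨by linarith, by linarith⟩).symm
    · exact hneg _ _ (by simp) (by simp) ⟨by linarith, by linarith⟩
  · refine deriv_eq_zero_of_symm (hsm.differentiable (by simp) _) ?_
    filter_upwards [hnear] with x hx
    obtain ⟨h1, h2⟩ := abs_lt.mp hx
    have e1 : ∀ x, Real.sin (Real.pi + x) = -Real.sin x := fun x => by
      rw [add_comm, Real.sin_add_pi]
    have e2 : ∀ x, Real.cos (Real.pi + x) = -Real.cos x := fun x => by
      rw [add_comm, Real.cos_add_pi]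
    rcases le_total 0 x with h | h
    · exact hneg _ _ (by rw [e1, Real.sin_pi_sub]) (by rw [e2, Real.cos_pi_sub])
        ⟨by linarith, by linarith⟩
    · exact (hneg _ _ (by rw [e1, Real.sin_pi_sub, neg_neg]) (by rw [e2, Real.cos_pi_sub])
        ⟨by linarith, by linarith⟩).symm

/-- The quantity `κ` is `λ ∧ dλ` on the positive frame `∂_t`, `∂_φ / sin θ`, `∂_θ`. Along a meridian
this frame extends continuously over the poles, so `κ` has a positive minimum on `[0, π]`, while
`sin θ · κ = -Δ`. -/
theorem cross_le_of_isPosContact (h₁ : ContDiff ℝ ∞ a₁) (h₂ : ContDiff ℝ ∞ a₂)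
    (hc : lam.HasCoordExpr a₁ a₂) (hpos : lam.IsPosContact) :
    ∃ c > 0, ∀ θ ∈ Set.Ioo 0 Real.pi,
      a₁ θ * deriv a₂ θ - a₂ θ * deriv a₁ θ ≤ -(c * Real.sin θ) := by
  obtain ⟨hlam, hpos⟩ := hpos
  set P : ℝ → Amb := fun θ => coord (0, θ, 0) with hP
  set V : ℝ → Amb := fun θ => fderiv ℝ coord (0, θ, 0) (0, 1, 0) with hV
  set v₁ : Amb := (Complex.I, 0, 0) with hv₁
  set v₃ : Amb := (0, Complex.I, 0) with hv₃
  have hV' : ∀ θ, V θ = (0, (Real.cos θ : ℂ), -Real.sin θ) := fun θ => by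
    simp [hV, fderiv_coord_apply]
  have hP' : ∀ θ, P θ = (1, (Real.sin θ : ℂ), Real.cos θ) := fun θ => by
    simp [hP, coord]
  have hv₁' : ∀ θ, fderiv ℝ coord (0, θ, 0) (1, 0, 0) = v₁ := fun θ => by
    simp [fderiv_coord_apply, hv₁]
  have hv₃' : ∀ θ : ℝ, fderiv ℝ coord (0, θ, 0) (0, 0, 1) = Real.sin θ • v₃ := fun θ => by
    simp [fderiv_coord_apply, hv₃, mul_comm]
  set κ : ℝ → ℝ := fun θ => lam (P θ) v₁ * lam.d (P θ) v₃ (V θ) +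
    lam (P θ) v₃ * lam.d (P θ) (V θ) v₁ + lam (P θ) (V θ) * lam.d (P θ) v₁ v₃ with hκ
  have hline : Continuous fun θ : ℝ => ((0 : ℝ), θ, (0 : ℝ)) := by fun_prop
  have cP : Continuous P := contDiff_coord.continuous.comp hline
  have cV : Continuous V :=
    (contDiff_fderiv_coord.continuous.comp hline).clm_apply continuous_const
  have cl : Continuous fun θ => lam (P θ) := hlam.continuous.comp cP
  have cd : Continuous fun θ => fderiv ℝ lam (P θ) :=
    (hlam.continuous_fderiv (by simp)).comp cP
  have cκ : Continuous κ := by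
    have cv : ∀ {v : ℝ → Amb}, Continuous v → Continuous fun θ => lam (P θ) (v θ) := fun hv =>
      cl.clm_apply hv
    have cdv : ∀ {v w : ℝ → Amb}, Continuous v → Continuous w →
        Continuous fun θ => lam.d (P θ) (v θ) (w θ) := fun hv hw =>
      ((cd.clm_apply hv).clm_apply hw).sub ((cd.clm_apply hw).clm_apply hv)
    have c₁ : Continuous fun _ : ℝ => v₁ := continuous_const
    have c₃ : Continuous fun _ : ℝ => v₃ := continuous_const
    exact (((cv c₁).mul (cdv c₃ cV)).add ((cv c₃).mul (cdv cV c₁))).add ((cv cV).mul (cdv c₁ c₃))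
  have κpos : ∀ θ, 0 < κ θ := by
    intro θ
    have e := Real.sin_sq_add_cos_sq θ
    refine hpos (P θ) (coord_mem _) v₁ v₃ (V θ) ?_ ?_ (isTangent_fderiv_coord _ _) ?_
    · rw [hP']; simp [IsTangent, cdot, hv₁]
    · rw [hP']; simp [IsTangent, cdot, hv₃, -Complex.ofReal_sin]
    · rw [hP', hV']
      simp [vol, dt, area, hv₁, hv₃, Matrix.det_fin_three, -Complex.ofReal_sin,
        -Complex.ofReal_cos]
      nlinarith
  obtain ⟨θ₀, -, hmin⟩ := isCompact_Icc.exists_isMinOn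
    (Set.nonempty_Icc.2 Real.pi_pos.le) cκ.continuousOn
  refine ⟨κ θ₀, κpos θ₀, fun θ hθ => ?_⟩
  have hs := Real.sin_pos_of_mem_Ioo hθ
  have hκθ : κ θ₀ ≤ κ θ := hmin (Set.Ioo_subset_Icc_self hθ)
  have hq : ((0 : ℝ), θ, (0 : ℝ)).2.1 ∈ Set.Icc 0 Real.pi := Set.Ioo_subset_Icc_self hθ
  have hd := fun v w => d_rescale_coord (f := 0) (q := (0, θ, 0)) hlam h₁ h₂ hc contDiff_const hθ
    v w
  have hF : fderiv ℝ ((0 : Amb → ℝ) ∘ coord) (0, θ, 0) = 0 := by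
    have : ((0 : Amb → ℝ) ∘ coord) = fun _ => 0 := rfl
    rw [this]; simp
  simp only [rescale_zero, hF] at hd
  have smul_d : ∀ (r : ℝ) (p v w : Amb), lam.d p (r • v) w = r * lam.d p v w ∧
      lam.d p v (r • w) = r * lam.d p v w := by
    intro r p v w
    simp [d, mul_sub]
  have key : Real.sin θ * κ θ = -(a₁ θ * deriv a₂ θ - a₂ θ * deriv a₁ θ) := by
    have k1 : lam (P θ) v₁ = a₁ θ := by rw [← hv₁' θ, hP, hc _ hq]; simp
    have k3 : Real.sin θ * lam (P θ) v₃ = a₂ θ := by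
      rw [← smul_eq_mul, ← map_smul, ← hv₃' θ, hP, hc _ hq]; simp
    have k2 : lam (P θ) (V θ) = 0 := by rw [hV, hP, hc _ hq]; simp
    have k4 : Real.sin θ * lam.d (P θ) v₃ (V θ) = -deriv a₂ θ := by
      rw [← (smul_d _ _ _ _).1, ← hv₃' θ, hV, hP, hd]; simp
    have k5 : lam.d (P θ) (V θ) v₁ = deriv a₁ θ := by
      rw [← hv₁' θ, hV, hP, hd]; simp
    simp only [hκ, k1, k2, k5]
    linear_combination a₁ θ * k4 + deriv a₁ θ * k3
  nlinarith

/-- The given coefficients matter only on `[0, π]`, so they may be replaced by smooth extensions;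
interior first and second derivatives, and with them the technical condition, are unchanged. -/
theorem exists_polarToric (hc : lam.HasCoordExpr a₁ a₂) (hpos : lam.IsPosContact)
    (htech : TechnicalCondition a₁ a₂) :
    ∃ b₁ b₂ : ℝ → ℝ, lam.PolarToric b₁ b₂ ∧ TechnicalCondition b₁ b₂ := by
  obtain ⟨b₁, hb₁, e₁, z₁, p₁⟩ := exists_extension hpos.1 hc (1, 0, 0) rfl
  obtain ⟨b₂, hb₂, e₂, z₂, p₂⟩ := exists_extension hpos.1 hc (0, 0, 1) rfl
  simp only [mul_one, mul_zero, add_zero, zero_add] at e₁ e₂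
  have hc' : lam.HasCoordExpr b₁ b₂ := fun q hq v => by rw [e₁ _ hq, e₂ _ hq, hc q hq v]
  have hev : ∀ {a b : ℝ → ℝ}, (∀ θ ∈ Set.Icc 0 Real.pi, b θ = a θ) →
      ∀ θ ∈ Set.Ioo 0 Real.pi, deriv b θ = deriv a θ ∧ deriv (deriv b) θ = deriv (deriv a) θ := by
    intro a b h θ hθ
    have : b =ᶠ[nhds θ] a := by
      filter_upwards [isOpen_Ioo.mem_nhds hθ] with x hx using h x (Set.Ioo_subset_Icc_self hx)
    exact ⟨this.deriv_eq, this.deriv.deriv_eq⟩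
  have hcross := cross_le_of_isPosContact hb₁ hb₂ hc' hpos
  have hd : ∀ {g : ℝ → ℝ}, ContDiff ℝ ∞ g → ContDiff ℝ ∞ (deriv g) := fun {g} hg =>
    (contDiff_infty_iff_deriv.mp hg).2
  -- Over a pole the coordinate vector `∂_φ` is mapped to zero, so the coefficient of `dφ` vanishes
  -- there.
  have hpole : ∀ c, c ∈ Set.Icc 0 Real.pi → Real.sin c = 0 → b₂ c = 0 := by
    intro c hcm hs
    have := hc' (0, c, 0) hcm (0, 0, 1)
    rw [fderiv_coord_apply] at this
    simp only [hs] at this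
    have h0 : ((0, 0, 0) : Amb) = 0 := rfl
    simpa [h0] using this.symm
  refine ⟨b₁, b₂, ⟨⟨hpos.1, hb₁, hb₂, hc', ?_⟩, ?_, ?_, ?_, ?_, hcross⟩, ?_⟩
  · obtain ⟨c, hc0, hcr⟩ := hcross
    intro θ hθ
    have := mul_pos hc0 (Real.sin_pos_of_mem_Ioo hθ)
    linarith [hcr θ hθ]
  · exact hpole 0 ⟨le_rfl, Real.pi_pos.le⟩ Real.sin_zero
  · exact hpole _ ⟨Real.pi_pos.le, le_rfl⟩ Real.sin_pi
  · exact abs_le_mul_sin_of_deriv (hd hb₁) z₁ p₁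
  · exact abs_le_mul_sin_of_deriv (hd hb₂) z₂ p₂
  · intro θ hθ hr
    rw [RationalSlope, (hev e₁ θ hθ).1, (hev e₂ θ hθ).1] at hr
    rw [(hev e₁ θ hθ).1, (hev e₂ θ hθ).1, (hev e₁ θ hθ).2, (hev e₂ θ hθ).2]
    exact htech θ hθ hr

end Form1

section finiteness

/-! ### Finiteness of the set of low tori -/

/-- A function cannot have two zeros if its derivative is positive at each zero. -/
theorem not_zero_zero_of_deriv_pos {g g' : ℝ → ℝ} {x y : ℝ} (hxy : x < y)
    (hg : ∀ z ∈ Set.Icc x y, HasDerivAt g (g' z) z)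
    (hpos : ∀ z ∈ Set.Icc x y, g z = 0 → 0 < g' z) (hx : g x = 0) (hy : g y = 0) : False := by
  have hnn : ∀ z ∈ Set.Icc x y, 0 ≤ g z := by
    intro z hz
    -- A fencing argument: the zero function cannot cross above `g`, since wherever they meet `g`
    -- has the larger derivative. At the right endpoint a positive derivative would make `g`
    -- negative just before it, which contradicts this.
    refine image_le_of_deriv_right_lt_deriv_boundary' (f := fun _ => (0 : ℝ)) (f' := fun _ => 0)
      (B := g) (B' := g') continuousOn_const (fun z _ => hasDerivWithinAt_const _ _ _) hx.ge
      (fun z hz => (hg z hz).continuousAt.continuousWithinAt)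
      (fun z hz => (hg z (Set.Ico_subset_Icc_self hz)).hasDerivWithinAt)
      (fun z hz h => hpos z (Set.Ico_subset_Icc_self hz) h.symm) hz
  have hyI : y ∈ Set.Icc x y := ⟨hxy.le, le_rfl⟩
  have h1 := (hasDerivAt_iff_tendsto_slope_left_right.mp (hg y hyI)).1
  have h2 : ∀ᶠ z in nhdsWithin y (Set.Iio y), 0 < slope g y z :=
    h1.eventually (lt_mem_nhds (hpos y hyI hy))
  have h3 : ∀ᶠ z in nhdsWithin y (Set.Iio y), z ∈ Set.Ioo x y := Ioo_mem_nhdsLT hxy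
  obtain ⟨z, hz1, hz2⟩ := (h2.and h3).exists
  rw [slope_def_field, hy, sub_zero] at hz1
  have := hnn z (Set.Ioo_subset_Icc_self hz2)
  have h4 : g z / (z - y) ≤ 0 := div_nonpos_of_nonneg_of_nonpos this (by linarith [hz2.2])
  linarith

variable {lam : Form1} {a₁ a₂ : ℝ → ℝ}

theorem rationalSlope_of_int {m n : ℤ} {θ : ℝ} (hmn : m ≠ 0 ∨ n ≠ 0)
    (h : m * deriv a₁ θ + n * deriv a₂ θ = 0) : RationalSlope a₁ a₂ θ := by
  by_cases h0 : deriv a₂ θ = 0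
  · exact Or.inl h0
  · have hm : (m : ℝ) ≠ 0 := by
      intro hm
      rw [hm, zero_mul, zero_add, mul_eq_zero, or_iff_left h0] at h
      rcases hmn with h1 | h1
      · exact h1 (by exact_mod_cast hm)
      · exact h1 (by exact_mod_cast h)
    refine Or.inr ⟨-n / m, ?_⟩
    push_cast
    rw [div_eq_div_iff h0 hm]
    linear_combination h

/-- On an interval where `a₁'` does not vanish, `a₂' / a₁'` has derivative `(a' × a'') / a₁'²`,
which is negative wherever the slope is `-m / n`; so this slope is attained at most once. If instead
`a₂'` does not vanish, the reciprocal slope is increasing at each such point. -/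
theorem no_two_parallel (h₁ : ContDiff ℝ ∞ a₁) (h₂ : ContDiff ℝ ∞ a₂)
    (htech : TechnicalCondition a₁ a₂) {m n : ℤ} (hmn : m ≠ 0 ∨ n ≠ 0) {x y : ℝ} (hxy : x < y)
    (hsub : Set.Icc x y ⊆ Set.Ioo 0 Real.pi)
    (hne : (∀ z ∈ Set.Icc x y, deriv a₁ z ≠ 0) ∨ ∀ z ∈ Set.Icc x y, deriv a₂ z ≠ 0)
    (hx : m * deriv a₁ x + n * deriv a₂ x = 0) (hy : m * deriv a₁ y + n * deriv a₂ y = 0) :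
    False := by
  have hdd : ∀ {g : ℝ → ℝ}, ContDiff ℝ ∞ g → ∀ z, HasDerivAt (deriv g) (deriv (deriv g) z) z :=
    fun hg z => ((contDiff_infty_iff_deriv.mp hg).2.differentiable (by simp) z).hasDerivAt
  have hxI : x ∈ Set.Icc x y := ⟨le_rfl, hxy.le⟩
  have hyI : y ∈ Set.Icc x y := ⟨hxy.le, le_rfl⟩
  rcases hne with hne | hne
  · have hn : (n : ℝ) ≠ 0 := by
      intro hn
      rw [hn, zero_mul, add_zero, mul_eq_zero, or_iff_left (hne x hxI)] at hx
      rcases hmn with h1 | h1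
      · exact h1 (by exact_mod_cast hx)
      · exact h1 (by exact_mod_cast hn)
    have hz : ∀ z ∈ Set.Icc x y, -(deriv a₂ z / deriv a₁ z + m / n) = 0 ↔
        m * deriv a₁ z + n * deriv a₂ z = 0 := by
      intro z hz
      have := hne z hz
      rw [neg_eq_zero, div_add_div _ _ this hn, div_eq_zero_iff, or_iff_left (by positivity)]
      constructor <;> intro h <;> linear_combination h
    refine not_zero_zero_of_deriv_pos hxy (fun z hz => (((hdd h₂ z).div (hdd h₁ z)
      (hne z hz)).add_const ((m : ℝ) / n)).neg) (fun z hzI h0 => ?_) ((hz x hxI).2 hx)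
      ((hz y hyI).2 hy)
    have := htech z (hsub hzI) (rationalSlope_of_int hmn ((hz z hzI).1 h0))
    have h2 := hne z hzI
    rw [← neg_div]
    apply div_pos _ (by positivity)
    linarith
  · have hm : (m : ℝ) ≠ 0 := by
      intro hm
      rw [hm, zero_mul, zero_add, mul_eq_zero, or_iff_left (hne x hxI)] at hx
      rcases hmn with h1 | h1
      · exact h1 (by exact_mod_cast hm)
      · exact h1 (by exact_mod_cast hx)
    have hz : ∀ z ∈ Set.Icc x y, deriv a₁ z / deriv a₂ z + n / m = 0 ↔
        m * deriv a₁ z + n * deriv a₂ z = 0 := by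
      intro z hz
      have := hne z hz
      rw [div_add_div _ _ this hm, div_eq_zero_iff, or_iff_left (by positivity)]
      constructor <;> intro h <;> linear_combination h
    refine not_zero_zero_of_deriv_pos hxy (fun z hz => (((hdd h₁ z).div (hdd h₂ z)
      (hne z hz)).add_const ((n : ℝ) / m))) (fun z hzI h0 => ?_) ((hz x hxI).2 hx)
      ((hz y hyI).2 hy)
    have := htech z (hsub hzI) (rationalSlope_of_int hmn ((hz z hzI).1 h0))
    have h2 := hne z hzI
    apply div_pos _ (by positivity)
    linarith

/-- Every point of the compact interval `[0, π]`, poles included, has a neighbourhood on whose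
interior angles one of `a₁'`, `a₂'` does not vanish; `no_two_parallel` allows at most one solution
in it. -/
theorem finite_parallel (h : lam.PolarToric a₁ a₂) (htech : TechnicalCondition a₁ a₂) {m n : ℤ}
    (hmn : m ≠ 0 ∨ n ≠ 0) :
    {θ | θ ∈ Set.Ioo 0 Real.pi ∧ m * deriv a₁ θ + n * deriv a₂ θ = 0}.Finite := by
  set S := {θ | θ ∈ Set.Ioo 0 Real.pi ∧ m * deriv a₁ θ + n * deriv a₂ θ = 0}
  have c₁ : Continuous (deriv a₁) := (contDiff_infty_iff_deriv.mp h.smooth₁).2.continuous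
  have c₂ : Continuous (deriv a₂) := (contDiff_infty_iff_deriv.mp h.smooth₂).2.continuous
  have hloc : ∀ θ₀ ∈ Set.Icc 0 Real.pi,
      (∀ᶠ z in nhds θ₀, z ∈ Set.Ioo 0 Real.pi → deriv a₁ z ≠ 0) ∨
      (∀ᶠ z in nhds θ₀, z ∈ Set.Ioo 0 Real.pi → deriv a₂ z ≠ 0) := by
    intro θ₀ hθ₀
    by_cases hI : θ₀ ∈ Set.Ioo 0 Real.pi
    · by_cases h0 : deriv a₁ θ₀ = 0
      · right
        have : deriv a₂ θ₀ ≠ 0 := by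
          intro h2
          have := h.cross_neg θ₀ hI
          simp [h0, h2] at this
        exact (c₂.continuousAt.eventually_ne this).mono fun z hz _ => hz
      · left
        exact (c₁.continuousAt.eventually_ne h0).mono fun z hz _ => hz
    · right
      have h2 : a₂ θ₀ = 0 := by
        have : θ₀ = 0 ∨ θ₀ = Real.pi := by
          by_contra hcon
          push Not at hcon
          exact hI ⟨lt_of_le_of_ne hθ₀.1 hcon.1.symm, lt_of_le_of_ne hθ₀.2 hcon.2⟩
        rcases this with rfl | rfl
        · exact h.a₂_zero
        · exact h.a₂_pi
      -- At a pole `a₂ = 0`. A nearby zero of `a₂'` would give `|Δ| = |a₂ a₁'| ≤ |a₂| C sin z`, less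
      -- than the lower bound `c sin z`.
      obtain ⟨C, hC0, hC⟩ := h.bound₁
      obtain ⟨c, hc0, hc⟩ := h.cross_le
      have hev : ∀ᶠ z in nhds θ₀, |a₂ z| * C < c := by
        have : Continuous fun z => |a₂ z| * C := (h.smooth₂.continuous.abs).mul continuous_const
        exact this.continuousAt.eventually_lt continuousAt_const (by simpa [h2] using hc0)
      filter_upwards [hev] with z hz hzI h0
      have hs := Real.sin_pos_of_mem_Ioo hzI
      have k1 := hc z hzI
      rw [h0, mul_zero, zero_sub, neg_le_neg_iff] at k1
      have k2 : a₂ z * deriv a₁ z ≤ |a₂ z| * (C * Real.sin z) := by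
        refine (le_abs_self _).trans ?_
        rw [abs_mul]
        exact mul_le_mul_of_nonneg_left (hC z (Set.Ioo_subset_Icc_self hzI)) (abs_nonneg _)
      nlinarith
  have hfin : (Set.Icc 0 Real.pi ∩ S).Finite := by
    refine isCompact_Icc.induction_on (p := fun U => (U ∩ S).Finite) (by simp)
      (fun s t hst ht => ht.subset (Set.inter_subset_inter_left _ hst))
      (fun s t hs ht => by rw [Set.union_inter_distrib_right]; exact hs.union ht) ?_
    intro θ₀ hθ₀
    have hex : ∃ r > 0, ∀ x ∈ Metric.ball θ₀ r, ∀ y ∈ Metric.ball θ₀ r,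
        x ∈ S → y ∈ S → ¬ x < y := by
      rcases hloc θ₀ hθ₀ with hl | hl <;>
      · obtain ⟨r, hr, hball⟩ := Metric.eventually_nhds_iff_ball.mp hl
        refine ⟨r, hr, fun x hx y hy hxS hyS hxy => ?_⟩
        have hsub : Set.Icc x y ⊆ Set.Ioo 0 Real.pi := fun z hz =>
          ⟨hxS.1.1.trans_le hz.1, hz.2.trans_lt hyS.1.2⟩
        have hsub2 : Set.Icc x y ⊆ Metric.ball θ₀ r := by
          rw [Real.ball_eq_Ioo] at hx hy ⊢
          exact fun z hz => ⟨hx.1.trans_le hz.1, hz.2.trans_lt hy.2⟩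
        refine no_two_parallel h.smooth₁ h.smooth₂ htech hmn hxy hsub ?_ hxS.2 hyS.2
        first
          | exact Or.inl fun z hz => hball z (hsub2 hz) (hsub hz)
          | exact Or.inr fun z hz => hball z (hsub2 hz) (hsub hz)
    obtain ⟨r, hr, hx⟩ := hex
    refine ⟨Metric.ball θ₀ r, mem_nhdsWithin_of_mem_nhds (Metric.ball_mem_nhds _ hr), ?_⟩
    refine Set.Subsingleton.finite fun x hx1 y hy1 => ?_
    exact le_antisymm (not_lt.1 (hx y hy1.1 x hx1.1 hy1.2 hx1.2))
      (not_lt.1 (hx x hx1.1 y hy1.1 hx1.2 hy1.2))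
  refine hfin.subset fun θ hθ => ⟨Set.Ioo_subset_Icc_self hθ.1, hθ⟩

/-- The closing relations read `a₂' b = m Δ` and `-a₁' b = n Δ`. With `|aᵢ'| ≤ Cᵢ sin θ`, `|Δ| ≥ c
sin θ` and `b ≤ L` the factor `sin θ` cancels, leaving a bound on `(m, n)` that is uniform up to the
poles; `finite_parallel` treats each class. -/
theorem finite_lowTori (h : lam.PolarToric a₁ a₂) (htech : TechnicalCondition a₁ a₂) (L : ℝ) :
    (lowTori lam L).Finite := by
  obtain ⟨C₁, hC₁0, hC₁⟩ := h.bound₁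
  obtain ⟨C₂, hC₂0, hC₂⟩ := h.bound₂
  obtain ⟨c, hc0, hc⟩ := h.cross_le
  set M : ℤ := ⌈L * (max C₁ C₂) / c⌉
  have hfin : (⋃ mn ∈ (Set.Icc (-M) M ×ˢ Set.Icc (-M) M) ∩ {mn : ℤ × ℤ | mn.1 ≠ 0 ∨ mn.2 ≠ 0},
      {θ | θ ∈ Set.Ioo 0 Real.pi ∧ (mn.1 : ℝ) * deriv a₁ θ + mn.2 * deriv a₂ θ = 0}).Finite := by
    refine Set.Finite.biUnion ?_ fun mn hmn => finite_parallel h htech hmn.2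
    exact (((Set.finite_Icc _ _).prod (Set.finite_Icc _ _))).inter_of_left _
  refine hfin.subset ?_
  rintro θ ⟨hθ, o, ho, hact⟩
  obtain ⟨m, n, hcl⟩ := o.exists_closedTorus h.toToric hθ ho
  have hT := hcl.period_eq h.toToric o ho
  rw [o.action_eq, hT] at hact
  have hb := hcl.pos
  have hs := Real.sin_pos_of_mem_Ioo hθ
  have hΔ := hc θ hθ
  have hcs : 0 < c * Real.sin θ := by positivity
  have r₁ := hcl.reeb₁
  have r₂ := hcl.reeb₂
  have hΔ0 : a₁ θ * deriv a₂ θ - a₂ θ * deriv a₁ θ ≠ 0 := by linarith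
  rw [div_eq_div_iff hΔ0 hb.ne'] at r₁ r₂
  set b := m * a₁ θ + n * a₂ θ
  set Δ := a₁ θ * deriv a₂ θ - a₂ θ * deriv a₁ θ
  have hbL : b ≤ L := by nlinarith [Real.pi_gt_three]
  have bound : ∀ (k : ℤ) (x D : ℝ), |x| ≤ D * Real.sin θ → D ≤ max C₁ C₂ → x * b = k * Δ →
      k ∈ Set.Icc (-M) M := by
    intro k x D hx hD hk
    have hDm : (0 : ℝ) ≤ max C₁ C₂ := hC₁0.le.trans (le_max_left _ _)
    have e1 : |(k : ℝ)| * |Δ| = |x| * b := by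
      rw [← abs_mul, ← hk, abs_mul, abs_of_pos hb]
    have e2 : c * Real.sin θ ≤ |Δ| := by rw [abs_of_neg (by linarith)]; linarith
    have e3 : |(k : ℝ)| * (c * Real.sin θ) ≤ max C₁ C₂ * Real.sin θ * L := by
      calc |(k : ℝ)| * (c * Real.sin θ) ≤ |(k : ℝ)| * |Δ| := by gcongr
        _ = |x| * b := e1
        _ ≤ (D * Real.sin θ) * b := by gcongr
        _ ≤ max C₁ C₂ * Real.sin θ * L := by gcongr
    have e4 : |(k : ℝ)| ≤ L * (max C₁ C₂) / c := by
      rw [le_div_iff₀ hc0]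
      exact le_of_mul_le_mul_right (by linarith) hs
    have e5 : |(k : ℝ)| ≤ M := e4.trans (Int.le_ceil _)
    rw [← abs_le.trans Set.mem_Icc.symm]
    exact_mod_cast e5
  refine Set.mem_biUnion (x := (m, n)) ⟨⟨?_, ?_⟩, ?_⟩ ⟨hθ, hcl.deriv_eq_zero h.toToric⟩
  · exact bound m _ C₂ (hC₂ θ (Set.Ioo_subset_Icc_self hθ)) (le_max_right _ _) r₁
  · exact bound n _ C₁ (by rw [abs_neg]; exact hC₁ θ (Set.Ioo_subset_Icc_self hθ))
      (le_max_left _ _) r₂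
  · by_contra hcon
    have hcon' : m = 0 ∧ n = 0 := by simpa using hcon
    have : b = 0 := by simp [b, hcon'.1, hcon'.2]
    linarith

end finiteness

/-! ### Rigidity of short periodic orbits of a slowly modulated system -/

theorem exists_lipschitz_bound {g : ℝ × ℝ → ℝ} {s : Set (ℝ × ℝ)} (hs : IsCompact s)
    (hg : ∀ x ∈ s, ContDiffAt ℝ 1 g x) :
    ∃ K > 0, (∀ x ∈ s, |g x| ≤ K) ∧
      ∀ x ∈ s, ∀ y ∈ s, |g x - g y| ≤ K * (|x.1 - y.1| + |x.2 - y.2|) := by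
  have hl : LocallyLipschitzOn s g := fun x hx => by
    obtain ⟨K, t, ht, h⟩ := (hg x hx).exists_lipschitzOnWith
    exact ⟨K, t, mem_nhdsWithin_of_mem_nhds ht, h⟩
  obtain ⟨K, hK⟩ := hl.exists_lipschitzOnWith_of_compact hs
  obtain ⟨C, hC⟩ := hs.exists_bound_of_continuousOn hl.continuousOn
  refine ⟨max (K : ℝ) C + 1, ?_, fun x hx => ?_, fun x hx y hy => ?_⟩
  · have : (0 : ℝ) ≤ max (K : ℝ) C := K.coe_nonneg.trans (le_max_left _ _)
    linarith
  · exact (hC x hx).trans ((le_max_right _ _).trans (by linarith))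
  · have h1 := hK.dist_le_mul x hx y hy
    rw [Real.dist_eq, Prod.dist_eq, Real.dist_eq, Real.dist_eq] at h1
    refine h1.trans ?_
    have h2 : max |x.1 - y.1| |x.2 - y.2| ≤ |x.1 - y.1| + |x.2 - y.2| :=
      max_le (le_add_of_nonneg_right (abs_nonneg _)) (le_add_of_nonneg_left (abs_nonneg _))
    have h3 : (K : ℝ) ≤ max (K : ℝ) C + 1 := (le_max_left _ _).trans (by linarith)
    have h4 : (0 : ℝ) ≤ max (K : ℝ) C + 1 := K.coe_nonneg.trans h3
    exact mul_le_mul h3 h2 (le_max_of_le_left (abs_nonneg _)) h4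

/-- By Rolle the speed vanishes somewhere in each period, so its size is at most its oscillation
over a time `L`. -/
theorem abs_le_of_periodic {g g' : ℝ → ℝ} {T L : ℝ} (hT : 0 < T) (hTL : T ≤ L)
    (hg : ∀ s, HasDerivAt g (g' s) s) (hper : ∀ s, g (s + T) = g s) {M : ℝ}
    (hM : ∀ s s', |s - s'| ≤ L → |g' s - g' s'| ≤ M) (s : ℝ) : |g' s| ≤ M := by
  obtain ⟨c, hc, hc0⟩ := exists_hasDerivAt_eq_zero (f := g) (f' := g') (a := s) (b := s + T)
    (by linarith) (fun x _ => (hg x).continuousAt.continuousWithinAt) (hper s).symm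
    (fun x _ => hg x)
  have := hM s c (by rw [abs_sub_comm, abs_of_pos (by linarith [hc.1])]; linarith [hc.2])
  rwa [hc0, sub_zero] at this

theorem abs_sub_le_of_hasDerivAt {g g' : ℝ → ℝ} (hg : ∀ s, HasDerivAt g (g' s) s) {A : ℝ}
    (hA : ∀ s, |g' s| ≤ A) (s s' : ℝ) : |g s - g s'| ≤ A * |s - s'| :=
  convex_univ.norm_image_sub_le_of_norm_hasDerivWithin_le
    (fun x _ => (hg x).hasDerivWithinAt) (fun x _ => hA x) (Set.mem_univ s') (Set.mem_univ s)

/-- For small `ε`, the only periodic orbits of period at most `L` of the system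
`θ' = ε sin y P(θ, ε (1 + cos y))`, `y' = Q(θ, ε (1 + cos y))` are the equilibria. -/
theorem eventually_equilibrium_of_periodic {P Q : ℝ × ℝ → ℝ} {l u L K : ℝ} (hL : 0 < L)
    (hK : 0 < K)
    (hP : ∀ x ∈ Set.Icc l u ×ˢ Set.Icc (0 : ℝ) 2, |P x| ≤ K)
    (hQ : ∀ x ∈ Set.Icc l u ×ˢ Set.Icc (0 : ℝ) 2, |Q x| ≤ K)
    (hPl : ∀ x ∈ Set.Icc l u ×ˢ Set.Icc (0 : ℝ) 2, ∀ y ∈ Set.Icc l u ×ˢ Set.Icc (0 : ℝ) 2,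
      |P x - P y| ≤ K * (|x.1 - y.1| + |x.2 - y.2|))
    (hQl : ∀ x ∈ Set.Icc l u ×ˢ Set.Icc (0 : ℝ) 2, ∀ y ∈ Set.Icc l u ×ˢ Set.Icc (0 : ℝ) 2,
      |Q x - Q y| ≤ K * (|x.1 - y.1| + |x.2 - y.2|)) :
    ∀ᶠ ε in nhdsWithin (0 : ℝ) (Set.Ioi 0), ∀ (θ y : ℝ → ℝ) (T : ℝ), 0 < T → T ≤ L →
      (∀ s, θ s ∈ Set.Icc l u) →
      (∀ s, HasDerivAt θ (ε * (Real.sin (y s) * P (θ s, ε * (1 + Real.cos (y s))))) s) →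
      (∀ s, HasDerivAt y (Q (θ s, ε * (1 + Real.cos (y s)))) s) →
      (∀ s, θ (s + T) = θ s) → (∀ s, y (s + T) = y s) →
      ∀ s, ε * (Real.sin (y s) * P (θ s, ε * (1 + Real.cos (y s)))) = 0 ∧
        Q (θ s, ε * (1 + Real.cos (y s))) = 0 := by
  set N := K * L with hN
  have hN0 : 0 < N := by positivity
  -- The speeds of `θ` and `y` are measured at different scales, `η M` and `M`. The coupling of `y'`
  -- to `θ` is not small, so `η` compensates for it; the coupling of `θ'` to `y` carries a factor
  -- `ε`, and the thresholds on `ε` below absorb the constants.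
  set η := 1 / (4 * N) with hη
  have hη0 : 0 < η := by positivity
  have hηN : η * N = 1 / 4 := by rw [hη]; field_simp
  have hsmall : ∀ x : ℝ, 0 < x → ∀ᶠ ε in nhdsWithin (0 : ℝ) (Set.Ioi 0), ε < x := fun x hx =>
    mem_nhdsWithin_of_mem_nhds (Iio_mem_nhds hx)
  filter_upwards [hsmall 1 one_pos, hsmall η hη0,
    hsmall (η / (2 * N * (η + 2))) (by positivity), self_mem_nhdsWithin]
    with ε h1 h2 h3 (hε : 0 < ε) θ y T hT hTL hθ hdθ hdy hpθ hpy
  rw [lt_div_iff₀ (by positivity)] at h3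
  set c : ℝ → ℝ := fun s => ε * (1 + Real.cos (y s)) with hc
  have hmem : ∀ s, (θ s, c s) ∈ Set.Icc l u ×ˢ Set.Icc (0 : ℝ) 2 := by
    intro s
    refine ⟨hθ s, ?_, ?_⟩
    · exact mul_nonneg hε.le (by linarith [Real.neg_one_le_cos (y s)])
    · have := Real.cos_le_one (y s)
      have := Real.neg_one_le_cos (y s)
      simp only [hc]
      nlinarith
  have hcd : ∀ s s', |c s - c s'| ≤ ε * |y s - y s'| := by
    intro s s'
    have : c s - c s' = ε * (Real.cos (y s) - Real.cos (y s')) := by simp only [hc]; ring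
    rw [this, abs_mul, abs_of_pos hε]
    exact mul_le_mul_of_nonneg_left (Real.abs_cos_sub_cos_le _ _) hε.le
  have hQd : ∀ s s', |Q (θ s, c s) - Q (θ s', c s')| ≤ K * (|θ s - θ s'| + ε * |y s - y s'|) := by
    intro s s'
    refine (hQl _ (hmem s) _ (hmem s')).trans ?_
    have := hcd s s'
    gcongr
  have hPd : ∀ s s', |Real.sin (y s) * P (θ s, c s) - Real.sin (y s') * P (θ s', c s')| ≤
      K * (|θ s - θ s'| + 2 * |y s - y s'|) := by
    intro s s'
    have e : Real.sin (y s) * P (θ s, c s) - Real.sin (y s') * P (θ s', c s') =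
        Real.sin (y s) * (P (θ s, c s) - P (θ s', c s')) +
        (Real.sin (y s) - Real.sin (y s')) * P (θ s', c s') := by ring
    have i1 : |Real.sin (y s)| ≤ 1 := Real.abs_sin_le_one _
    have i2 : |Real.sin (y s) - Real.sin (y s')| ≤ |y s - y s'| :=
      Real.abs_sin_sub_sin_le _ _
    have i3 := hPl _ (hmem s) _ (hmem s')
    have i4 := hP _ (hmem s')
    have i5 := hcd s s'
    have i6 : ε * |y s - y s'| ≤ 1 * |y s - y s'| := by gcongr
    calc _ ≤ |Real.sin (y s)| * |P (θ s, c s) - P (θ s', c s')| +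
          |Real.sin (y s) - Real.sin (y s')| * |P (θ s', c s')| := by
            rw [e, ← abs_mul, ← abs_mul]; exact abs_add_le _ _
      _ ≤ 1 * (K * (|θ s - θ s'| + |c s - c s'|)) + |y s - y s'| * K := by gcongr
      _ ≤ K * (|θ s - θ s'| + 2 * |y s - y s'|) := by nlinarith
  -- A bound `M` on the scaled speeds bounds the displacements over time `L`, hence by Lipschitz
  -- continuity the oscillation of the speeds, hence by periodicity the speeds themselves by half of
  -- the previous bound.
  have step : ∀ M, 0 ≤ M →
      (∀ s, |ε * (Real.sin (y s) * P (θ s, c s))| ≤ η * M) → (∀ s, |Q (θ s, c s)| ≤ M) →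
      (∀ s, |ε * (Real.sin (y s) * P (θ s, c s))| ≤ η * (M / 2)) ∧
      ∀ s, |Q (θ s, c s)| ≤ M / 2 := by
    intro M hM hA hB
    have dθ : ∀ s s', |s - s'| ≤ L → |θ s - θ s'| ≤ η * M * L := fun s s' hs =>
      (abs_sub_le_of_hasDerivAt hdθ hA s s').trans (by gcongr)
    have dy : ∀ s s', |s - s'| ≤ L → |y s - y s'| ≤ M * L := fun s s' hs =>
      (abs_sub_le_of_hasDerivAt hdy hB s s').trans (by gcongr)
    constructor
    · refine abs_le_of_periodic hT hTL hdθ hpθ fun s s' hs => ?_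
      rw [← mul_sub, abs_mul, abs_of_pos hε]
      have e1 := hPd s s'
      have e2 := dθ s s' hs
      have e3 := dy s s' hs
      calc _ ≤ ε * (K * (|θ s - θ s'| + 2 * |y s - y s'|)) := by gcongr
        _ ≤ ε * (K * (η * M * L + 2 * (M * L))) := by gcongr
        _ = (ε * (2 * N * (η + 2))) * (M / 2) := by rw [hN]; ring
        _ ≤ η * (M / 2) := by gcongr
    · refine abs_le_of_periodic hT hTL hdy hpy fun s s' hs => ?_
      have e1 := hQd s s'
      have e2 := dθ s s' hs
      have e3 := dy s s' hs
      calc _ ≤ K * (|θ s - θ s'| + ε * |y s - y s'|) := e1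
        _ ≤ K * (η * M * L + η * (M * L)) := by gcongr
        _ = (η * N) * (2 * M) := by rw [hN]; ring
        _ = M / 2 := by rw [hηN]; ring
  have hall : ∀ k : ℕ, (∀ s, |ε * (Real.sin (y s) * P (θ s, c s))| ≤
      η * ((K + K / η) / 2 ^ k)) ∧ ∀ s, |Q (θ s, c s)| ≤ (K + K / η) / 2 ^ k := by
    intro k
    induction k with
    | zero =>
      have hKη : 0 < K / η := by positivity
      refine ⟨fun s => ?_, fun s => ?_⟩
      · rw [abs_mul, abs_mul, abs_of_pos hε, pow_zero, div_one]
        have i1 := Real.abs_sin_le_one (y s)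
        have i2 := hP _ (hmem s)
        calc ε * (|Real.sin (y s)| * |P (θ s, c s)|) ≤ 1 * (1 * K) := by gcongr
          _ ≤ η * K + K := by nlinarith
          _ = η * (K + K / η) := by field_simp
      · rw [pow_zero, div_one]
        exact (hQ _ (hmem s)).trans (by linarith)
    | succ k ih =>
      have := step _ (by positivity) ih.1 ih.2
      rwa [div_div, ← pow_succ] at this
  have lim : Filter.Tendsto (fun k : ℕ => (K + K / η) / 2 ^ k) Filter.atTop (nhds 0) := by
    have := (tendsto_pow_atTop_nhds_zero_of_lt_one (r := (1 / 2 : ℝ)) (by norm_num)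
      (by norm_num)).const_mul (K + K / η)
    simpa [div_eq_mul_inv] using this
  intro s
  constructor
  · have lim' := lim.const_mul η
    rw [mul_zero] at lim'
    exact abs_nonpos_iff.mp (ge_of_tendsto' lim' fun k => (hall k).1 s)
  · exact abs_nonpos_iff.mp (ge_of_tendsto' lim fun k => (hall k).2 s)

/-- Every closed trajectory of period at most `L` in the strip `l ≤ θ ≤ u` of the perturbed flow in
the variables `θ` and `y = n t - m φ` is an equilibrium on the line `θ = θ₀`. -/
def RigidFlow (b Δ X : ℝ → ℝ) (l u θ₀ L ε : ℝ) : Prop :=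
  ∀ (θ y : ℝ → ℝ) (T : ℝ), 0 < T → T ≤ L →
    (∀ s, θ s ∈ Set.Icc l u) →
    (∀ s, HasDerivAt θ (-(Real.exp (ε * X (θ s) * (1 + Real.cos (y s))) / Δ (θ s) *
      (ε * X (θ s) * Real.sin (y s) * b (θ s)))) s) →
    (∀ s, HasDerivAt y (Real.exp (ε * X (θ s) * (1 + Real.cos (y s))) / Δ (θ s) *
      (deriv b (θ s) - ε * deriv X (θ s) * (1 + Real.cos (y s)) * b (θ s))) s) →
    (∀ s, θ (s + T) = θ s) → (∀ s, ∃ k : ℤ, y (s + T) = y s + 2 * Real.pi * k) →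
    (∀ s, θ s = θ₀) ∧ Real.sin (y 0) = 0 ∧ ∀ s, y s = y 0

/-- Rigidity of the perturbed flow near a closed torus: for small `ε` all closed orbits of period
at most `L` are the obvious ones. -/
theorem eventually_rigid {b Δ X : ℝ → ℝ} (hb : ContDiff ℝ ∞ b) (hΔ : ContDiff ℝ ∞ Δ)
    (hX : ContDiff ℝ ∞ X) {l u θ₀ L : ℝ} (hL : 0 < L) (hθ₀ : θ₀ ∈ Set.Icc l u)
    (hΔ0 : ∀ θ ∈ Set.Icc l u, Δ θ ≠ 0) (hb' : ∀ θ ∈ Set.Icc l u, deriv b θ = 0 → θ = θ₀)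
    (hbL : ∀ θ ∈ Set.Icc l u, |deriv b θ / Δ θ| < Real.pi / L) (hb0 : b θ₀ ≠ 0)
    {W : Set ℝ} (hW : IsOpen W) (hWθ : θ₀ ∈ W) (hXW : ∀ θ ∈ W, X θ = 1) :
    ∀ᶠ ε in nhdsWithin (0 : ℝ) (Set.Ioi 0), RigidFlow b Δ X l u θ₀ L ε := by
  simp only [RigidFlow]
  -- The combination `ε (1 + cos y)` becomes an independent variable in `[0, 2]`, so `P` and `Q` do
  -- not involve `ε` and one Lipschitz constant serves for all small `ε`.
  set P : ℝ × ℝ → ℝ := fun x => -(Real.exp (x.2 * X x.1) / Δ x.1 * (X x.1 * b x.1)) with hP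
  set Q : ℝ × ℝ → ℝ := fun x => Real.exp (x.2 * X x.1) / Δ x.1 *
    (deriv b x.1 - x.2 * deriv X x.1 * b x.1) with hQ
  have hd : ∀ {g : ℝ → ℝ}, ContDiff ℝ ∞ g → ContDiff ℝ ∞ (deriv g) := fun {g} hg =>
    (contDiff_infty_iff_deriv.mp hg).2
  have h1 : ∀ {g : ℝ → ℝ}, ContDiff ℝ ∞ g → ∀ x : ℝ × ℝ,
      ContDiffAt ℝ 1 (fun x : ℝ × ℝ => g x.1) x := fun {g} hg x =>
    ((hg.of_le (by simp)).comp contDiff_fst).contDiffAt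
  have hE : ∀ x ∈ Set.Icc l u ×ˢ Set.Icc (0 : ℝ) 2,
      ContDiffAt ℝ 1 (fun x : ℝ × ℝ => Real.exp (x.2 * X x.1) / Δ x.1) x := fun x hx =>
    ((contDiffAt_snd.mul (h1 hX x)).exp).div (h1 hΔ x) (hΔ0 _ hx.1)
  have hcpt : IsCompact (Set.Icc l u ×ˢ Set.Icc (0 : ℝ) 2) := isCompact_Icc.prod isCompact_Icc
  obtain ⟨K₁, hK₁, bP, lP⟩ := exists_lipschitz_bound hcpt (g := P) fun x hx =>
    ((hE x hx).mul ((h1 hX x).mul (h1 hb x))).neg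
  obtain ⟨K₂, hK₂, bQ, lQ⟩ := exists_lipschitz_bound hcpt (g := Q) fun x hx =>
    (hE x hx).mul ((h1 (hd hb) x).sub ((contDiffAt_snd.mul (h1 (hd hX) x)).mul (h1 hb x)))
  have hKl : K₁ ≤ max K₁ K₂ := le_max_left _ _
  have hKr : K₂ ≤ max K₁ K₂ := le_max_right _ _
  have hode := eventually_equilibrium_of_periodic (P := P) (Q := Q) (l := l) (u := u) hL
    (hK₁.trans_le hKl) (fun x hx => (bP x hx).trans hKl) (fun x hx => (bQ x hx).trans hKr)
    (fun x hx y hy => (lP x hx y hy).trans (by gcongr))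
    (fun x hx y hy => (lQ x hx y hy).trans (by gcongr))
  -- away from `W` the derivative of `b` is bounded below
  obtain ⟨c₀, hc₀, hlow⟩ : ∃ c₀ > 0, ∀ θ ∈ Set.Icc l u, θ ∉ W → c₀ ≤ |deriv b θ| := by
    have hc : IsCompact (Set.Icc l u \ W) := isCompact_Icc.diff hW
    rcases (Set.Icc l u \ W).eq_empty_or_nonempty with he | hne
    · refine ⟨1, one_pos, fun θ h1 h2 => ?_⟩
      have : θ ∈ Set.Icc l u \ W := ⟨h1, h2⟩
      simp [he] at this
    · obtain ⟨θ', hθ', hmin⟩ := hc.exists_isMinOn hne ((hd hb).continuous.abs).continuousOn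
      refine ⟨|deriv b θ'|, abs_pos.2 fun h0 => ?_, fun θ h1 h2 => hmin ⟨h1, h2⟩⟩
      exact hθ'.2 (hb' θ' hθ'.1 h0 ▸ hWθ)
  obtain ⟨C, hC⟩ := (isCompact_Icc (a := l) (b := u)).exists_bound_of_continuousOn
    ((hd hX).continuous.mul hb.continuous).continuousOn
  have hC0 : 0 ≤ C := (norm_nonneg _).trans (hC θ₀ hθ₀)
  -- a uniform bound on the speed of `y` at `ε = 0`
  obtain ⟨β, hβ, hβL⟩ : ∃ β, (∀ θ ∈ Set.Icc l u, |deriv b θ / Δ θ| ≤ β) ∧ β < Real.pi / L := by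
    have hcont : ContinuousOn (fun θ => |deriv b θ / Δ θ|) (Set.Icc l u) :=
      ((hd hb).continuous.continuousOn.div hΔ.continuous.continuousOn hΔ0).abs
    obtain ⟨θ', hθ', hmax⟩ := isCompact_Icc.exists_isMaxOn ⟨θ₀, hθ₀⟩ hcont
    exact ⟨_, fun θ hθ => hmax hθ, hbL θ' hθ'⟩
  have hpL : 0 < Real.pi / L := div_pos Real.pi_pos hL
  have hsmall : ∀ x : ℝ, 0 < x → ∀ᶠ ε in nhdsWithin (0 : ℝ) (Set.Ioi 0), ε < x := fun x hx =>
    mem_nhdsWithin_of_mem_nhds (Iio_mem_nhds hx)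
  filter_upwards [hode, hsmall 1 one_pos, hsmall (c₀ / (2 * (C + 1))) (by positivity),
    hsmall (Real.pi / L / (2 * K₂)) (by positivity), self_mem_nhdsWithin]
    with ε hode h1 h2 h3 (hε : 0 < ε) θ y T hT hTL hθ hdθ hdy hpθ hpy
  rw [lt_div_iff₀ (by positivity)] at h2 h3
  have hcos : ∀ s, 0 ≤ ε * (1 + Real.cos (y s)) ∧ ε * (1 + Real.cos (y s)) ≤ 2 * ε := by
    intro s
    have e1 := Real.cos_le_one (y s)
    have e2 := Real.neg_one_le_cos (y s)
    constructor <;> nlinarith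
  have hdθ' : ∀ s, HasDerivAt θ
      (ε * (Real.sin (y s) * P (θ s, ε * (1 + Real.cos (y s))))) s := by
    intro s
    convert hdθ s using 1
    simp only [hP]
    rw [show ε * (1 + Real.cos (y s)) * X (θ s) = ε * X (θ s) * (1 + Real.cos (y s)) by ring]
    ring
  have hdy' : ∀ s, HasDerivAt y (Q (θ s, ε * (1 + Real.cos (y s)))) s := by
    intro s
    convert hdy s using 1
    simp only [hQ]
    rw [show ε * (1 + Real.cos (y s)) * X (θ s) = ε * X (θ s) * (1 + Real.cos (y s)) by ring]
    ring
  have hspeed : ∀ s, |Q (θ s, ε * (1 + Real.cos (y s)))| ≤ β + Real.pi / L := by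
    intro s
    have hm1 : (θ s, ε * (1 + Real.cos (y s))) ∈ Set.Icc l u ×ˢ Set.Icc (0 : ℝ) 2 :=
      ⟨hθ s, (hcos s).1, (hcos s).2.trans (by linarith)⟩
    have hm2 : (θ s, (0 : ℝ)) ∈ Set.Icc l u ×ˢ Set.Icc (0 : ℝ) 2 := ⟨hθ s, le_rfl, by norm_num⟩
    have e1 := lQ _ hm1 _ hm2
    simp only [sub_self, abs_zero, zero_add, sub_zero, abs_of_nonneg (hcos s).1] at e1
    have e2 : |Q (θ s, 0)| ≤ β := by
      convert hβ _ (hθ s) using 2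
      simp only [hQ, zero_mul, Real.exp_zero]
      ring
    have e3 : K₂ * (ε * (1 + Real.cos (y s))) ≤ K₂ * (2 * ε) := by
      have := (hcos s).2
      gcongr
    have e4 := abs_sub_abs_le_abs_sub (Q (θ s, ε * (1 + Real.cos (y s)))) (Q (θ s, 0))
    linarith
  -- The speed of `y` is at most `β + π / L < 2π / L`, so within a period `T ≤ L` it cannot go
  -- around the circle.
  have hpy' : ∀ s, y (s + T) = y s := by
    intro s
    obtain ⟨k, hk⟩ := hpy s
    have e1 := abs_sub_le_of_hasDerivAt hdy' hspeed (s + T) s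
    rw [hk, add_sub_cancel_left, add_sub_cancel_left, abs_of_pos hT] at e1
    have e2 : (β + Real.pi / L) * T < 2 * Real.pi := by
      have i1 : 0 ≤ β := (abs_nonneg _).trans (hβ θ₀ hθ₀)
      calc (β + Real.pi / L) * T ≤ (β + Real.pi / L) * L := by gcongr
        _ < (Real.pi / L + Real.pi / L) * L := by gcongr
        _ = 2 * Real.pi := by field_simp; ring
    have e3 : |2 * Real.pi * (k : ℝ)| < 2 * Real.pi := e1.trans_lt e2
    rw [abs_mul, abs_of_pos Real.two_pi_pos] at e3
    have e4 : |(k : ℝ)| < 1 := by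
      by_contra hcon
      push Not at hcon
      nlinarith [Real.two_pi_pos]
    have e5 : |k| < 1 := by exact_mod_cast e4
    rw [hk, Int.abs_lt_one_iff.mp e5]
    simp
  have heq := hode θ y T hT hTL hθ hdθ' hdy' hpθ hpy'
  have hθ₀' : ∀ s, θ s = θ₀ := by
    intro s
    have hQ0 := (heq s).2
    simp only [hQ] at hQ0
    have hb0' := (mul_eq_zero.mp hQ0).resolve_left
      (div_ne_zero (Real.exp_pos _).ne' (hΔ0 _ (hθ s)))
    -- At an equilibrium `b' = ε (1 + cos y) X' b`. On `W` the profile `X` is constant, so `b' = 0`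
    -- and `θ = θ₀`; off `W` the left side is at least `c₀` in size, while the right side is at most
    -- `2 ε C < c₀`.
    by_cases hw : θ s ∈ W
    · have : deriv X (θ s) = 0 := by
        have hev : X =ᶠ[nhds (θ s)] fun _ => 1 := by
          filter_upwards [hW.mem_nhds hw] with x hx using hXW x hx
        rw [hev.deriv_eq, deriv_const]
      rw [this, mul_zero, zero_mul, sub_zero] at hb0'
      exact hb' _ (hθ s) hb0'
    · exfalso
      have e1 := hlow _ (hθ s) hw
      have e2 : |deriv X (θ s) * b (θ s)| ≤ C := hC _ (hθ s)
      have e3 : deriv b (θ s) = ε * (1 + Real.cos (y s)) * (deriv X (θ s) * b (θ s)) := by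
        linarith
      rw [e3, abs_mul, abs_of_nonneg (hcos s).1] at e1
      have e4 : ε * (1 + Real.cos (y s)) * |deriv X (θ s) * b (θ s)| ≤ 2 * ε * C :=
        mul_le_mul (hcos s).2 e2 (abs_nonneg _) (by positivity)
      nlinarith
  refine ⟨hθ₀', ?_, ?_⟩
  · have h0 := (heq 0).1
    rw [hθ₀'] at h0
    have hX1 : X θ₀ = 1 := hXW _ hWθ
    have hE := (Real.exp_pos (ε * (1 + Real.cos (y 0)) * X θ₀)).ne'
    have hP0 : P (θ₀, ε * (1 + Real.cos (y 0))) ≠ 0 :=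
      neg_ne_zero.2 (mul_ne_zero (div_ne_zero hE (hΔ0 _ hθ₀))
        (mul_ne_zero (by simp [hX1]) hb0))
    exact (mul_eq_zero.mp ((mul_eq_zero.mp h0).resolve_left hε.ne')).resolve_right hP0
  · intro s
    have hd0 : ∀ s, HasDerivAt y 0 s := fun s => by
      have := hdy' s
      rwa [(heq s).2] at this
    exact is_const_of_deriv_eq_zero (fun s => (hd0 s).differentiableAt) (fun s => (hd0 s).deriv) s 0

/-! ### The perturbing function -/

/-- A smooth function of `z` that is `1` for `|z - c| ≤ ρ` and `0` for `|z - c| ≥ 2 ρ`. -/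
noncomputable def zBump (c ρ z : ℝ) : ℝ := Real.smoothTransition (2 - ((z - c) / ρ) ^ 2)

theorem contDiff_zBump (c ρ : ℝ) : ContDiff ℝ ∞ (zBump c ρ) :=
  Real.smoothTransition.contDiff.comp (by fun_prop)

theorem zBump_nonneg (c ρ z : ℝ) : 0 ≤ zBump c ρ z := Real.smoothTransition.nonneg _

theorem zBump_le_one (c ρ z : ℝ) : zBump c ρ z ≤ 1 := Real.smoothTransition.le_one _

theorem zBump_eq_one {c ρ z : ℝ} (hρ : 0 < ρ) (h : |z - c| ≤ ρ) : zBump c ρ z = 1 := by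
  apply Real.smoothTransition.one_of_one_le
  have : ((z - c) / ρ) ^ 2 ≤ 1 := by
    rw [sq_le_one_iff_abs_le_one, abs_div, abs_of_pos hρ]
    exact (div_le_one hρ).2 h
  linarith

theorem zBump_eq_zero {c ρ z : ℝ} (hρ : 0 < ρ) (h : 2 * ρ ≤ |z - c|) : zBump c ρ z = 0 := by
  apply Real.smoothTransition.zero_of_nonpos
  have h2 : 2 ≤ |(z - c) / ρ| := by
    rw [abs_div, abs_of_pos hρ]
    exact (le_div_iff₀ hρ).2 h
  nlinarith [sq_abs ((z - c) / ρ)]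

/-- The function `r e^{it} ↦ r^|k| e^{ikt}`, which is smooth on the whole plane. -/
noncomputable def angPow (w : ℂ) (k : ℤ) : ℂ :=
  if 0 ≤ k then w ^ k.natAbs else (starRingEnd ℂ w) ^ k.natAbs

theorem contDiff_angPow (k : ℤ) : ContDiff ℝ ∞ fun w => angPow w k := by
  unfold angPow
  split_ifs
  · exact contDiff_id.pow _
  · exact Complex.conjCLE.contDiff.pow _

theorem angPow_polar (r t : ℝ) (k : ℤ) :
    angPow (r * Complex.exp (t * Complex.I)) k =
      r ^ k.natAbs * Complex.exp ((k * t : ℝ) * Complex.I) := by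
  unfold angPow
  split_ifs with h
  · rw [mul_pow, ← Complex.exp_nat_mul]
    obtain ⟨j, rfl⟩ := Int.eq_ofNat_of_zero_le h
    simp only [Int.natAbs_natCast]
    push_cast
    ring_nf
  · rw [map_mul, Complex.conj_ofReal, ← Complex.exp_conj, mul_pow, ← Complex.exp_nat_mul]
    obtain ⟨j, rfl⟩ : ∃ j : ℕ, k = -j := ⟨k.natAbs, by omega⟩
    simp only [Int.natAbs_neg, Int.natAbs_natCast, map_mul, Complex.conj_ofReal, Complex.conj_I]
    push_cast
    ring_nf

/-- The function `χ(z) (1 + cos (n t - m φ))`, where `χ` is the bump function `zBump c ρ`. -/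
noncomputable def torusBump (c ρ : ℝ) (m n : ℤ) (p : Amb) : ℝ :=
  zBump c ρ p.2.2 * (1 + (√(1 - p.2.2 ^ 2))⁻¹ ^ m.natAbs *
    (angPow p.1 n * angPow (starRingEnd ℂ p.2.1) m).re)

/-- The power of `√(1 - z²)⁻¹` cancels the factor `sin^|m| θ` produced by the smooth angular power
of the second coordinate. -/
theorem torusBump_coord (c ρ : ℝ) (m n : ℤ) {q : ℝ × ℝ × ℝ} (hq : q.2.1 ∈ Set.Ioo 0 Real.pi) :
    torusBump c ρ m n (coord q) =
      zBump c ρ (Real.cos q.2.1) * (1 + Real.cos (n * q.1 - m * q.2.2)) := by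
  have hs := Real.sin_pos_of_mem_Ioo hq
  have h1 : angPow (coord q).1 n = Complex.exp ((n * q.1 : ℝ) * Complex.I) := by
    simpa [coord] using angPow_polar 1 q.1 n
  have h2 : starRingEnd ℂ (coord q).2.1 =
      (Real.sin q.2.1 : ℂ) * Complex.exp (((-q.2.2 : ℝ) : ℂ) * Complex.I) := by
    simp only [coord]
    rw [map_mul, Complex.conj_ofReal, ← Complex.exp_conj]
    simp
  rw [torusBump, h1, h2, angPow_polar]
  have h3 : (coord q).2.2 = Real.cos q.2.1 := rfl
  rw [h3, sqrt_one_sub_cos_sq (Set.Ioo_subset_Icc_self hq)]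
  congr 2
  rw [mul_left_comm, ← Complex.exp_add, ← Complex.ofReal_pow, Complex.re_ofReal_mul, ← mul_assoc,
    ← mul_pow, inv_mul_cancel₀ hs.ne', one_pow, one_mul, ← add_mul, ← Complex.ofReal_add,
    Complex.exp_ofReal_mul_I_re]
  congr 1
  ring

theorem torusBump_eq_zero {c ρ : ℝ} {m n : ℤ} {p : Amb} (hρ : 0 < ρ)
    (h : 2 * ρ ≤ |p.2.2 - c|) : torusBump c ρ m n p = 0 := by
  rw [torusBump, zBump_eq_zero hρ h, zero_mul]

/-- The square root and its inverse are singular only at `|z| = 1` and beyond, and the condition on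
`c` and `ρ` keeps the support of the bump away from there. -/
theorem contDiff_torusBump {c ρ : ℝ} (m n : ℤ) (hρ : 0 < ρ) (hc : |c| + 2 * ρ < 1) :
    ContDiff ℝ ∞ (torusBump c ρ m n) := by
  rw [contDiff_iff_contDiffAt]
  intro p
  have hz : ContDiff ℝ ∞ (fun p : Amb => p.2.2) := contDiff_snd.comp contDiff_snd
  by_cases hp : |p.2.2| < 1
  · have hsq : 0 < 1 - p.2.2 ^ 2 := by
      have : p.2.2 ^ 2 < 1 := by rw [sq_lt_one_iff_abs_lt_one]; exact hp
      linarith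
    have h1 : ContDiffAt ℝ ∞ (fun p : Amb => √(1 - p.2.2 ^ 2)) p :=
      (contDiffAt_const.sub (hz.contDiffAt.pow 2)).sqrt hsq.ne'
    have h2 : ContDiffAt ℝ ∞ (fun p : Amb => zBump c ρ p.2.2) p :=
      ((contDiff_zBump c ρ).comp hz).contDiffAt
    have h3 : ContDiff ℝ ∞ (fun p : Amb => angPow p.1 n * angPow (starRingEnd ℂ p.2.1) m) :=
      ((contDiff_angPow n).comp contDiff_fst).mul ((contDiff_angPow m).comp
        (Complex.conjCLE.contDiff.comp (contDiff_fst.comp contDiff_snd)))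
    exact h2.mul (contDiffAt_const.add (((h1.inv (Real.sqrt_pos.2 hsq).ne').pow _).mul
      (Complex.reCLM.contDiff.comp h3).contDiffAt))
  · have hlt : 2 * ρ < |p.2.2 - c| := by
      have := abs_sub_abs_le_abs_sub p.2.2 c
      push Not at hp
      linarith
    have hev : torusBump c ρ m n =ᶠ[nhds p] fun _ => 0 := by
      have : ∀ᶠ p' : Amb in nhds p, 2 * ρ < |p'.2.2 - c| :=
        continuousAt_const.eventually_lt (hz.continuous.sub continuous_const).abs.continuousAt hlt
      filter_upwards [this] with p' hp'
      exact torusBump_eq_zero hρ hp'.le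
    exact contDiffAt_const.congr_of_eventuallyEq hev

/-- The sum of the perturbing functions over a finite set of tori. -/
noncomputable def perturbation (S : Finset ℝ) (ρ : ℝ) (m n : ℝ → ℤ) (ε : ℝ → ℝ) (p : Amb) : ℝ :=
  -∑ θ ∈ S, ε θ * torusBump (Real.cos θ) ρ (m θ) (n θ) p

section perturbation

variable {S : Finset ℝ} {ρ : ℝ} {m n : ℝ → ℤ} {ε : ℝ → ℝ}

theorem contDiff_perturbation (hρ : 0 < ρ) (hS : ∀ θ ∈ S, |Real.cos θ| + 2 * ρ < 1) :
    ContDiff ℝ ∞ (perturbation S ρ m n ε) := by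
  have : ContDiff ℝ ∞ fun p => ∑ θ ∈ S, ε θ * torusBump (Real.cos θ) ρ (m θ) (n θ) p :=
    ContDiff.sum fun θ hθ => contDiff_const.mul (contDiff_torusBump _ _ hρ (hS θ hθ))
  exact this.neg

theorem perturbation_eq_zero (hρ : 0 < ρ) {p : Amb}
    (h : ∀ θ ∈ S, 2 * ρ ≤ |p.2.2 - Real.cos θ|) : perturbation S ρ m n ε p = 0 := by
  rw [perturbation, Finset.sum_eq_zero fun θ hθ => ?_, neg_zero]
  rw [torusBump_eq_zero hρ (h θ hθ), mul_zero]

/-- Each bump is supported within `2ρ` of its centre, so a separation of `5ρ` leaves a zone of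
radius `3ρ` that no other bump reaches. -/
theorem perturbation_eq_single (hρ : 0 < ρ) {θ₀ : ℝ} (hθ₀ : θ₀ ∈ S)
    (hsep : ∀ θ ∈ S, θ ≠ θ₀ → 5 * ρ < |Real.cos θ - Real.cos θ₀|) {p : Amb}
    (hp : |p.2.2 - Real.cos θ₀| < 3 * ρ) :
    perturbation S ρ m n ε p = -(ε θ₀ * torusBump (Real.cos θ₀) ρ (m θ₀) (n θ₀) p) := by
  rw [perturbation, Finset.sum_eq_single_of_mem θ₀ hθ₀ fun θ hθ hne => ?_]
  rw [torusBump_eq_zero hρ, mul_zero]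
  have h1 := hsep θ hθ hne
  have h2 := abs_sub_le (Real.cos θ) p.2.2 (Real.cos θ₀)
  rw [abs_sub_comm (Real.cos θ) p.2.2] at h2
  linarith

theorem perturbation_coord (hρ : 0 < ρ) {θ₀ : ℝ} (hθ₀ : θ₀ ∈ S)
    (hsep : ∀ θ ∈ S, θ ≠ θ₀ → 5 * ρ < |Real.cos θ - Real.cos θ₀|) {q : ℝ × ℝ × ℝ}
    (hq : q.2.1 ∈ Set.Ioo 0 Real.pi) (hq' : |Real.cos q.2.1 - Real.cos θ₀| < 3 * ρ) :
    perturbation S ρ m n ε (coord q) = -(ε θ₀ * zBump (Real.cos θ₀) ρ (Real.cos q.2.1) *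
      (1 + Real.cos (n θ₀ * q.1 - m θ₀ * q.2.2))) := by
  rw [perturbation_eq_single hρ hθ₀ hsep (p := coord q) hq', torusBump_coord _ _ _ _ hq]
  ring

theorem abs_perturbation_lt (hρ : 0 < ρ) (hS : ∀ θ ∈ S, |Real.cos θ| + 2 * ρ < 1)
    (hsep : ∀ θ₀ ∈ S, ∀ θ ∈ S, θ ≠ θ₀ → 5 * ρ < |Real.cos θ - Real.cos θ₀|) {δ : ℝ} (hδ : 0 < δ)
    (hε : ∀ θ ∈ S, 0 < ε θ ∧ 2 * ε θ < δ) {p : Amb} (hp : p ∈ S1S2) :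
    |perturbation S ρ m n ε p| < δ := by
  by_cases h : ∀ θ ∈ S, 2 * ρ ≤ |p.2.2 - Real.cos θ|
  · rw [perturbation_eq_zero hρ h, abs_zero]; exact hδ
  · push Not at h
    obtain ⟨θ₀, hθ₀, hlt⟩ := h
    have hz : |p.2.2| < 1 := by
      have := abs_sub_abs_le_abs_sub p.2.2 (Real.cos θ₀)
      linarith [hS θ₀ hθ₀]
    obtain ⟨q, hq, rfl⟩ := exists_coord_eq hp hz
    have hlt' : |Real.cos q.2.1 - Real.cos θ₀| < 3 * ρ := by
      have : |Real.cos q.2.1 - Real.cos θ₀| < 2 * ρ := hlt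
      linarith
    rw [perturbation_coord hρ hθ₀ (hsep θ₀ hθ₀) hq hlt', abs_neg]
    obtain ⟨e0, e1⟩ := hε θ₀ hθ₀
    have b1 := zBump_nonneg (Real.cos θ₀) ρ (Real.cos q.2.1)
    have b2 := zBump_le_one (Real.cos θ₀) ρ (Real.cos q.2.1)
    have c1 := Real.neg_one_le_cos (n θ₀ * q.1 - m θ₀ * q.2.2)
    have c2 := Real.cos_le_one (n θ₀ * q.1 - m θ₀ * q.2.2)
    have c3 : 0 ≤ 1 + Real.cos (n θ₀ * q.1 - m θ₀ * q.2.2) := by linarith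
    rw [abs_of_nonneg (by positivity)]
    calc _ ≤ ε θ₀ * 1 * 2 := by gcongr; linarith
      _ < δ := by linarith

end perturbation

/-! ### The Reeb field of the perturbed form near a torus -/

namespace Form1

/-- This is the source of the planar system: up to a common factor, the `θ`-component and the
combination of the others that moves `n t - m φ` depend only on `θ` and on `n t - m φ`. -/
theorem reebVec_of_eventuallyEq {a₁ a₂ X : ℝ → ℝ} {F : ℝ × ℝ × ℝ → ℝ} {ε : ℝ} {m n : ℤ}
    {q : ℝ × ℝ × ℝ} (hX : DifferentiableAt ℝ X q.2.1)
    (hF : F =ᶠ[nhds q] fun q => -(ε * X q.2.1 * (1 + Real.cos (n * q.1 - m * q.2.2)))) :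
    reebVec a₁ a₂ F q =
      (Real.exp (ε * X q.2.1 * (1 + Real.cos (n * q.1 - m * q.2.2))) /
        (a₁ q.2.1 * deriv a₂ q.2.1 - a₂ q.2.1 * deriv a₁ q.2.1)) •
      (deriv a₂ q.2.1 - ε * deriv X q.2.1 * (1 + Real.cos (n * q.1 - m * q.2.2)) * a₂ q.2.1,
       -(ε * X q.2.1 * Real.sin (n * q.1 - m * q.2.2) * (m * a₁ q.2.1 + n * a₂ q.2.1)),
       -deriv a₁ q.2.1 + ε * deriv X q.2.1 * (1 + Real.cos (n * q.1 - m * q.2.2)) * a₁ q.2.1) := by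
  have key : ∀ v : ℝ × ℝ × ℝ, fderiv ℝ F q v =
      -(ε * deriv X q.2.1 * (1 + Real.cos (n * q.1 - m * q.2.2))) * v.2.1 +
      ε * X q.2.1 * Real.sin (n * q.1 - m * q.2.2) * (n * v.1 - m * v.2.2) := by
    intro v
    rw [hF.fderiv_eq]
    have hθ : HasFDerivAt (fun q : ℝ × ℝ × ℝ => q.2.1)
        ((ContinuousLinearMap.fst ℝ ℝ ℝ).comp (ContinuousLinearMap.snd ℝ ℝ (ℝ × ℝ))) q :=
      ((ContinuousLinearMap.fst ℝ ℝ ℝ).comp (ContinuousLinearMap.snd ℝ ℝ (ℝ × ℝ))).hasFDerivAt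
    have hφ : HasFDerivAt (fun q : ℝ × ℝ × ℝ => q.2.2)
        ((ContinuousLinearMap.snd ℝ ℝ ℝ).comp (ContinuousLinearMap.snd ℝ ℝ (ℝ × ℝ))) q :=
      ((ContinuousLinearMap.snd ℝ ℝ ℝ).comp (ContinuousLinearMap.snd ℝ ℝ (ℝ × ℝ))).hasFDerivAt
    have ht : HasFDerivAt (fun q : ℝ × ℝ × ℝ => q.1) (ContinuousLinearMap.fst ℝ ℝ (ℝ × ℝ)) q :=
      (ContinuousLinearMap.fst ℝ ℝ (ℝ × ℝ)).hasFDerivAt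
    have hX' : HasFDerivAt (fun q : ℝ × ℝ × ℝ => X q.2.1) _ q :=
      hX.hasDerivAt.comp_hasFDerivAt q hθ
    have hy : HasFDerivAt (fun q : ℝ × ℝ × ℝ => (n : ℝ) * q.1 - m * q.2.2) _ q :=
      (ht.const_mul (n : ℝ)).sub (hφ.const_mul (m : ℝ))
    have hall : HasFDerivAt (fun q : ℝ × ℝ × ℝ =>
        -(ε * X q.2.1 * (1 + Real.cos (n * q.1 - m * q.2.2)))) _ q :=
      ((hX'.const_mul ε).mul (hy.cos.const_add 1)).neg
    rw [hall.fderiv]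
    simp
    ring
  rw [reebVec, key, key, key, hF.eq_of_nhds, neg_neg]
  congr 1
  ext1
  · simp; ring
  ext1
  · simp; ring
  · simp

end Form1

section linearization

/-! ### The linearized return map in coordinates -/

theorem fderiv_coord_eq_zero {q v : ℝ × ℝ × ℝ} (hq : q.2.1 ∈ Set.Ioo 0 Real.pi)
    (h : fderiv ℝ coord q v = 0) : v = 0 := by
  have hs := (Real.sin_pos_of_mem_Ioo hq).ne'
  rw [fderiv_coord_apply] at h
  have h1 := congrArg (fun p : Amb => p.1) h
  have h2 := congrArg (fun p : Amb => p.2.1) h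
  have h3 := congrArg (fun p : Amb => p.2.2) h
  simp only [Prod.fst_zero, Prod.snd_zero] at h1 h2 h3
  have v2 : v.2.1 = 0 := by simpa [hs] using h3
  have v1 : v.1 = 0 := by simpa using h1
  have v3 : v.2.2 = 0 := by
    have hs' : Complex.sin q.2.1 ≠ 0 := by exact_mod_cast hs
    simpa [v2, hs'] using h2
  exact Prod.ext v1 (Prod.ext v2 v3)

/-- The lift of a closed orbit ends at a translate of its starting point; this identifies the
tangent vectors at both ends. -/
theorem fderiv_coord_congr {q q' : ℝ × ℝ × ℝ} (hq : q.2.1 ∈ Set.Ioo 0 Real.pi)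
    (hq' : q'.2.1 ∈ Set.Ioo 0 Real.pi) (h : coord q = coord q') :
    fderiv ℝ coord q = fderiv ℝ coord q' := by
  obtain ⟨h1, h2, h3⟩ := (coord_eq_coord_iff hq hq').1 h
  rw [← exp_ofReal_mul_I_eq_iff] at h2 h3
  refine ContinuousLinearMap.ext fun v => ?_
  rw [fderiv_coord_apply, fderiv_coord_apply, h1, h2, h3]

namespace Form1

theorem differentiableAt_reebVec {lam : Form1} {a₁ a₂ : ℝ → ℝ} {F : ℝ × ℝ × ℝ → ℝ}
    (h : lam.Toric a₁ a₂) (hF : ContDiff ℝ ∞ F) {q : ℝ × ℝ × ℝ}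
    (hq : q.2.1 ∈ Set.Ioo 0 Real.pi) : DifferentiableAt ℝ (reebVec a₁ a₂ F) q := by
  have hθ : DifferentiableAt ℝ (fun q : ℝ × ℝ × ℝ => q.2.1) q :=
    differentiableAt_fst.comp q differentiableAt_snd
  have hg : ∀ {g : ℝ → ℝ}, ContDiff ℝ ∞ g →
      DifferentiableAt ℝ (fun q : ℝ × ℝ × ℝ => g q.2.1) q := fun {g} hg =>
    DifferentiableAt.comp (g := g) q (hg.differentiable (by simp) _) hθ
  have hd : ∀ {g : ℝ → ℝ}, ContDiff ℝ ∞ g → ContDiff ℝ ∞ (deriv g) := fun {g} hg =>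
    (contDiff_infty_iff_deriv.mp hg).2
  have s1 := hg h.smooth₁
  have s2 := hg h.smooth₂
  have d1 := hg (hd h.smooth₁)
  have d2 := hg (hd h.smooth₂)
  have hdF : ∀ v, DifferentiableAt ℝ (fun q => fderiv ℝ F q v) q := fun v =>
    ((hF.fderiv_right (m := ∞) (by simp)).differentiable (by simp) q).clm_apply
      (differentiableAt_const v)
  have hF' := hF.differentiable (by simp) q
  unfold reebVec
  have hden : DifferentiableAt ℝ (fun q : ℝ × ℝ × ℝ =>
      a₁ q.2.1 * deriv a₂ q.2.1 - a₂ q.2.1 * deriv a₁ q.2.1) q := (s1.mul d2).sub (s2.mul d1)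
  have hne := (h.cross_neg _ hq).ne
  have hquot : DifferentiableAt ℝ (fun q : ℝ × ℝ × ℝ => Real.exp (-F q) /
      (a₁ q.2.1 * deriv a₂ q.2.1 - a₂ q.2.1 * deriv a₁ q.2.1)) q := by
    simp only [div_eq_mul_inv]
    exact hF'.neg.exp.mul (hden.inv hne)
  exact hquot.smul ((d2.add ((hdF _).mul s2)).prodMk (((s1.mul (hdF _)).sub (s2.mul (hdF _))).prodMk
      (d1.neg.sub ((hdF _).mul s1))))

end Form1

variable {lam : Form1} {a₁ a₂ : ℝ → ℝ} {f : Amb → ℝ}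

/-- The variational equation is natural under the chart: differentiating the identity between the
ambient and the coordinate Reeb field, and using symmetry of the second derivative of `coord`, shows
that the image of a solution in coordinates is again a solution. -/
theorem EmbReebOrbit.linReturn_of_coord (h : lam.Toric a₁ a₂) (hf : ContDiff ℝ ∞ f)
    (o : EmbReebOrbit (Form1.rescale f lam)) {q ξ : ℝ → ℝ × ℝ × ℝ}
    (hγ : ∀ s, o.γ s = coord (q s)) (hI : ∀ s, (q s).2.1 ∈ Set.Ioo 0 Real.pi)
    (hq : ∀ s, HasDerivAt q (Form1.reebVec a₁ a₂ (f ∘ coord) (q s)) s)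
    (hξ : ∀ s, HasDerivAt ξ (fderiv ℝ (Form1.reebVec a₁ a₂ (f ∘ coord)) (q s) (ξ s)) s) :
    o.LinReturn (fderiv ℝ coord (q 0) (ξ 0)) (fderiv ℝ coord (q 0) (ξ o.T)) := by
  have hz : ∀ s, |(o.γ s).2.2| < 1 := fun s => by
    rw [hγ]; exact abs_cos_lt_one (hI s)
  have hopen : IsOpen {p : Amb | |p.2.2| < 1} :=
    isOpen_lt (continuous_snd.comp continuous_snd).abs continuous_const
  refine ⟨{p | |p.2.2| < 1}, Form1.reebField a₁ a₂ f,
    fun s => fderiv ℝ coord (q s) (ξ s), hopen, ?_, Form1.contDiffOn_reebField h hf,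
    fun p hp => Form1.isReeb_reebField h hf hp.2 hp.1, rfl, ?_, fun s => ?_⟩
  · rintro _ ⟨s, rfl⟩
    exact hz s
  · have hper : o.γ o.T = o.γ 0 := by simpa using o.periodic 0
    rw [hγ, hγ] at hper
    simp only [fderiv_coord_congr (hI _) (hI _) hper]
  · have hE : HasFDerivAt (fderiv ℝ coord) (fderiv ℝ (fderiv ℝ coord) (q s)) (q s) :=
      (contDiff_fderiv_coord.differentiable (by simp) _).hasFDerivAt
    have hV := (hE.comp_hasDerivAt s (hq s)).clm_apply (hξ s)
    refine hV.congr_deriv ?_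
    have hΞ := (Form1.differentiableAt_reebVec h (hf.comp contDiff_coord) (hI s)).hasFDerivAt
    have hR : HasFDerivAt (Form1.reebField a₁ a₂ f)
        (fderiv ℝ (Form1.reebField a₁ a₂ f) (coord (q s))) (coord (q s)) := by
      have : ContDiffAt ℝ ∞ (Form1.reebField a₁ a₂ f) (coord (q s)) :=
        (Form1.contDiffOn_reebField h hf).contDiffAt (hopen.mem_nhds (by rw [← hγ]; exact hz s))
      exact (this.differentiableAt (by simp)).hasFDerivAt
    have h1 := hR.comp (q s) (hasFDerivAt_coord (q s))
    have h2 := hE.clm_apply hΞ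
    have hev : Form1.reebField a₁ a₂ f ∘ coord =ᶠ[nhds (q s)]
        fun q => fderiv ℝ coord q (Form1.reebVec a₁ a₂ (f ∘ coord) q) := by
      have hU : ∀ᶠ q' in nhds (q s), q'.2.1 ∈ Set.Ioo 0 Real.pi :=
        (continuous_fst.comp continuous_snd).continuousAt.eventually (isOpen_Ioo.mem_nhds (hI s))
      filter_upwards [hU] with q' hq'
      exact Form1.reebField_coord hf hq'
    have h3 := congrArg (fun A => A (ξ s)) (h1.unique (h2.congr_of_eventuallyEq hev))
    simp only [ContinuousLinearMap.comp_apply, add_apply,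
      ContinuousLinearMap.flip_apply] at h3
    rw [hγ, h3, fderiv_fderiv_coord_symm]
    simp only [Function.comp_apply]
    abel

/-! ### The two orbits that survive on a torus -/

/-- Near the torus `T(θ₀)` the function `f` is `-ε (1 + cos (n t - m φ))`. -/
def LocalModel (f : Amb → ℝ) (θ₀ ε : ℝ) (m n : ℤ) : Prop :=
  ∀ᶠ θ in nhds θ₀, ∀ t φ : ℝ, f (coord (t, θ, φ)) = -(ε * (1 + Real.cos (n * t - m * φ)))

section model

variable {θ₀ ε : ℝ} {m n : ℤ}

theorem LocalModel.eventually_reebVec (hF : LocalModel f θ₀ ε m n) :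
    ∀ᶠ θ in nhds θ₀, ∀ t φ : ℝ, Form1.reebVec a₁ a₂ (f ∘ coord) (t, θ, φ) =
      (Real.exp (ε * (1 + Real.cos (n * t - m * φ))) /
        (a₁ θ * deriv a₂ θ - a₂ θ * deriv a₁ θ)) •
      (deriv a₂ θ, -(ε * Real.sin (n * t - m * φ) * (m * a₁ θ + n * a₂ θ)), -deriv a₁ θ) := by
  filter_upwards [eventually_eventually_nhds.2 hF] with θ hθ t φ
  have hev : f ∘ coord =ᶠ[nhds (t, θ, φ)] fun q => -(ε * (fun _ : ℝ => (1 : ℝ)) q.2.1 *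
      (1 + Real.cos (n * q.1 - m * q.2.2))) := by
    have : ∀ᶠ q' : ℝ × ℝ × ℝ in nhds (t, θ, φ), ∀ t φ : ℝ, f (coord (t, q'.2.1, φ)) =
        -(ε * (1 + Real.cos (n * t - m * φ))) :=
      ((continuous_fst.comp continuous_snd).continuousAt
        (x := ((t, θ, φ) : ℝ × ℝ × ℝ))).eventually hθ
    filter_upwards [this] with q' hq'
    simpa using hq' q'.1 q'.2.2
  rw [Form1.reebVec_of_eventuallyEq (differentiableAt_const _) hev]
  simp

theorem HasDerivAt.line {E : Type*} [NormedAddCommGroup E] [NormedSpace ℝ E] (q v : E) :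
    HasDerivAt (fun s : ℝ => q + s • v) v 0 := by
  simpa using ((hasDerivAt_id (0 : ℝ)).smul_const v).const_add q

/-- The linearization of the Reeb field at an equilibrium, on the contact plane. -/
theorem fderiv_reebVec_equilibrium (h : lam.Toric a₁ a₂) (hf : ContDiff ℝ ∞ f)
    (hc : Form1.ClosedTorus a₁ a₂ θ₀ m n) (hF : LocalModel f θ₀ ε m n) {t φ σ : ℝ}
    (hsin : Real.sin (n * t - m * φ) = 0) (hcos : Real.cos (n * t - m * φ) = σ) (Θ Y : ℝ) :
    fderiv ℝ (Form1.reebVec a₁ a₂ (f ∘ coord)) (t, θ₀, φ)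
      (a₂ θ₀ / (m * a₁ θ₀ + n * a₂ θ₀) * Y, Θ, -(a₁ θ₀ / (m * a₁ θ₀ + n * a₂ θ₀)) * Y) =
    (a₂ θ₀ / (m * a₁ θ₀ + n * a₂ θ₀) *
      (Real.exp (ε * (1 + σ)) * (m * deriv (deriv a₁) θ₀ + n * deriv (deriv a₂) θ₀) /
        (a₁ θ₀ * deriv a₂ θ₀ - a₂ θ₀ * deriv a₁ θ₀) * Θ),
     -(Real.exp (ε * (1 + σ)) * (ε * σ * (m * a₁ θ₀ + n * a₂ θ₀)) /
        (a₁ θ₀ * deriv a₂ θ₀ - a₂ θ₀ * deriv a₁ θ₀) * Y),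
     -(a₁ θ₀ / (m * a₁ θ₀ + n * a₂ θ₀)) *
      (Real.exp (ε * (1 + σ)) * (m * deriv (deriv a₁) θ₀ + n * deriv (deriv a₂) θ₀) /
        (a₁ θ₀ * deriv a₂ θ₀ - a₂ θ₀ * deriv a₁ θ₀) * Θ)) := by
  have hΔ := (h.cross_neg θ₀ hc.mem).ne
  have hb := hc.pos.ne'
  have r₁ := hc.reeb₁
  have r₂ := hc.reeb₂
  rw [div_eq_div_iff hΔ hb] at r₁ r₂
  set q : ℝ × ℝ × ℝ := (t, θ₀, φ) with hq
  set b := m * a₁ θ₀ + n * a₂ θ₀ with hbdef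
  -- This vector is annihilated by `a₁ dt + a₂ dφ` and changes `n t - m φ` at rate `Y`, so `(Θ, Y)`
  -- are coordinates on the contact plane.
  set ξ : ℝ × ℝ × ℝ := (a₂ θ₀ / b * Y, Θ, -(a₁ θ₀ / b) * Y) with hξ
  have hdir : HasDerivAt (fun s : ℝ => Form1.reebVec a₁ a₂ (f ∘ coord) (q + s • ξ))
      (fderiv ℝ (Form1.reebVec a₁ a₂ (f ∘ coord)) q ξ) 0 := by
    have hd := (Form1.differentiableAt_reebVec h (hf.comp contDiff_coord) (q := q)
      hc.mem).hasFDerivAt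
    refine HasFDerivAt.comp_hasDerivAt (0 : ℝ)
      (l := Form1.reebVec a₁ a₂ (f ∘ coord)) (f := fun s : ℝ => q + s • ξ) ?_ (HasDerivAt.line q ξ)
    simpa using hd
  have hlθ : HasDerivAt (fun s : ℝ => θ₀ + s * Θ) Θ 0 := HasDerivAt.line (E := ℝ) θ₀ Θ
  have hly : HasDerivAt (fun s : ℝ => (n * t - m * φ) + s * Y) Y 0 := HasDerivAt.line (E := ℝ) _ Y
  have hev : (fun s : ℝ => Form1.reebVec a₁ a₂ (f ∘ coord) (q + s • ξ)) =ᶠ[nhds 0] fun s =>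
      (Real.exp (ε * (1 + Real.cos ((n * t - m * φ) + s * Y))) /
        (a₁ (θ₀ + s * Θ) * deriv a₂ (θ₀ + s * Θ) - a₂ (θ₀ + s * Θ) * deriv a₁ (θ₀ + s * Θ))) •
      (deriv a₂ (θ₀ + s * Θ), -(ε * Real.sin ((n * t - m * φ) + s * Y) *
        (m * a₁ (θ₀ + s * Θ) + n * a₂ (θ₀ + s * Θ))), -deriv a₁ (θ₀ + s * Θ)) := by
    have ht : Filter.Tendsto (fun s : ℝ => θ₀ + s * Θ) (nhds 0) (nhds θ₀) := by
      simpa using hlθ.continuousAt.tendsto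
    filter_upwards [ht.eventually (hF.eventually_reebVec (a₁ := a₁) (a₂ := a₂))] with s hs
    have e1 : q + s • ξ = (t + s * (a₂ θ₀ / b * Y), θ₀ + s * Θ, φ + s * (-(a₁ θ₀ / b) * Y)) := by
      simp [hq, hξ]
    have e2 : n * (t + s * (a₂ θ₀ / b * Y)) - m * (φ + s * (-(a₁ θ₀ / b) * Y)) =
        (n * t - m * φ) + s * Y := by
      field_simp
      rw [hbdef]
      ring
    rw [e1, hs, e2]
  have hdd : ∀ {g : ℝ → ℝ}, ContDiff ℝ ∞ g →
      HasDerivAt (fun s : ℝ => g (θ₀ + s * Θ)) (deriv g θ₀ * Θ) 0 := by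
    intro g hg
    have hg' : HasDerivAt g (deriv g θ₀) (θ₀ + 0 * Θ) := by
      simpa using (hg.differentiable (by simp) θ₀).hasDerivAt
    exact hg'.comp (0 : ℝ) hlθ
  have hd : ∀ {g : ℝ → ℝ}, ContDiff ℝ ∞ g → ContDiff ℝ ∞ (deriv g) := fun {g} hg =>
    (contDiff_infty_iff_deriv.mp hg).2
  have s1 := hdd h.smooth₁
  have s2 := hdd h.smooth₂
  have d1 := hdd (hd h.smooth₁)
  have d2 := hdd (hd h.smooth₂)
  set Δ := a₁ θ₀ * deriv a₂ θ₀ - a₂ θ₀ * deriv a₁ θ₀ with hΔdef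
  have hexp : HasDerivAt (fun s : ℝ => Real.exp (ε * (1 + Real.cos ((n * t - m * φ) + s * Y))))
      0 0 := ((hly.cos.const_add 1).const_mul ε).exp.congr_deriv (by simp [hsin])
  have hden : HasDerivAt (fun s : ℝ =>
      a₁ (θ₀ + s * Θ) * deriv a₂ (θ₀ + s * Θ) - a₂ (θ₀ + s * Θ) * deriv a₁ (θ₀ + s * Θ))
      ((a₁ θ₀ * deriv (deriv a₂) θ₀ - a₂ θ₀ * deriv (deriv a₁) θ₀) * Θ) 0 :=
    ((s1.mul d2).sub (s2.mul d1)).congr_deriv (by simp only [zero_mul, add_zero]; ring)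
  have hquot := hexp.div hden (by simpa using hΔ)
  have hsinb : HasDerivAt (fun s : ℝ => -(ε * Real.sin ((n * t - m * φ) + s * Y) *
      (m * a₁ (θ₀ + s * Θ) + n * a₂ (θ₀ + s * Θ)))) (-(ε * σ * b * Y)) 0 :=
    (((hly.sin.const_mul ε).mul ((s1.const_mul (m : ℝ)).add (s2.const_mul (n : ℝ)))).neg).congr_deriv
      (by simp only [zero_mul, add_zero, hsin, hcos, Pi.add_apply, hbdef]; ring)
  have hfin := hdir.unique ((hquot.smul (d2.prodMk (hsinb.prodMk d1.neg))).congr_of_eventuallyEq hev)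
  simp only [zero_mul, add_zero, hsin, hcos, Pi.div_apply, Pi.neg_apply, ← hΔdef, zero_sub, mul_zero,
    neg_zero] at hfin
  rw [hfin]
  clear_value b Δ
  simp only [Prod.smul_mk, smul_eq_mul, Prod.mk_add_mk]
  clear hdir hev hexp hden hquot hsinb hfin s1 s2 d1 d2 hdd hd hlθ hly
  generalize Real.exp (ε * (1 + σ)) = E
  generalize deriv (deriv a₁) θ₀ = A at *
  generalize deriv (deriv a₂) θ₀ = B at *
  refine Prod.ext ?_ (Prod.ext ?_ ?_)
  -- The closing relations replace `a₁'` and `a₂'` by multiples of `Δ / b`. The derivative of `aᵢ' /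
  -- Δ` then collapses to a multiple of `b''`, and the result lies again in the contact plane.
  · simp only
    field_simp
    linear_combination (-(a₁ θ₀ * B - a₂ θ₀ * A) * E * Θ) * r₁ + E * Θ * Δ * B * hbdef
  · simp only
    field_simp
    ring
  · simp only
    field_simp
    linear_combination (-(a₁ θ₀ * B - a₂ θ₀ * A) * E * Θ) * r₂ - E * Θ * Δ * A * hbdef

end model

end linearization

/-! ### Explicit orbits over the equilibria and their return maps. -/

section modelOrbits

variable {lam : Form1} {a₁ a₂ : ℝ → ℝ} {f : Amb → ℝ} {θ₀ ε : ℝ} {m n : ℤ}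

/-- The line in coordinates that is traced with speed `c` in the direction `(m, n)` and on which
`n t - m φ = y₀`, provided that `k m + l n = 1`. -/
def coordLine (θ₀ : ℝ) (m n k l : ℤ) (y₀ c s : ℝ) : ℝ × ℝ × ℝ :=
  (l * y₀ + m * (c * s), θ₀, -(k * y₀) + n * (c * s))

theorem coordLine_phase {k l : ℤ} (hkl : k * m + l * n = 1) (y₀ c s : ℝ) :
    n * (coordLine θ₀ m n k l y₀ c s).1 - m * (coordLine θ₀ m n k l y₀ c s).2.2 = y₀ := by
  have : (k * m + l * n : ℝ) = 1 := by exact_mod_cast hkl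
  simp only [coordLine]
  linear_combination y₀ * this

theorem hasDerivAt_coordLine (k l : ℤ) (y₀ c s : ℝ) :
    HasDerivAt (coordLine θ₀ m n k l y₀ c) (m * c, 0, n * c) s := by
  have h : ∀ (x : ℝ) (j : ℤ), HasDerivAt (fun s : ℝ => x + j * (c * s)) (j * c) s := fun x j => by
    simpa using (((hasDerivAt_id s).const_mul c).const_mul (j : ℝ)).const_add x
  exact (h _ m).prodMk ((hasDerivAt_const s θ₀).prodMk (h _ n))

theorem coord_coordLine_eq_iff (hθ : θ₀ ∈ Set.Ioo 0 Real.pi) {k l : ℤ} (hkl : k * m + l * n = 1)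
    {y₀ c s s' : ℝ} :
    coord (coordLine θ₀ m n k l y₀ c s) = coord (coordLine θ₀ m n k l y₀ c s') ↔
      ∃ j : ℤ, c * (s - s') = 2 * Real.pi * j := by
  rw [coord_eq_coord_iff (q := coordLine θ₀ m n k l y₀ c s)
    (q' := coordLine θ₀ m n k l y₀ c s') hθ hθ]
  simp only [coordLine, true_and]
  constructor
  · rintro ⟨⟨i, hi⟩, j, hj⟩
    refine ⟨k * i + l * j, ?_⟩
    have : (k * m + l * n : ℝ) = 1 := by exact_mod_cast hkl
    push_cast
    linear_combination k * hi + l * hj - c * (s - s') * this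
  · rintro ⟨j, hj⟩
    refine ⟨⟨m * j, ?_⟩, ⟨n * j, ?_⟩⟩ <;> push_cast
    · linear_combination m * hj
    · linear_combination n * hj

/-- When `sin y₀ = 0` the `θ`-component vanishes, and the closing relations turn the rest into a
multiple of `(m, n)`: the unperturbed flow, sped up by `e^{-f}`. -/
theorem reebVec_equilibrium (hc : Form1.ClosedTorus a₁ a₂ θ₀ m n) (hF : LocalModel f θ₀ ε m n)
    {q : ℝ × ℝ × ℝ} (hq : q.2.1 = θ₀) {y₀ : ℝ} (hy : n * q.1 - m * q.2.2 = y₀)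
    (hsin : Real.sin y₀ = 0) :
    Form1.reebVec a₁ a₂ (f ∘ coord) q =
      (m * (Real.exp (ε * (1 + Real.cos y₀)) / (m * a₁ θ₀ + n * a₂ θ₀)), 0,
       n * (Real.exp (ε * (1 + Real.cos y₀)) / (m * a₁ θ₀ + n * a₂ θ₀))) := by
  obtain ⟨t, θ, φ⟩ := q
  simp only at hq hy
  subst hq
  rw [hF.eventually_reebVec.self_of_nhds, hy, hsin]
  have r₁ := hc.reeb₁
  have r₂ := hc.reeb₂
  simp only [Prod.smul_mk, smul_eq_mul, mul_zero, zero_mul, neg_zero]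
  refine Prod.ext ?_ (Prod.ext rfl ?_)
  · simp only
    rw [div_mul_eq_mul_div, mul_div_assoc, r₁]
    ring
  · simp only
    rw [div_mul_eq_mul_div, mul_div_assoc, r₂]
    ring

/-- The straight line in direction `(m, n)` integrates the Reeb field. Because `(m, n)` is primitive
it first closes up when its parameter has advanced by `2π`, which gives both the period and
injectivity. -/
theorem exists_equilibriumOrbit (h : lam.Toric a₁ a₂) (hf : ContDiff ℝ ∞ f)
    (hc : Form1.ClosedTorus a₁ a₂ θ₀ m n) (hF : LocalModel f θ₀ ε m n) {k l : ℤ}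
    (hkl : k * m + l * n = 1) {y₀ : ℝ} (hsin : Real.sin y₀ = 0) :
    ∃ o : EmbReebOrbit (Form1.rescale f lam),
      (∀ s, o.γ s = coord (coordLine θ₀ m n k l y₀
        (Real.exp (ε * (1 + Real.cos y₀)) / (m * a₁ θ₀ + n * a₂ θ₀)) s)) ∧
      o.T = 2 * Real.pi * (m * a₁ θ₀ + n * a₂ θ₀) / Real.exp (ε * (1 + Real.cos y₀)) := by
  have hb := hc.pos
  have hE := Real.exp_pos (ε * (1 + Real.cos y₀))
  set b := m * a₁ θ₀ + n * a₂ θ₀ with hbd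
  set E := Real.exp (ε * (1 + Real.cos y₀))
  have hpi := Real.pi_pos
  have hcpos : 0 < E / b := div_pos hE hb
  have hR := fun s => reebVec_equilibrium (f := f) hc hF (q := coordLine θ₀ m n k l y₀ (E / b) s)
    rfl (coordLine_phase hkl y₀ _ s) hsin
  have hTc : E / b * (2 * Real.pi * b / E) = 2 * Real.pi := by field_simp
  refine ⟨⟨fun s => coord (coordLine θ₀ m n k l y₀ (E / b) s), 2 * Real.pi * b / E,
    by positivity, fun s => coord_mem _, fun s => ?_, fun s => ?_, fun s hs s' hs' heq => ?_⟩,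
    fun s => rfl, rfl⟩
  · refine ⟨_, Form1.isReeb_reebVec h hf (q := coordLine θ₀ m n k l y₀ (E / b) s) hc.mem, ?_⟩
    rw [hR]
    exact (hasFDerivAt_coord _).comp_hasDerivAt s (hasDerivAt_coordLine k l y₀ (E / b) s)
  · rw [coord_coordLine_eq_iff hc.mem hkl]
    refine ⟨1, ?_⟩
    rw [add_sub_cancel_left, hTc]
    simp
  · rw [coord_coordLine_eq_iff hc.mem hkl] at heq
    obtain ⟨j, hj⟩ := heq
    have h1 : |E / b * (s - s')| < 2 * Real.pi := by
      rw [abs_mul, abs_of_pos hcpos, ← hTc]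
      refine mul_lt_mul_of_pos_left ?_ hcpos
      rw [abs_lt]
      constructor <;> linarith [hs.1, hs.2, hs'.1, hs'.2]
    rw [hj, abs_mul, abs_of_pos Real.two_pi_pos] at h1
    have h2 : |(j : ℝ)| < 1 := by
      by_contra hcon
      push Not at hcon
      nlinarith [Real.two_pi_pos]
    have h3 : |j| < 1 := by exact_mod_cast h2
    rw [Int.abs_lt_one_iff.mp h3] at hj
    simp only [Int.cast_zero, mul_zero] at hj
    have := (mul_eq_zero.mp hj).resolve_left hcpos.ne'
    linarith

section orbit

variable {k l : ℤ} {y₀ : ℝ} {o : EmbReebOrbit (Form1.rescale f lam)}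

theorem EmbReebOrbit.hasClass_of_coordLine {c : ℝ}
    (ho : ∀ s, o.γ s = coord (coordLine θ₀ m n k l y₀ c s)) (hT : c * o.T = 2 * Real.pi) :
    o.HasClass θ₀ m n := by
  refine ⟨fun s => l * y₀ + m * (c * s), fun s => -(k * y₀) + n * (c * s), by fun_prop,
    by fun_prop, ho, fun s => ?_, fun s => ?_⟩
  · linear_combination m * hT
  · linear_combination n * hT

/-- The vector in the contact plane with components `Θ` along `∂_θ` and `Y` along `n t - m φ`. -/
noncomputable def planeVec (a₁ a₂ : ℝ → ℝ) (θ₀ : ℝ) (m n : ℤ) (Θ Y : ℝ) : ℝ × ℝ × ℝ :=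
  (a₂ θ₀ / (m * a₁ θ₀ + n * a₂ θ₀) * Y, Θ, -(a₁ θ₀ / (m * a₁ θ₀ + n * a₂ θ₀)) * Y)

theorem planeVec_smul_add (r r' Θ Y Θ' Y' : ℝ) :
    r • planeVec a₁ a₂ θ₀ m n Θ Y + r' • planeVec a₁ a₂ θ₀ m n Θ' Y' =
      planeVec a₁ a₂ θ₀ m n (r * Θ + r' * Θ') (r * Y + r' * Y') := by
  simp only [planeVec, Prod.smul_mk, Prod.mk_add_mk, smul_eq_mul]
  refine Prod.ext ?_ (Prod.ext rfl ?_) <;> simp only <;> ring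

theorem planeVec_smul (r Θ Y : ℝ) :
    r • planeVec a₁ a₂ θ₀ m n Θ Y = planeVec a₁ a₂ θ₀ m n (r * Θ) (r * Y) := by
  simpa using planeVec_smul_add (a₁ := a₁) (a₂ := a₂) (θ₀ := θ₀) (m := m) (n := n) r 0 Θ Y 0 0

theorem inPlane_planeVec (h : lam.Toric a₁ a₂) {q : ℝ × ℝ × ℝ} (hq : q.2.1 = θ₀)
    (hθ : θ₀ ∈ Set.Ioo 0 Real.pi) (Θ Y : ℝ) :
    (Form1.rescale f lam).InPlane (coord q)
      (fderiv ℝ coord q (planeVec a₁ a₂ θ₀ m n Θ Y)) := by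
  refine ⟨isTangent_fderiv_coord _ _, ?_⟩
  rw [Form1.rescale_coord h.coordExpr (by rw [hq]; exact Set.Ioo_subset_Icc_self hθ), hq]
  simp only [planeVec]
  ring

/-- Along such an orbit the linearization has constant coefficients, so the return map on the
contact plane is the time-`T` map of a planar linear system for `(Θ, Y)`. -/
theorem EmbReebOrbit.linReturn_planeVec (h : lam.Toric a₁ a₂) (hf : ContDiff ℝ ∞ f)
    (hc : Form1.ClosedTorus a₁ a₂ θ₀ m n) (hF : LocalModel f θ₀ ε m n)
    (hkl : k * m + l * n = 1) (hsin : Real.sin y₀ = 0)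
    (ho : ∀ s, o.γ s = coord (coordLine θ₀ m n k l y₀
        (Real.exp (ε * (1 + Real.cos y₀)) / (m * a₁ θ₀ + n * a₂ θ₀)) s))
    {Θ Y : ℝ → ℝ}
    (hY : ∀ s, HasDerivAt Y (Real.exp (ε * (1 + Real.cos y₀)) *
      (m * deriv (deriv a₁) θ₀ + n * deriv (deriv a₂) θ₀) /
        (a₁ θ₀ * deriv a₂ θ₀ - a₂ θ₀ * deriv a₁ θ₀) * Θ s) s)
    (hΘ : ∀ s, HasDerivAt Θ (-(Real.exp (ε * (1 + Real.cos y₀)) *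
      (ε * Real.cos y₀ * (m * a₁ θ₀ + n * a₂ θ₀)) /
        (a₁ θ₀ * deriv a₂ θ₀ - a₂ θ₀ * deriv a₁ θ₀) * Y s)) s) :
    o.LinReturn
      (fderiv ℝ coord (coordLine θ₀ m n k l y₀ (Real.exp (ε * (1 + Real.cos y₀)) /
        (m * a₁ θ₀ + n * a₂ θ₀)) 0) (planeVec a₁ a₂ θ₀ m n (Θ 0) (Y 0)))
      (fderiv ℝ coord (coordLine θ₀ m n k l y₀ (Real.exp (ε * (1 + Real.cos y₀)) /
        (m * a₁ θ₀ + n * a₂ θ₀)) 0) (planeVec a₁ a₂ θ₀ m n (Θ o.T) (Y o.T))) := by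
  refine EmbReebOrbit.linReturn_of_coord h hf o
    (ξ := fun s => planeVec a₁ a₂ θ₀ m n (Θ s) (Y s)) ho (fun s => hc.mem) (fun s => ?_)
    (fun s => ?_)
  · rw [reebVec_equilibrium hc hF rfl (coordLine_phase hkl y₀ _ s) hsin]
    exact hasDerivAt_coordLine k l y₀ _ s
  · have hph := coordLine_phase (θ₀ := θ₀) hkl y₀
      (Real.exp (ε * (1 + Real.cos y₀)) / (m * a₁ θ₀ + n * a₂ θ₀)) s
    have := fderiv_reebVec_equilibrium h hf hc hF
      (t := (coordLine θ₀ m n k l y₀ (Real.exp (ε * (1 + Real.cos y₀)) /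
        (m * a₁ θ₀ + n * a₂ θ₀)) s).1)
      (φ := (coordLine θ₀ m n k l y₀ (Real.exp (ε * (1 + Real.cos y₀)) /
        (m * a₁ θ₀ + n * a₂ θ₀)) s).2.2) (σ := Real.cos y₀)
      (by rw [hph]; exact hsin) (by rw [hph]) (Θ s) (Y s)
    refine HasDerivAt.congr_deriv ?_ this.symm
    exact ((hY s).const_mul _).prodMk ((hΘ s).prodMk ((hY s).const_mul _))

/-- At `y₀ = 0` both coefficients in `Y' = κ₁ Θ`, `Θ' = κ₂ Y` are positive, because `b''` and `Δ`
are negative: a saddle. -/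
theorem EmbReebOrbit.isPosHyperbolic_of_coordLine (h : lam.Toric a₁ a₂) (hf : ContDiff ℝ ∞ f)
    (hc : Form1.ClosedTorus a₁ a₂ θ₀ m n) (hF : LocalModel f θ₀ ε m n) (hε : 0 < ε)
    (hneg : m * deriv (deriv a₁) θ₀ + n * deriv (deriv a₂) θ₀ < 0)
    (hkl : k * m + l * n = 1) (hsin : Real.sin y₀ = 0) (hcos : Real.cos y₀ = 1)
    (ho : ∀ s, o.γ s = coord (coordLine θ₀ m n k l y₀
        (Real.exp (ε * (1 + Real.cos y₀)) / (m * a₁ θ₀ + n * a₂ θ₀)) s)) :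
    o.IsPosHyperbolic := by
  have hΔ := h.cross_neg θ₀ hc.mem
  have hb := hc.pos
  have hE := Real.exp_pos (ε * (1 + Real.cos y₀))
  have key := fun {Θ Y : ℝ → ℝ} hY hΘ =>
    EmbReebOrbit.linReturn_planeVec (Θ := Θ) (Y := Y) h hf hc hF hkl hsin ho hY hΘ
  rw [hcos, mul_one] at key
  set q₀ := coordLine θ₀ m n k l y₀
    (Real.exp (ε * (1 + Real.cos y₀)) / (m * a₁ θ₀ + n * a₂ θ₀)) 0 with hq₀
  rw [hcos] at hE hq₀
  rw [← hq₀] at key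
  obtain ⟨κ₁, hκ₁⟩ : ∃ κ, κ = Real.exp (ε * (1 + 1)) *
    (m * deriv (deriv a₁) θ₀ + n * deriv (deriv a₂) θ₀) /
      (a₁ θ₀ * deriv a₂ θ₀ - a₂ θ₀ * deriv a₁ θ₀) := ⟨_, rfl⟩
  obtain ⟨κ₂, hκ₂⟩ : ∃ κ, κ = -(Real.exp (ε * (1 + 1)) * (ε * (m * a₁ θ₀ + n * a₂ θ₀)) /
    (a₁ θ₀ * deriv a₂ θ₀ - a₂ θ₀ * deriv a₁ θ₀)) := ⟨_, rfl⟩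
  simp only [← neg_mul, ← hκ₁, ← hκ₂] at key
  have p₁ : 0 < κ₁ := by
    rw [hκ₁]; exact div_pos_of_neg_of_neg (mul_neg_of_pos_of_neg hE hneg) hΔ
  have p₂ : 0 < κ₂ := by
    rw [hκ₂, ← div_neg]; exact div_pos (by positivity) (by linarith)
  -- With `rᵢ² = κᵢ` the vectors `(Θ, Y) = (± r₂, r₁)` are eigenvectors with rates `± r₁ r₂`.
  set r₁ := √κ₁ with hr₁
  set r₂ := √κ₂ with hr₂
  have e₁ : r₁ * r₁ = κ₁ := Real.mul_self_sqrt p₁.le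
  have e₂ : r₂ * r₂ = κ₂ := Real.mul_self_sqrt p₂.le
  have pr₁ : 0 < r₁ := Real.sqrt_pos.2 p₁
  have pr₂ : 0 < r₂ := Real.sqrt_pos.2 p₂
  have hexp : ∀ (c ν s : ℝ), HasDerivAt (fun s => c * Real.exp (ν * s))
      (c * ν * Real.exp (ν * s)) s := fun c ν s => by
    have := (((hasDerivAt_id s).const_mul ν).exp).const_mul c
    refine this.congr_deriv ?_
    simp only [id, mul_one]; ring
  have hγ0 : o.γ 0 = coord q₀ := ho 0
  have hq0θ : q₀.2.1 = θ₀ := rfl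
  have hI : q₀.2.1 ∈ Set.Ioo 0 Real.pi := hc.mem
  have hT := o.T_pos
  refine ⟨Real.exp (r₁ * r₂ * o.T), fderiv ℝ coord q₀ (planeVec a₁ a₂ θ₀ m n r₂ r₁),
    fderiv ℝ coord q₀ (planeVec a₁ a₂ θ₀ m n (-r₂) r₁), Real.exp_pos _, ?_, ?_, ?_, ?_, ?_, ?_⟩
  · have : 0 < r₁ * r₂ * o.T := by positivity
    exact (Real.one_lt_exp_iff.2 this).ne'
  · rw [hγ0]; exact inPlane_planeVec h hq0θ hc.mem _ _
  · rw [hγ0]; exact inPlane_planeVec h hq0θ hc.mem _ _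
  · rw [LinearIndependent.pair_iff]
    intro s t hst
    rw [← map_smul, ← map_smul, ← map_add, planeVec_smul_add] at hst
    have h0 := fderiv_coord_eq_zero hI hst
    have hΘ := congrArg (fun v : ℝ × ℝ × ℝ => v.2.1) h0
    have h1 := congrArg (fun v : ℝ × ℝ × ℝ => n * v.1 - m * v.2.2) h0
    simp only [planeVec, Prod.snd_zero, Prod.fst_zero, mul_zero, sub_zero] at hΘ h1
    have hY : s * r₁ + t * r₁ = 0 := by
      rw [← h1]; field_simp; ring
    have i1 : s + t = 0 := by
      rw [← add_mul] at hY
      exact (mul_eq_zero.mp hY).resolve_right pr₁.ne'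
    have i2 : s - t = 0 := by
      have : (s - t) * r₂ = 0 := by linear_combination hΘ
      exact (mul_eq_zero.mp this).resolve_right pr₂.ne'
    constructor <;> linarith
  · have := key (Θ := fun s => r₂ * Real.exp (r₁ * r₂ * s))
      (Y := fun s => r₁ * Real.exp (r₁ * r₂ * s))
      (fun s => (hexp _ _ s).congr_deriv (by rw [← e₁]; ring))
      (fun s => (hexp _ _ s).congr_deriv (by rw [← e₂]; ring))
    rw [← map_smul, planeVec_smul]
    simpa [mul_comm] using this
  · have := key (Θ := fun s => -r₂ * Real.exp (-(r₁ * r₂) * s))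
      (Y := fun s => r₁ * Real.exp (-(r₁ * r₂) * s))
      (fun s => (hexp _ _ s).congr_deriv (by rw [← e₁]; ring))
      (fun s => (hexp _ _ s).congr_deriv (by rw [← e₂]; ring))
    rw [← map_smul, planeVec_smul, ← Real.exp_neg, ← neg_mul]
    simpa [mul_comm] using this

/-- At `y₀ = π` the sign of one coefficient flips: `Y' = κ₁ Θ`, `Θ' = -κ₂ Y` with both constants
positive. In the basis rescaled by `√κ₂` and `√κ₁` this is a rotation of speed `√(κ₁ κ₂)`, in the
positive sense because `Δ < 0`, and the condition on `ε` says that its angle after one period is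
`2πρ`. -/
theorem EmbReebOrbit.isEllipticWith_of_coordLine (h : lam.Toric a₁ a₂) (hf : ContDiff ℝ ∞ f)
    (hc : Form1.ClosedTorus a₁ a₂ θ₀ m n) (hF : LocalModel f θ₀ ε m n) (hε : 0 < ε)
    (hneg : m * deriv (deriv a₁) θ₀ + n * deriv (deriv a₂) θ₀ < 0)
    (hkl : k * m + l * n = 1) (hsin : Real.sin y₀ = 0) (hcos : Real.cos y₀ = -1)
    (ho : ∀ s, o.γ s = coord (coordLine θ₀ m n k l y₀
        (Real.exp (ε * (1 + Real.cos y₀)) / (m * a₁ θ₀ + n * a₂ θ₀)) s))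
    (hT : o.T = 2 * Real.pi * (m * a₁ θ₀ + n * a₂ θ₀)) {ρ : ℝ} (hρ : Irrational ρ) (hρ0 : 0 < ρ)
    (hερ : ε * (-(m * deriv (deriv a₁) θ₀ + n * deriv (deriv a₂) θ₀) *
      (m * a₁ θ₀ + n * a₂ θ₀) ^ 3 / (a₁ θ₀ * deriv a₂ θ₀ - a₂ θ₀ * deriv a₁ θ₀) ^ 2) = ρ ^ 2) :
    o.IsEllipticWith ρ := by
  have hΔ := h.cross_neg θ₀ hc.mem
  have hb := hc.pos
  have key := fun {Θ Y : ℝ → ℝ} hY hΘ =>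
    EmbReebOrbit.linReturn_planeVec (Θ := Θ) (Y := Y) h hf hc hF hkl hsin ho hY hΘ
  set q₀ := coordLine θ₀ m n k l y₀
    (Real.exp (ε * (1 + Real.cos y₀)) / (m * a₁ θ₀ + n * a₂ θ₀)) 0 with hq₀
  simp only [hcos, add_neg_cancel, mul_zero, Real.exp_zero, one_mul] at key
  obtain ⟨κ₁, hκ₁⟩ : ∃ κ, κ = (m * deriv (deriv a₁) θ₀ + n * deriv (deriv a₂) θ₀) /
      (a₁ θ₀ * deriv a₂ θ₀ - a₂ θ₀ * deriv a₁ θ₀) := ⟨_, rfl⟩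
  obtain ⟨κ₂, hκ₂⟩ : ∃ κ, κ = ε * -1 * (m * a₁ θ₀ + n * a₂ θ₀) /
    (a₁ θ₀ * deriv a₂ θ₀ - a₂ θ₀ * deriv a₁ θ₀) := ⟨_, rfl⟩
  simp only [← hκ₁, ← hκ₂] at key
  have p₁ : 0 < κ₁ := by rw [hκ₁]; exact div_pos_of_neg_of_neg hneg hΔ
  have p₂ : 0 < κ₂ := by
    rw [hκ₂]
    refine div_pos_of_neg_of_neg ?_ hΔ
    have := mul_pos hε hb
    linarith
  set r₁ := √κ₁ with hr₁
  set r₂ := √κ₂ with hr₂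
  have e₁ : r₁ * r₁ = κ₁ := Real.mul_self_sqrt p₁.le
  have e₂ : r₂ * r₂ = κ₂ := Real.mul_self_sqrt p₂.le
  have pr₁ : 0 < r₁ := Real.sqrt_pos.2 p₁
  have pr₂ : 0 < r₂ := Real.sqrt_pos.2 p₂
  have hangle : r₁ * r₂ * o.T = 2 * Real.pi * ρ := by
    have h1 : r₁ * r₂ * (m * a₁ θ₀ + n * a₂ θ₀) = ρ := by
      rw [← pow_left_inj₀ (by positivity) hρ0.le two_ne_zero, ← hερ]
      have : (r₁ * r₂ * (m * a₁ θ₀ + n * a₂ θ₀)) ^ 2 =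
          (r₁ * r₁) * (r₂ * r₂) * (m * a₁ θ₀ + n * a₂ θ₀) ^ 2 := by ring
      rw [this, e₁, e₂, hκ₁, hκ₂]
      field_simp
    rw [hT]
    linear_combination (2 * Real.pi) * h1
  have hcosd : ∀ (c ν s : ℝ), HasDerivAt (fun s => c * Real.cos (ν * s))
      (-(c * ν * Real.sin (ν * s))) s := fun c ν s => by
    have := (((hasDerivAt_id s).const_mul ν).cos).const_mul c
    refine this.congr_deriv ?_
    simp only [id, mul_one]; ring
  have hsind : ∀ (c ν s : ℝ), HasDerivAt (fun s => c * Real.sin (ν * s))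
      (c * ν * Real.cos (ν * s)) s := fun c ν s => by
    have := (((hasDerivAt_id s).const_mul ν).sin).const_mul c
    refine this.congr_deriv ?_
    simp only [id, mul_one]; ring
  have hγ0 : o.γ 0 = coord q₀ := ho 0
  have hq0θ : q₀.2.1 = θ₀ := rfl
  have hI : q₀.2.1 ∈ Set.Ioo 0 Real.pi := hc.mem
  refine ⟨hρ, fderiv ℝ coord q₀ (planeVec a₁ a₂ θ₀ m n r₂ 0),
    fderiv ℝ coord q₀ (planeVec a₁ a₂ θ₀ m n 0 r₁), ?_, ?_, ?_, ?_, ?_⟩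
  · rw [hγ0]; exact inPlane_planeVec h hq0θ hc.mem _ _
  · rw [hγ0]; exact inPlane_planeVec h hq0θ hc.mem _ _
  · rw [hγ0, Form1.d_rescale_coord h.smooth h.smooth₁ h.smooth₂ h.coordExpr hf hI, hq0θ]
    refine mul_pos (Real.exp_pos _) ?_
    simp only [planeVec]
    have : 0 < r₂ * (r₁ * (-(a₁ θ₀ * deriv a₂ θ₀ - a₂ θ₀ * deriv a₁ θ₀) /
        (m * a₁ θ₀ + n * a₂ θ₀))) :=
      mul_pos pr₂ (mul_pos pr₁ (div_pos (by linarith) hb))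
    refine this.trans_eq ?_
    field_simp
    ring
  · have := key (Θ := fun s => r₂ * Real.cos (r₁ * r₂ * s))
      (Y := fun s => r₁ * Real.sin (r₁ * r₂ * s))
      (fun s => (hsind _ _ s).congr_deriv (by rw [← e₁]; ring))
      (fun s => (hcosd _ _ s).congr_deriv (by rw [← e₂]; ring))
    rw [← map_smul, ← map_smul, ← map_add, planeVec_smul_add, ← hangle]
    simpa [mul_comm] using this
  · have := key (Θ := fun s => -r₂ * Real.sin (r₁ * r₂ * s))
      (Y := fun s => r₁ * Real.cos (r₁ * r₂ * s))
      (fun s => (hcosd _ _ s).congr_deriv (by rw [← e₁]; ring))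
      (fun s => (hsind _ _ s).congr_deriv (by rw [← e₂]; ring))
    rw [← map_smul, ← map_smul, ← map_add, planeVec_smul_add, ← hangle]
    simpa [mul_comm] using this

end orbit

end modelOrbits

section awayFromTori

/-! ### Orbits away from the perturbed region, and orbits in the poles -/

/-- The level set through `s₀` is closed by continuity. It is also open: its points are mapped
outside the closed set `K`, so the derivative vanishes near each of them. -/
theorem const_of_deriv_eq_zero_off {g : ℝ → ℝ} (hg : Differentiable ℝ g) {K : Set ℝ}
    (hK : IsClosed K) (hd : ∀ s, g s ∉ K → deriv g s = 0) {s₀ : ℝ} (hs₀ : g s₀ ∉ K) (s : ℝ) :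
    g s = g s₀ := by
  have hclopen : IsClopen {s | g s = g s₀} := by
    refine ⟨isClosed_eq hg.continuous continuous_const, ?_⟩
    rw [isOpen_iff_mem_nhds]
    intro s (hs : g s = g s₀)
    have hopen : IsOpen {x | g x ∉ K} := hK.isOpen_compl.preimage hg.continuous
    obtain ⟨r, hr, hball⟩ := Metric.isOpen_iff.mp hopen s (by rw [← hs] at hs₀; exact hs₀)
    refine Filter.mem_of_superset (Metric.ball_mem_nhds s hr) fun x hx => ?_
    have := Metric.isOpen_ball.is_const_of_deriv_eq_zero (convex_ball s r).isPreconnected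
      hg.differentiableOn (fun y hy => hd y (hball hy)) hx (Metric.mem_ball_self hr)
    exact this.trans hs
  have := hclopen.eq_univ ⟨s₀, rfl⟩
  exact this.ge (Set.mem_univ s)

namespace Form1

theorem isReeb_congr {α β : Form1} {p R : Amb} (h : α =ᶠ[nhds p] β) (hR : α.IsReeb p R) :
    β.IsReeb p R := by
  obtain ⟨h1, h2, h3⟩ := hR
  refine ⟨h1, by rw [← h.eq_of_nhds]; exact h2, fun v hv => ?_⟩
  have := h3 v hv
  rwa [d, h.fderiv_eq] at this

theorem rescale_eventuallyEq {f : Amb → ℝ} {p : Amb} (lam : Form1)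
    (h : ∀ᶠ x in nhds p, f x = 0) : rescale f lam =ᶠ[nhds p] lam := by
  filter_upwards [h] with x hx
  simp [rescale, hx]

theorem snd_eq_zero_of_abs_z {p : Amb} (hp : p ∈ S1S2) (hz : |p.2.2| = 1) : p.2.1 = 0 := by
  have h1 : p.2.2 ^ 2 = 1 := by rw [← sq_abs, hz, one_pow]
  have h2 := hp.2
  rw [h1] at h2
  have : ‖p.2.1‖ ^ 2 = 0 := by linarith
  simpa using this

/-- In coordinates the Reeb field of `λ` has no `θ`-component, and over the poles every tangent
vector is horizontal. -/
theorem isReeb_z_eq_zero {lam : Form1} {a₁ a₂ : ℝ → ℝ} (h : lam.Toric a₁ a₂) {p R : Amb}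
    (hp : p ∈ S1S2) (hR : lam.IsReeb p R) : R.2.2 = 0 := by
  rcases (abs_z_le_one hp).lt_or_eq with hz | hz
  · obtain ⟨q, hq, rfl⟩ := exists_coord_eq hp hz
    obtain ⟨ξ, rfl⟩ := exists_fderiv_coord_eq hq hR.1
    rw [← lam.rescale_zero] at hR
    have := eq_reebVec_of_isReeb h (f := 0) contDiff_const hq hR
    rw [reebVec_zero] at this
    rw [fderiv_coord_apply, this]
    simp
  · have hu := snd_eq_zero_of_abs_z hp hz
    have ht := hR.1.2
    have h0 : p.2.2 ≠ 0 := by intro h0; simp [h0] at hz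
    simpa [hu, cdot, h0] using ht

end Form1

variable {lam : Form1} {a₁ a₂ : ℝ → ℝ} {f : Amb → ℝ}

namespace EmbReebOrbit

theorem hasDerivAt_z {α : Form1} (o : EmbReebOrbit α) (s : ℝ) :
    HasDerivAt (fun s => (o.γ s).2.2) (deriv o.γ s).2.2 s :=
  ((o.differentiable s).hasDerivAt.snd).snd

theorem deriv_z_eq_zero (h : lam.Toric a₁ a₂) (o : EmbReebOrbit (Form1.rescale f lam)) {s : ℝ}
    (hf0 : ∀ᶠ p in nhds (o.γ s), f p = 0) : deriv (fun s => (o.γ s).2.2) s = 0 := by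
  rw [(o.hasDerivAt_z s).deriv]
  exact Form1.isReeb_z_eq_zero h (o.mem s)
    (Form1.isReeb_congr (lam.rescale_eventuallyEq hf0) (o.isReeb_deriv s))

/-- An orbit of `e^f λ` along which `f` vanishes is an orbit of `λ`. -/
def ofVanishing (o : EmbReebOrbit (Form1.rescale f lam))
    (hf0 : ∀ s, ∀ᶠ p in nhds (o.γ s), f p = 0) : EmbReebOrbit lam where
  γ := o.γ
  T := o.T
  T_pos := o.T_pos
  mem := o.mem
  reeb s := ⟨_, Form1.isReeb_congr (lam.rescale_eventuallyEq (hf0 s)) (o.isReeb_deriv s),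
    (o.differentiable s).hasDerivAt⟩
  periodic := o.periodic
  inj := o.inj

/-- An orbit of `λ` in the circle over a pole is all of that circle. -/
theorem image_eq_poleCircle (h : lam.Toric a₁ a₂) (o : EmbReebOrbit lam) {θ : ℝ}
    (hθ : θ ∈ Set.Icc 0 Real.pi) (hsin : Real.sin θ = 0)
    (hz : ∀ s, (o.γ s).2.2 = Real.cos θ) : o.image = poleCircle (Real.cos θ) := by
  have hcos : |Real.cos θ| = 1 := by
    rw [← pow_eq_one_iff_of_nonneg (abs_nonneg _) two_ne_zero, sq_abs]
    have := Real.sin_sq_add_cos_sq θ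
    rw [hsin] at this
    linarith
  have hu : ∀ s, (o.γ s).2.1 = 0 := fun s =>
    Form1.snd_eq_zero_of_abs_z (o.mem s) (by rw [hz]; exact hcos)
  have hT : ∀ p : Amb, p ∈ S1S2 → p.2.2 = Real.cos θ → lam p (vecT p) = a₁ θ := by
    intro p hp hpz
    obtain ⟨t, ht⟩ := exists_exp_eq_of_norm_eq_one hp.1
    have hp0 := Form1.snd_eq_zero_of_abs_z hp (by rw [hpz]; exact hcos)
    have : p = coord (t, θ, 0) := by
      refine Prod.ext ht (Prod.ext ?_ hpz)
      simp only [coord, hsin, hp0]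
      simp
    rw [this, vecT_coord, h.coordExpr (t, θ, 0) hθ]
    simp
  have hd : ∀ s, HasDerivAt o.γ (deriv o.γ s) s := fun s => (o.differentiable s).hasDerivAt
  have hform : ∀ s, deriv o.γ s = dt (o.γ s) (deriv o.γ s) • vecT (o.γ s) := by
    intro s
    have hud : (deriv o.γ s).2.1 = 0 := by
      have h1 : HasDerivAt (fun s => (o.γ s).2.1) (deriv o.γ s).2.1 s := (hd s).snd.fst
      have h2 : (fun s => (o.γ s).2.1) = fun _ => 0 := funext hu
      rw [h2] at h1
      exact h1.unique (hasDerivAt_const s 0)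
    have hzd : (deriv o.γ s).2.2 = 0 := by
      have h1 := o.hasDerivAt_z s
      have h2 : (fun s => (o.γ s).2.2) = fun _ => Real.cos θ := funext hz
      rw [h2] at h1
      exact h1.unique (hasDerivAt_const s _)
    have ht := (o.isReeb_deriv s).1.1
    have hn : (o.γ s).1.re ^ 2 + (o.γ s).1.im ^ 2 = 1 := by
      have := (o.mem s).1
      rw [← pow_eq_one_iff_of_nonneg (norm_nonneg _) two_ne_zero, ← Complex.normSq_eq_norm_sq,
        Complex.normSq_apply] at this
      linarith
    refine Prod.ext ?_ (Prod.ext ?_ ?_)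
    · simp only [cdot] at ht
      simp only [dt, vecT, Prod.smul_fst]
      apply Complex.ext
      · simp
        linear_combination (-(deriv o.γ s).1.re) * hn + (o.γ s).1.re * ht
      · simp
        linear_combination (-(deriv o.γ s).1.im) * hn + (o.γ s).1.im * ht
    · simp [vecT, hud]
    · simp [vecT, hzd]
  have hτ : ∀ s, dt (o.γ s) (deriv o.γ s) * a₁ θ = 1 := by
    intro s
    have h1 := (o.isReeb_deriv s).2.1
    rw [hform s, map_smul, hT _ (o.mem s) (hz s), smul_eq_mul] at h1
    exact h1
  have ha : a₁ θ ≠ 0 := fun h0 => by simpa [h0] using hτ 0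
  have hw : ∀ s, HasDerivAt (fun s => (o.γ s).1) (((a₁ θ)⁻¹ : ℝ) • (Complex.I * (o.γ s).1)) s := by
    intro s
    have h1 : HasDerivAt (fun s => (o.γ s).1) (deriv o.γ s).1 s := (hd s).fst
    rw [hform s, eq_inv_of_mul_eq_one_left (hτ s)] at h1
    exact h1
  have hsol : ∀ s : ℝ, (o.γ s).1 = Complex.exp (((a₁ θ)⁻¹ * s : ℝ) * Complex.I) * (o.γ 0).1 := by
    have hE : ∀ s : ℝ, HasDerivAt
        (fun s : ℝ => Complex.exp ((-((a₁ θ)⁻¹ * s) : ℝ) * Complex.I))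
        (Complex.exp ((-((a₁ θ)⁻¹ * s) : ℝ) * Complex.I) * ((-(a₁ θ)⁻¹ : ℝ) * Complex.I)) s := by
      intro s
      have h1 : HasDerivAt (fun s : ℝ => -((a₁ θ)⁻¹ * s)) (-(a₁ θ)⁻¹) s :=
        (((hasDerivAt_id s).const_mul (a₁ θ)⁻¹).neg).congr_deriv (by simp)
      exact (h1.ofReal_comp.mul_const Complex.I).cexp
    have hprod : ∀ s : ℝ, HasDerivAt (fun s : ℝ =>
        Complex.exp ((-((a₁ θ)⁻¹ * s) : ℝ) * Complex.I) * (o.γ s).1) 0 s := by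
      intro s
      refine ((hE s).mul (hw s)).congr_deriv ?_
      rw [Complex.real_smul]
      push_cast
      ring
    intro s
    have := is_const_of_deriv_eq_zero (fun s => (hprod s).differentiableAt)
      (fun s => (hprod s).deriv) s 0
    simp only [mul_zero, neg_zero, Complex.ofReal_zero, zero_mul, Complex.exp_zero,
      one_mul] at this
    rw [← this, ← mul_assoc, ← Complex.exp_add]
    simp
  ext p
  constructor
  · rintro ⟨s, rfl⟩
    exact ⟨o.mem s, hz s⟩
  · rintro ⟨hp, hpz⟩
    have h0 : ‖p.1 / (o.γ 0).1‖ = 1 := by rw [norm_div, hp.1, (o.mem 0).1, div_one]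
    obtain ⟨ψ, hψ⟩ := exists_exp_eq_of_norm_eq_one h0
    have hne : (o.γ 0).1 ≠ 0 := by
      intro h0
      have := (o.mem 0).1
      simp [h0] at this
    refine ⟨a₁ θ * ψ, Prod.ext ?_ (Prod.ext ?_ ?_)⟩
    · rw [hsol, inv_mul_cancel_left₀ ha, ← hψ, div_mul_cancel₀ _ hne]
    · rw [hu, Form1.snd_eq_zero_of_abs_z hp (by rw [hpz]; exact hcos)]
    · rw [hz, hpz]

/-- An orbit on which `θ` and `n t - m φ` are constant is one of the two model orbits. -/
theorem image_eq_of_equilibrium {θ₀ ε : ℝ} {m n k l j : ℤ}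
    (hc : Form1.ClosedTorus a₁ a₂ θ₀ m n) (hF : LocalModel f θ₀ ε m n)
    (hkl : k * m + l * n = 1) {y₀ y₁ : ℝ} (hy : y₁ = y₀ + 2 * Real.pi * j)
    (hsin : Real.sin y₀ = 0) {o o' : EmbReebOrbit (Form1.rescale f lam)}
    {q : ℝ → ℝ × ℝ × ℝ} (hq : ∀ s, o.γ s = coord (q s))
    (hd : ∀ s, HasDerivAt q (Form1.reebVec a₁ a₂ (f ∘ coord) (q s)) s)
    (hθ : ∀ s, (q s).2.1 = θ₀) (hphase : ∀ s, n * (q s).1 - m * (q s).2.2 = y₁)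
    (ho' : ∀ s, o'.γ s = coord (coordLine θ₀ m n k l y₀
        (Real.exp (ε * (1 + Real.cos y₀)) / (m * a₁ θ₀ + n * a₂ θ₀)) s)) :
    o.image = o'.image := by
  have hy' : y₁ = y₀ + j * (2 * Real.pi) := by rw [hy]; ring
  have hsin₁ : Real.sin y₁ = 0 := by rw [hy', Real.sin_add_int_mul_two_pi, hsin]
  have hcos₁ : Real.cos y₁ = Real.cos y₀ := by rw [hy', Real.cos_add_int_mul_two_pi]
  have hR := fun s => reebVec_equilibrium (f := f) hc hF (hθ s) (hphase s) hsin₁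
  simp only [hR, hcos₁] at hd
  have hcpos : 0 < Real.exp (ε * (1 + Real.cos y₀)) / (m * a₁ θ₀ + n * a₂ θ₀) :=
    div_pos (Real.exp_pos _) hc.pos
  set c := Real.exp (ε * (1 + Real.cos y₀)) / (m * a₁ θ₀ + n * a₂ θ₀)
  have ht := eq_add_mul_of_hasDerivAt_const (fun s => (hd s).fst)
  have hφ := eq_add_mul_of_hasDerivAt_const (fun s => (hd s).snd.snd)
  have hkl' : (k * m + l * n : ℝ) = 1 := by exact_mod_cast hkl
  have h0 := hphase 0
  -- The phase fixes the position transverse to `(m, n)`; the form `k t + l φ` takes the value `1`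
  -- on `(m, n)` and so measures the remaining time shift between the two orbits.
  set x₀ := k * (q 0).1 + l * (q 0).2.2 with hx₀
  have hshift : ∀ s, o.γ s = o'.γ (s + x₀ / c) := by
    intro s
    rw [hq, ho', coord_eq_coord_iff (q' := coordLine θ₀ m n k l y₀ c (s + x₀ / c))
      (by rw [hθ]; exact hc.mem) hc.mem]
    have hcx : c * (s + x₀ / c) = c * s + x₀ := by field_simp
    refine ⟨hθ s, ⟨l * j, ?_⟩, ⟨-(k * j), ?_⟩⟩
    · simp only [coordLine, hcx]
      rw [ht s, hx₀]
      push_cast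
      linear_combination (-(q 0).1) * hkl' + l * h0 + l * hy
    · simp only [coordLine, hcx]
      rw [hφ s, hx₀]
      push_cast
      linear_combination (-(q 0).2.2) * hkl' - k * h0 - k * hy
  ext p
  constructor
  · rintro ⟨s, rfl⟩
    exact ⟨_, (hshift s).symm⟩
  · rintro ⟨s, rfl⟩
    exact ⟨s - x₀ / c, by rw [hshift, sub_add_cancel]⟩

end EmbReebOrbit

end awayFromTori

/-! ### Choice of the parameters -/

section choices

open Filter Topology

variable {lam : Form1} {a₁ a₂ : ℝ → ℝ}

/-- Since `b' = 0` and `b'' ≠ 0` at `θ₀`, the zero of `b'` is isolated, and by continuity `b' / Δ`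
is small nearby; the bound `π / L` later prevents winding. -/
theorem Form1.ClosedTorus.exists_window {θ₀ L : ℝ} {m n : ℤ}
    (hc : Form1.ClosedTorus a₁ a₂ θ₀ m n) (h : lam.Toric a₁ a₂)
    (htech : TechnicalCondition a₁ a₂) (hL : 0 < L) :
    ∃ r > 0, ∀ θ ∈ Set.Icc (θ₀ - r) (θ₀ + r), θ ∈ Set.Ioo 0 Real.pi ∧
      (deriv (fun x => m * a₁ x + n * a₂ x) θ = 0 → θ = θ₀) ∧
      |deriv (fun x => m * a₁ x + n * a₂ x) θ / (a₁ θ * deriv a₂ θ - a₂ θ * deriv a₁ θ)| <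
        Real.pi / L := by
  have hd₁ := (contDiff_infty_iff_deriv.mp h.smooth₁)
  have hd₂ := (contDiff_infty_iff_deriv.mp h.smooth₂)
  have hdd₁ := (contDiff_infty_iff_deriv.mp hd₁.2).1
  have hdd₂ := (contDiff_infty_iff_deriv.mp hd₂.2).1
  have hderiv : deriv (fun x => m * a₁ x + n * a₂ x) = fun x => m * deriv a₁ x + n * deriv a₂ x := by
    funext x
    exact (((hd₁.1 x).hasDerivAt.const_mul (m : ℝ)).add
      ((hd₂.1 x).hasDerivAt.const_mul (n : ℝ))).deriv
  simp only [hderiv]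
  have h0 := hc.deriv_eq_zero h
  have hb2 : HasDerivAt (fun x => m * deriv a₁ x + n * deriv a₂ x)
      (m * deriv (deriv a₁) θ₀ + n * deriv (deriv a₂) θ₀) θ₀ :=
    ((hdd₁ θ₀).hasDerivAt.const_mul (m : ℝ)).add ((hdd₂ θ₀).hasDerivAt.const_mul (n : ℝ))
  have e1 : ∀ᶠ θ in 𝓝 θ₀, θ ∈ Set.Ioo 0 Real.pi := Ioo_mem_nhds hc.mem.1 hc.mem.2
  have e2 : ∀ᶠ θ in 𝓝 θ₀, m * deriv a₁ θ + n * deriv a₂ θ = 0 → θ = θ₀ := by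
    have := hb2.eventually_ne (c := 0) (hc.deriv_deriv_neg h htech).ne
    rw [eventually_nhdsWithin_iff] at this
    filter_upwards [this] with θ hθ hz
    by_contra hne
    exact hθ hne hz
  have e3 : ∀ᶠ θ in 𝓝 θ₀, |(m * deriv a₁ θ + n * deriv a₂ θ) /
      (a₁ θ * deriv a₂ θ - a₂ θ * deriv a₁ θ)| < Real.pi / L := by
    have c₁ := h.smooth₁.continuous
    have c₂ := h.smooth₂.continuous
    have c₃ := hd₁.2.continuous
    have c₄ := hd₂.2.continuous
    have hcont : ContinuousAt (fun θ => |(m * deriv a₁ θ + n * deriv a₂ θ) /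
        (a₁ θ * deriv a₂ θ - a₂ θ * deriv a₁ θ)|) θ₀ :=
      (ContinuousAt.div (f := fun θ => m * deriv a₁ θ + n * deriv a₂ θ)
        (g := fun θ => a₁ θ * deriv a₂ θ - a₂ θ * deriv a₁ θ) (by fun_prop) (by fun_prop)
        (h.cross_neg θ₀ hc.mem).ne).abs
    refine hcont.eventually_lt continuousAt_const ?_
    rw [h0, zero_div, abs_zero]
    exact div_pos Real.pi_pos hL
  obtain ⟨r, hr, hball⟩ := Metric.nhds_basis_closedBall.eventually_iff.mp (e1.and (e2.and e3))
  refine ⟨r, hr, fun θ hθ => hball ?_⟩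
  rwa [Real.closedBall_eq_Icc]

/-- Finitely many conditions, each valid for all small `ρ`: supports away from the poles, inside the
windows and mutually separated. Continuity of `arccos` converts closeness of cosines into closeness
of angles. -/
theorem exists_bumpWidth (S : Finset ℝ) (hS : ∀ θ ∈ S, θ ∈ Set.Ioo 0 Real.pi) {r : ℝ → ℝ}
    (hr : ∀ θ ∈ S, 0 < r θ) :
    ∃ ρ > 0, ∀ θ ∈ S, |Real.cos θ| + 3 * ρ < 1 ∧
      (∀ θ' ∈ Set.Icc 0 Real.pi, |Real.cos θ' - Real.cos θ| < 3 * ρ →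
        θ' ∈ Set.Icc (θ - r θ) (θ + r θ)) ∧
      ∀ θ' ∈ S, θ' ≠ θ → 5 * ρ < |Real.cos θ' - Real.cos θ| := by
  have hsmall : ∀ {A B : ℝ}, 0 < A → 0 < B → ∀ᶠ ρ in 𝓝[>] (0 : ℝ), A * ρ < B := by
    intro A B hA hB
    filter_upwards [Ioo_mem_nhdsGT (div_pos hB hA)] with ρ hρ
    have := (lt_div_iff₀ hA).mp hρ.2
    linarith
  have hall : ∀ᶠ ρ in 𝓝[>] (0 : ℝ), ∀ θ ∈ S, |Real.cos θ| + 3 * ρ < 1 ∧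
      (∀ θ' ∈ Set.Icc 0 Real.pi, |Real.cos θ' - Real.cos θ| < 3 * ρ →
        θ' ∈ Set.Icc (θ - r θ) (θ + r θ)) ∧
      ∀ θ' ∈ S, θ' ≠ θ → 5 * ρ < |Real.cos θ' - Real.cos θ| := by
    refine (eventually_all_finset S).2 fun θ hθ => ?_
    have hθ' := Set.Ioo_subset_Icc_self (hS θ hθ)
    refine Filter.Eventually.and ?_ (Filter.Eventually.and ?_ ?_)
    · filter_upwards [hsmall three_pos (sub_pos.2 (abs_cos_lt_one (hS θ hθ)))] with ρ hρ
      linarith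
    · obtain ⟨η, hη, hball⟩ := Metric.continuousAt_iff.mp
        (Real.continuous_arccos.continuousAt (x := Real.cos θ)) (r θ) (hr θ hθ)
      filter_upwards [hsmall three_pos hη] with ρ hρ θ' hθ'' hlt
      have := hball (x := Real.cos θ') (by rw [Real.dist_eq]; linarith)
      rw [Real.arccos_cos hθ''.1 hθ''.2, Real.arccos_cos hθ'.1 hθ'.2, Real.dist_eq, abs_lt] at this
      constructor <;> linarith
    · refine (eventually_all_finset S).2 fun θ' hθ'' => ?_
      by_cases hne : θ' = θ
      · exact Eventually.of_forall fun ρ hcon => absurd hne hcon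
      · have hpos : 0 < |Real.cos θ' - Real.cos θ| := by
          rw [abs_pos, sub_ne_zero]
          exact fun heq => hne (Real.injOn_cos (Set.Ioo_subset_Icc_self (hS θ' hθ'')) hθ' heq)
        filter_upwards [hsmall (by norm_num : (0 : ℝ) < 5) hpos] with ρ hρ _
        exact hρ
  obtain ⟨ρ, hρ, hρ0⟩ := (hall.and self_mem_nhdsWithin).exists
  exact ⟨ρ, hρ0, hρ⟩

/-- The numbers `ρ = √2 / (N + 1)` are irrational and tend to `0`, so `ε = ρ² / κ` eventually meets
every condition that holds for small `ε`. -/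
theorem exists_irrational_sq {κ c : ℝ} (hκ : 0 < κ) (hc : 0 < c) {P : ℝ → Prop}
    (hP : ∀ᶠ ε in 𝓝[>] (0 : ℝ), P ε) :
    ∃ ε > 0, P ε ∧ ∃ ρ, Irrational ρ ∧ 0 < ρ ∧ ρ < c ∧ ε * κ = ρ ^ 2 := by
  have hlim : Tendsto (fun N : ℕ => √2 / ((N : ℝ) + 1)) atTop (𝓝 0) := by
    have := tendsto_one_div_add_atTop_nhds_zero_nat.const_mul (√2)
    simpa [div_eq_mul_inv] using this
  have hpos : ∀ N : ℕ, 0 < √2 / ((N : ℝ) + 1) := fun N => by positivity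
  have hlim2 : Tendsto (fun N : ℕ => (√2 / ((N : ℝ) + 1)) ^ 2 / κ) atTop (𝓝[>] 0) := by
    refine tendsto_nhdsWithin_iff.2 ⟨?_, Eventually.of_forall fun N => ?_⟩
    · simpa using (hlim.pow 2).div_const κ
    · exact div_pos (pow_pos (hpos N) 2) hκ
  obtain ⟨N, hN, hNc⟩ := ((hlim2.eventually hP).and (hlim.eventually_lt_const hc)).exists
  refine ⟨_, div_pos (pow_pos (hpos N) 2) hκ, hN, _, ?_, hpos N, hNc, div_mul_cancel₀ _ hκ.ne'⟩
  have := irrational_sqrt_two.div_natCast (m := N + 1) (by omega)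
  simpa using this

/-- All requirements except irrationality hold for every small `ε`, so they can be imposed together
with a rotation number from `exists_irrational_sq`. -/
theorem exists_strength {θ₀ L δ ρ r : ℝ} {m n : ℤ} (hc : Form1.ClosedTorus a₁ a₂ θ₀ m n)
    (h : lam.Toric a₁ a₂) (htech : TechnicalCondition a₁ a₂) (hL : 0 < L) (hδ : 0 < δ)
    (hρ : 0 < ρ) (hr : 0 < r)
    (hw : ∀ θ ∈ Set.Icc (θ₀ - r) (θ₀ + r), θ ∈ Set.Ioo 0 Real.pi ∧
      (deriv (fun x => m * a₁ x + n * a₂ x) θ = 0 → θ = θ₀) ∧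
      |deriv (fun x => m * a₁ x + n * a₂ x) θ / (a₁ θ * deriv a₂ θ - a₂ θ * deriv a₁ θ)| <
        Real.pi / L) :
    ∃ ε > 0, 2 * ε < δ ∧
      |2 * Real.pi * (m * a₁ θ₀ + n * a₂ θ₀) / Real.exp (2 * ε) -
        2 * Real.pi * (m * a₁ θ₀ + n * a₂ θ₀)| < δ ∧
      RigidFlow (fun x => m * a₁ x + n * a₂ x)
        (fun x => a₁ x * deriv a₂ x - a₂ x * deriv a₁ x)
        (fun x => zBump (Real.cos θ₀) ρ (Real.cos x)) (θ₀ - r) (θ₀ + r) θ₀ L ε ∧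
      ∃ ν, Irrational ν ∧ 0 < ν ∧ ν < 2 * Real.pi * (m * a₁ θ₀ + n * a₂ θ₀) / L ∧
        ε * (-(m * deriv (deriv a₁) θ₀ + n * deriv (deriv a₂) θ₀) *
          (m * a₁ θ₀ + n * a₂ θ₀) ^ 3 /
          (a₁ θ₀ * deriv a₂ θ₀ - a₂ θ₀ * deriv a₁ θ₀) ^ 2) = ν ^ 2 := by
  have hb := hc.pos
  have hneg := hc.deriv_deriv_neg h htech
  have hΔ := h.cross_neg θ₀ hc.mem
  have hpi := Real.pi_pos
  have hd₁ := (contDiff_infty_iff_deriv.mp h.smooth₁).2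
  have hd₂ := (contDiff_infty_iff_deriv.mp h.smooth₂).2
  have hW : IsOpen {x : ℝ | |Real.cos x - Real.cos θ₀| < ρ} :=
    isOpen_lt (by fun_prop) continuous_const
  have hrig := eventually_rigid (b := fun x => m * a₁ x + n * a₂ x)
    (Δ := fun x => a₁ x * deriv a₂ x - a₂ x * deriv a₁ x)
    (X := fun x => zBump (Real.cos θ₀) ρ (Real.cos x)) (l := θ₀ - r) (u := θ₀ + r) (θ₀ := θ₀)
    ((contDiff_const.mul h.smooth₁).add (contDiff_const.mul h.smooth₂))
    ((h.smooth₁.mul hd₂).sub (h.smooth₂.mul hd₁))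
    ((contDiff_zBump _ _).comp Real.contDiff_cos) hL ⟨by linarith, by linarith⟩
    (fun θ hθ => (h.cross_neg θ (hw θ hθ).1).ne) (fun θ hθ => (hw θ hθ).2.1)
    (fun θ hθ => (hw θ hθ).2.2) hb.ne' hW (by simpa using hρ)
    (fun θ hθ => zBump_eq_one hρ (le_of_lt hθ))
  have e1 : ∀ᶠ ε in 𝓝[>] (0 : ℝ), 2 * ε < δ := by
    refine nhdsWithin_le_nhds (ContinuousAt.eventually_lt (by fun_prop) continuousAt_const ?_)
    simpa using hδ
  have e2 : ∀ᶠ ε in 𝓝[>] (0 : ℝ), |2 * Real.pi * (m * a₁ θ₀ + n * a₂ θ₀) / Real.exp (2 * ε) -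
        2 * Real.pi * (m * a₁ θ₀ + n * a₂ θ₀)| < δ := by
    refine nhdsWithin_le_nhds (ContinuousAt.eventually_lt ?_ continuousAt_const ?_)
    · exact ((continuousAt_const.div (g := fun ε => Real.exp (2 * ε)) (by fun_prop)
        (Real.exp_pos _).ne').sub continuousAt_const).abs
    · simpa using hδ
  obtain ⟨ε, hε, ⟨p1, p2, p3⟩, hν⟩ := exists_irrational_sq
    (κ := -(m * deriv (deriv a₁) θ₀ + n * deriv (deriv a₂) θ₀) *
          (m * a₁ θ₀ + n * a₂ θ₀) ^ 3 / (a₁ θ₀ * deriv a₂ θ₀ - a₂ θ₀ * deriv a₁ θ₀) ^ 2)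
    (c := 2 * Real.pi * (m * a₁ θ₀ + n * a₂ θ₀) / L)
    (div_pos (mul_pos (neg_pos.2 hneg) (pow_pos hb 3)) (sq_pos_of_ne_zero hΔ.ne)) (by positivity)
    (e1.and (e2.and hrig))
  exact ⟨ε, hε, p1, p2, p3, hν⟩

end choices

/-! ### Classification of the short orbits of the perturbed form. -/

section classification

variable {lam : Form1} {a₁ a₂ : ℝ → ℝ} {f : Amb → ℝ}

theorem localModel_perturbation {S : Finset ℝ} {ρ : ℝ} {m n : ℝ → ℤ} {ε : ℝ → ℝ} (hρ : 0 < ρ)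
    {θ₀ : ℝ} (hθ₀ : θ₀ ∈ S) (hI : θ₀ ∈ Set.Ioo 0 Real.pi)
    (hsep : ∀ θ ∈ S, θ ≠ θ₀ → 5 * ρ < |Real.cos θ - Real.cos θ₀|) :
    LocalModel (perturbation S ρ m n ε) θ₀ (ε θ₀) (m θ₀) (n θ₀) := by
  have hW : ∀ᶠ x in nhds θ₀, |Real.cos x - Real.cos θ₀| < ρ :=
    ContinuousAt.eventually_lt (by fun_prop) continuousAt_const (by simpa using hρ)
  filter_upwards [hW, Ioo_mem_nhds hI.1 hI.2] with θ hθ hθI t φ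
  rw [perturbation_coord hρ hθ₀ hsep (q := (t, θ, φ)) hθI (by simp only; linarith),
    zBump_eq_one hρ hθ.le, mul_one]

/-- A closed orbit of small action in the support of the perturbation near `T(θ₀)` is one of the
two model orbits. -/
theorem EmbReebOrbit.image_eq_of_near {θ₀ ε L ρ r : ℝ} {m n k l : ℤ} {X : ℝ → ℝ}
    (h : lam.Toric a₁ a₂) (hf : ContDiff ℝ ∞ f) (hX : Differentiable ℝ X)
    (hc : Form1.ClosedTorus a₁ a₂ θ₀ m n) (hF : LocalModel f θ₀ ε m n)
    (hrep : ∀ q : ℝ × ℝ × ℝ, q.2.1 ∈ Set.Ioo 0 Real.pi → |Real.cos q.2.1 - Real.cos θ₀| < ρ →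
      f (coord q) = -(ε * X q.2.1 * (1 + Real.cos (n * q.1 - m * q.2.2))))
    (hkl : k * m + l * n = 1)
    (hrig : RigidFlow (fun x => m * a₁ x + n * a₂ x)
        (fun x => a₁ x * deriv a₂ x - a₂ x * deriv a₁ x) X (θ₀ - r) (θ₀ + r) θ₀ L ε)
    (hwin : ∀ θ ∈ Set.Icc 0 Real.pi, |Real.cos θ - Real.cos θ₀| < ρ →
      θ ∈ Set.Icc (θ₀ - r) (θ₀ + r))
    (hρ1 : |Real.cos θ₀| + ρ ≤ 1)
    {o oh oe : EmbReebOrbit (Form1.rescale f lam)} (hT : o.T ≤ L)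
    (hz : ∀ s, |(o.γ s).2.2 - Real.cos θ₀| < ρ)
    (hoh : ∀ s, oh.γ s = coord (coordLine θ₀ m n k l 0
        (Real.exp (ε * (1 + Real.cos 0)) / (m * a₁ θ₀ + n * a₂ θ₀)) s))
    (hoe : ∀ s, oe.γ s = coord (coordLine θ₀ m n k l Real.pi
        (Real.exp (ε * (1 + Real.cos Real.pi)) / (m * a₁ θ₀ + n * a₂ θ₀)) s)) :
    o.image = oh.image ∨ o.image = oe.image := by
  have hz1 : ∀ s, |(o.γ s).2.2| < 1 := fun s => by
    have := abs_sub_abs_le_abs_sub (o.γ s).2.2 (Real.cos θ₀)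
    linarith [hz s]
  obtain ⟨q, hq, hI, -, hd⟩ := o.exists_lift h hf hz1
  have hnear : ∀ s, |Real.cos (q s).2.1 - Real.cos θ₀| < ρ := fun s => by
    have := hz s
    rwa [hq] at this
  have hd₁ := (contDiff_infty_iff_deriv.mp h.smooth₁).1
  have hd₂ := (contDiff_infty_iff_deriv.mp h.smooth₂).1
  have hb : ∀ x, deriv (fun x => m * a₁ x + n * a₂ x) x = m * deriv a₁ x + n * deriv a₂ x :=
    fun x => (((hd₁ x).hasDerivAt.const_mul (m : ℝ)).add
      ((hd₂ x).hasDerivAt.const_mul (n : ℝ))).deriv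
  have hR : ∀ s, _ := fun s => Form1.reebVec_of_eventuallyEq (a₁ := a₁) (a₂ := a₂) (X := X)
    (F := f ∘ coord) (ε := ε) (m := m) (n := n) (q := q s) (hX _) (by
      have hθ : Continuous fun q : ℝ × ℝ × ℝ => q.2.1 := continuous_fst.comp continuous_snd
      have e1 : ∀ᶠ q' in nhds (q s), q'.2.1 ∈ Set.Ioo 0 Real.pi :=
        hθ.continuousAt.eventually (Ioo_mem_nhds (hI s).1 (hI s).2)
      have e2 : ∀ᶠ q' in nhds (q s), |Real.cos q'.2.1 - Real.cos θ₀| < ρ :=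
        ContinuousAt.eventually_lt
          ((Real.continuous_cos.comp hθ).sub continuous_const).abs.continuousAt
          continuousAt_const (hnear s)
      filter_upwards [e1, e2] with q' h1 h2
      exact hrep q' h1 h2)
  simp only [Prod.smul_mk, smul_eq_mul] at hR
  have hθ' : ∀ s, HasDerivAt (fun s => (q s).2.1) (Form1.reebVec a₁ a₂ (f ∘ coord) (q s)).2.1 s :=
    fun s => (hd s).snd.fst
  have ht' : ∀ s, HasDerivAt (fun s => (q s).1) (Form1.reebVec a₁ a₂ (f ∘ coord) (q s)).1 s :=
    fun s => (hd s).fst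
  have hφ' : ∀ s, HasDerivAt (fun s => (q s).2.2) (Form1.reebVec a₁ a₂ (f ∘ coord) (q s)).2.2 s :=
    fun s => (hd s).snd.snd
  obtain ⟨hθ, hsin, hy⟩ := hrig (fun s => (q s).2.1) (fun s => n * (q s).1 - m * (q s).2.2) o.T
    o.T_pos hT (fun s => hwin _ (Set.Ioo_subset_Icc_self (hI s)) (hnear s))
    (fun s => (hθ' s).congr_deriv (by rw [hR]; ring))
    (fun s => (((ht' s).const_mul (n : ℝ)).sub ((hφ' s).const_mul (m : ℝ))).congr_deriv (by
      rw [hR, hb]; ring))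
    (fun s => (o.exists_int_of_lift hq hI s).1)
    (fun s => by
      obtain ⟨-, ⟨i, hi⟩, j, hj⟩ := o.exists_int_of_lift hq hI s
      refine ⟨n * i - m * j, ?_⟩
      simp only [hi, hj]
      push_cast
      ring)
  -- The phase is a multiple of `π`; even multiples give the hyperbolic orbit, odd ones the elliptic
  -- orbit.
  obtain ⟨i, hi⟩ := Real.sin_eq_zero_iff.mp hsin
  obtain ⟨j, rfl | rfl⟩ := Int.even_or_odd' i
  · left
    refine image_eq_of_equilibrium hc hF hkl (y₀ := 0) (j := j) ?_ Real.sin_zero hq hd hθ hy hoh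
    rw [← hi]; push_cast; ring
  · right
    refine image_eq_of_equilibrium hc hF hkl (y₀ := Real.pi) (j := j) ?_ Real.sin_pi hq hd hθ hy hoe
    rw [← hi]; push_cast; ring

/-- Closed orbits of `e^f λ` either are closed orbits of `λ` along which `z` is constant, or stay in
the region where `f` does not vanish. -/
theorem EmbReebOrbit.vanishing_or_mem (h : lam.Toric a₁ a₂) {K : Set ℝ} (hK : IsClosed K)
    (hfK : ∀ p : Amb, p.2.2 ∉ K → f p = 0) (o : EmbReebOrbit (Form1.rescale f lam)) :
    (∃ o' : EmbReebOrbit lam, o'.image = o.image ∧ o'.T = o.T ∧ (o.γ 0).2.2 ∉ K ∧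
      ∀ s, (o'.γ s).2.2 = (o.γ 0).2.2) ∨ ∀ s, (o.γ s).2.2 ∈ K := by
  by_cases hmem : ∀ s, (o.γ s).2.2 ∈ K
  · exact Or.inr hmem
  · push Not at hmem
    obtain ⟨s₀, hs₀⟩ := hmem
    left
    have hf0 : ∀ p : Amb, p.2.2 ∉ K → ∀ᶠ p' in nhds p, f p' = 0 := by
      intro p hp
      have hopen : IsOpen {p : Amb | p.2.2 ∉ K} :=
        hK.isOpen_compl.preimage (continuous_snd.comp continuous_snd)
      filter_upwards [hopen.mem_nhds hp] with p' hp'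
      exact hfK p' hp'
    have hconst := const_of_deriv_eq_zero_off (g := fun s => (o.γ s).2.2)
      (fun s => (o.hasDerivAt_z s).differentiableAt) hK
      (fun s hs => o.deriv_z_eq_zero h (hf0 _ hs)) hs₀
    have hK' : ∀ s, (o.γ s).2.2 ∉ K := fun s => by rw [show (o.γ s).2.2 = _ from hconst s]; exact hs₀
    exact ⟨o.ofVanishing fun s => hf0 _ (hK' s), rfl, rfl, hK' 0,
      fun s => (hconst s).trans (hconst 0).symm⟩

/-- A curve in a finite union of well separated intervals stays in one of them. -/
theorem exists_mem_interval {S : Finset ℝ} {c : ℝ → ℝ} {ρ : ℝ} (hρ : 0 < ρ)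
    (hsep : ∀ θ₀ ∈ S, ∀ θ ∈ S, θ ≠ θ₀ → 5 * ρ < |c θ - c θ₀|) {g : ℝ → ℝ} (hg : Continuous g)
    (hmem : ∀ s, ∃ θ ∈ S, |g s - c θ| ≤ 2 * ρ) : ∃ θ ∈ S, ∀ s, |g s - c θ| < 3 * ρ := by
  obtain ⟨θ₀, hθ₀, h0⟩ := hmem 0
  refine ⟨θ₀, hθ₀, fun s => ?_⟩
  by_contra hcon
  push Not at hcon
  have hcont : Continuous fun s => |g s - c θ₀| := by fun_prop
  -- To escape, the curve would have to pass at distance `5ρ/2` from `c θ₀`: more than `2ρ` away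
  -- from this centre and, by the separation, from every other one.
  obtain ⟨x, hx⟩ := mem_range_of_exists_le_of_exists_ge hcont (c := 5 / 2 * ρ)
    ⟨0, by linarith⟩ ⟨s, by linarith⟩
  simp only at hx
  obtain ⟨θ, hθ, hle⟩ := hmem x
  by_cases hne : θ = θ₀
  · rw [hne] at hle; linarith
  · have h1 := hsep θ₀ hθ₀ θ hθ hne
    have h2 := abs_sub_le (c θ) (g x) (c θ₀)
    rw [abs_sub_comm (c θ) (g x)] at h2
    linarith

end classification

/-! ### Assembly of the theorem. -/

theorem mainTheorem8 (lam : Form1) (a₁ a₂ : ℝ → ℝ)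
    (ha₁ : ContDiffOn ℝ ∞ a₁ (Set.Icc 0 Real.pi)) (ha₂ : ContDiffOn ℝ ∞ a₂ (Set.Icc 0 Real.pi))
    (hcoord : lam.HasCoordExpr a₁ a₂) (hcontact : lam.IsPosContact)
    (htech : TechnicalCondition a₁ a₂) (L : ℝ) (hL : 0 < L) :
    ∃ δ₀ : ℝ, 0 < δ₀ ∧ ∀ δ : ℝ, 0 < δ → δ < δ₀ →
      ∃ f : Amb → ℝ, ContDiff ℝ ∞ f ∧
        (∀ p ∈ Amb.S1S2, |f p| < δ) ∧
        (∃ U : Set Amb, IsOpen U ∧ Amb.poleCircle 1 ∪ Amb.poleCircle (-1) ⊆ U ∧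
          ∀ p ∈ U ∩ Amb.S1S2, ∀ v, Amb.IsTangent p v → Form1.rescale f lam p v = lam p v) ∧
        ∃ h e : lowTori lam L → EmbReebOrbit (Form1.rescale f lam),
          (∀ θ : lowTori lam L,
            (h θ).IsPosHyperbolic ∧ (e θ).IsLPositive L ∧
            (h θ).action < L ∧ (e θ).action < L ∧
            (∀ o : EmbReebOrbit lam, o.image ⊆ Amb.torus θ →
              |(h θ).action - o.action| < δ ∧ |(e θ).action - o.action| < δ) ∧
            ∃ m n : ℤ, (h θ).HasClass θ m n ∧ (e θ).HasClass θ m n ∧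
              ∀ o : EmbReebOrbit lam, o.image ⊆ Amb.torus θ → o.HasClass θ m n) ∧
          ∀ o : EmbReebOrbit (Form1.rescale f lam), o.action < L →
            o.image = Amb.poleCircle 1 ∨ o.image = Amb.poleCircle (-1) ∨
            ∃ θ : lowTori lam L, o.image = (h θ).image ∨ o.image = (e θ).image := by
  obtain ⟨b₁, b₂, hpt, htech'⟩ := Form1.exists_polarToric hcoord hcontact htech
  have ht := hpt.toToric
  have hfin := finite_lowTori hpt htech' L
  -- The data are chosen for every real `θ`, with irrelevant zero values off the low tori, so that
  -- they can index a sum over a finite set of reals.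
  have hdata : ∀ θ : ℝ, ∃ m n k l : ℤ, θ ∈ lowTori lam L →
      Form1.ClosedTorus b₁ b₂ θ m n ∧ k * m + l * n = 1 ∧
        2 * Real.pi * (m * b₁ θ + n * b₂ θ) < L := by
    intro θ
    by_cases hθ : θ ∈ lowTori lam L
    · obtain ⟨hθI, o, ho, hoL⟩ := hθ
      obtain ⟨m, n, hc⟩ := o.exists_closedTorus ht hθI ho
      obtain ⟨k, l, hkl⟩ := hc.coprime
      refine ⟨m, n, k, l, fun _ => ⟨hc, hkl, ?_⟩⟩
      rw [← hc.period_eq ht o ho, ← o.action_eq]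
      exact hoL
    · exact ⟨0, 0, 0, 0, fun hcon => absurd hcon hθ⟩
  choose m n k l hdata using hdata
  have hwin : ∀ θ : ℝ, ∃ r : ℝ, θ ∈ lowTori lam L → 0 < r ∧
      ∀ θ' ∈ Set.Icc (θ - r) (θ + r), θ' ∈ Set.Ioo 0 Real.pi ∧
        (deriv (fun x => m θ * b₁ x + n θ * b₂ x) θ' = 0 → θ' = θ) ∧
        |deriv (fun x => m θ * b₁ x + n θ * b₂ x) θ' /
          (b₁ θ' * deriv b₂ θ' - b₂ θ' * deriv b₁ θ')| < Real.pi / L := by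
    intro θ
    by_cases hθ : θ ∈ lowTori lam L
    · obtain ⟨r, hr, hw⟩ := (hdata θ hθ).1.exists_window ht htech' hL
      exact ⟨r, fun _ => ⟨hr, hw⟩⟩
    · exact ⟨0, fun hcon => absurd hcon hθ⟩
  choose r hwin using hwin
  have hS : ∀ {θ}, θ ∈ hfin.toFinset ↔ θ ∈ lowTori lam L := hfin.mem_toFinset
  obtain ⟨ρ, hρ, hwidth⟩ := exists_bumpWidth hfin.toFinset (fun θ hθ => (hS.1 hθ).1)
    (r := r) (fun θ hθ => (hwin θ (hS.1 hθ)).1)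
  -- Any threshold would do: the tori, windows and bump width are fixed before `δ`, and only the
  -- strengths `ε` depend on it.
  refine ⟨1, one_pos, fun δ hδ _ => ?_⟩
  have hstrength : ∀ θ : ℝ, ∃ ε : ℝ, θ ∈ lowTori lam L → 0 < ε ∧ 2 * ε < δ ∧
      |2 * Real.pi * (m θ * b₁ θ + n θ * b₂ θ) / Real.exp (2 * ε) -
        2 * Real.pi * (m θ * b₁ θ + n θ * b₂ θ)| < δ ∧
      RigidFlow (fun x => m θ * b₁ x + n θ * b₂ x)
        (fun x => b₁ x * deriv b₂ x - b₂ x * deriv b₁ x)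
        (fun x => zBump (Real.cos θ) ρ (Real.cos x)) (θ - r θ) (θ + r θ) θ L ε ∧
      ∃ ν, Irrational ν ∧ 0 < ν ∧ ν < 2 * Real.pi * (m θ * b₁ θ + n θ * b₂ θ) / L ∧
        ε * (-(m θ * deriv (deriv b₁) θ + n θ * deriv (deriv b₂) θ) *
          (m θ * b₁ θ + n θ * b₂ θ) ^ 3 /
          (b₁ θ * deriv b₂ θ - b₂ θ * deriv b₁ θ) ^ 2) = ν ^ 2 := by
    intro θ
    by_cases hθ : θ ∈ lowTori lam L
    · obtain ⟨ε, hε, hrest⟩ := exists_strength (hdata θ hθ).1 ht htech' hL hδ hρ (hwin θ hθ).1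
        (hwin θ hθ).2
      exact ⟨ε, fun _ => ⟨hε, hrest⟩⟩
    · exact ⟨0, fun hcon => absurd hcon hθ⟩
  choose ε hstrength using hstrength
  have hcos2 : ∀ θ ∈ hfin.toFinset, |Real.cos θ| + 2 * ρ < 1 := fun θ hθ => by
    linarith [(hwidth θ hθ).1]
  have hsep := fun θ₀ hθ₀ => (hwidth θ₀ hθ₀).2.2
  have hf : ContDiff ℝ ∞ (perturbation hfin.toFinset ρ m n ε) := contDiff_perturbation hρ hcos2
  have hF : ∀ θ ∈ lowTori lam L,
      LocalModel (perturbation hfin.toFinset ρ m n ε) θ (ε θ) (m θ) (n θ) := fun θ hθ =>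
    localModel_perturbation hρ (hS.2 hθ) hθ.1 (hsep θ (hS.2 hθ))
  choose oh hoh hohT using fun θ : lowTori lam L => exists_equilibriumOrbit ht hf
    (hdata θ θ.2).1 (hF θ θ.2) (hdata θ θ.2).2.1 Real.sin_zero
  choose oe hoe hoeT using fun θ : lowTori lam L => exists_equilibriumOrbit ht hf
    (hdata θ θ.2).1 (hF θ θ.2) (hdata θ θ.2).2.1 Real.sin_pi
  -- Here `f = -2ε` on the hyperbolic orbit and `f = 0` on the elliptic one, so one period shrinks
  -- and the other is unchanged; both stay below `L`.
  have hohT' : ∀ θ, (oh θ).T =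
      2 * Real.pi * (m θ * b₁ θ + n θ * b₂ θ) / Real.exp (2 * ε θ) := fun θ => by
    rw [hohT, Real.cos_zero]; ring_nf
  have hoeT' : ∀ θ, (oe θ).T = 2 * Real.pi * (m θ * b₁ θ + n θ * b₂ θ) := fun θ => by
    rw [hoeT, Real.cos_pi]; simp
  refine ⟨perturbation hfin.toFinset ρ m n ε, hf, fun p hp => ?_, ?_, oh, oe, fun θ => ?_,
    fun o hoL => ?_⟩
  · exact abs_perturbation_lt hρ hcos2 hsep hδ
      (fun θ hθ => ⟨(hstrength θ (hS.1 hθ)).1, (hstrength θ (hS.1 hθ)).2.1⟩) hp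
  · refine ⟨⋂ θ ∈ hfin.toFinset, {p : Amb | 2 * ρ < |p.2.2 - Real.cos θ|}, ?_, ?_, ?_⟩
    · exact isOpen_biInter_finset fun θ _ => isOpen_lt continuous_const (by fun_prop)
    · have hpole : ∀ c : ℝ, |c| = 1 → ∀ θ ∈ hfin.toFinset, 2 * ρ < |c - Real.cos θ| := by
        intro c hc θ hθ
        have := abs_sub_abs_le_abs_sub c (Real.cos θ)
        linarith [hcos2 θ hθ]
      rintro p (hp | hp)
      · refine Set.mem_iInter₂.2 fun θ hθ => ?_
        rw [Set.mem_ofPred_eq, hp.2]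
        exact hpole 1 (by simp) θ hθ
      · refine Set.mem_iInter₂.2 fun θ hθ => ?_
        rw [Set.mem_ofPred_eq, hp.2]
        exact hpole (-1) (by simp) θ hθ
    · rintro p ⟨hp, -⟩ v -
      have h0 : perturbation hfin.toFinset ρ m n ε p = 0 :=
        perturbation_eq_zero hρ fun θ hθ => (Set.mem_iInter₂.1 hp θ hθ).le
      simp [Form1.rescale, h0]
  · obtain ⟨hc, hkl, hcL⟩ := hdata θ θ.2
    obtain ⟨hε, -, hδ', -, ν, hν, hν0, hνL, hεν⟩ := hstrength θ θ.2
    have hneg := hc.deriv_deriv_neg ht htech'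
    have hb := hc.pos
    have hpi := Real.pi_pos
    have hbp : 0 < 2 * Real.pi * (m θ * b₁ θ + n θ * b₂ θ) := by positivity
    have hhL : (oh θ).T < L := by
      rw [hohT']
      exact (div_le_self hbp.le (Real.one_le_exp (by linarith))).trans_lt hcL
    have heL : (oe θ).T < L := by rw [hoeT']; exact hcL
    have hell := EmbReebOrbit.isEllipticWith_of_coordLine ht hf hc (hF θ θ.2) hε hneg hkl
      Real.sin_pi Real.cos_pi (hoe θ) (hoeT' θ) hν hν0 hεν
    refine ⟨EmbReebOrbit.isPosHyperbolic_of_coordLine ht hf hc (hF θ θ.2) hε hneg hkl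
      Real.sin_zero Real.cos_zero (hoh θ), ⟨?_, ν, ⟨hν0, ?_⟩, hell⟩, ?_, ?_, fun o ho => ?_,
      m θ, n θ, ?_, ?_, fun o ho => hc.hasClass ht o ho⟩
    · rwa [(oe θ).action_eq]
    · rwa [(oe θ).action_eq, hoeT']
    · rwa [(oh θ).action_eq]
    · rwa [(oe θ).action_eq]
    · rw [(oh θ).action_eq, (oe θ).action_eq, o.action_eq, hc.period_eq ht o ho, hohT', hoeT']
      refine ⟨hδ', ?_⟩
      simpa using hδ
    · refine EmbReebOrbit.hasClass_of_coordLine (hoh θ) ?_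
      rw [hohT]
      field_simp
    · refine EmbReebOrbit.hasClass_of_coordLine (hoe θ) ?_
      rw [hoeT]
      field_simp
  · rw [o.action_eq] at hoL
    have hK : IsClosed (⋃ θ ∈ hfin.toFinset, {z : ℝ | |z - Real.cos θ| ≤ 2 * ρ}) :=
      isClosed_biUnion_finset fun θ _ => isClosed_le (by fun_prop) continuous_const
    rcases o.vanishing_or_mem ht hK (fun p hp => perturbation_eq_zero hρ fun θ hθ => by
      by_contra hcon
      exact hp (Set.mem_iUnion₂.2 ⟨θ, hθ, (not_le.1 hcon).le⟩)) with ⟨o', him, hoT, h0, hz⟩ | hmem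
    · rcases (abs_z_le_one (o.mem 0)).lt_or_eq with hlt | heq
      · exfalso
        set θ := Real.arccos (o.γ 0).2.2 with hθ
        have hcosθ : Real.cos θ = (o.γ 0).2.2 :=
          Real.cos_arccos (abs_lt.1 hlt).1.le (abs_lt.1 hlt).2.le
        -- An orbit of `λ` off the poles with action below `L` would make its torus a low torus,
        -- whose height lies in the set `K` that the orbit avoids.
        have hlow : θ ∈ lowTori lam L := by
          refine ⟨⟨Real.arccos_pos.2 (abs_lt.1 hlt).2, Real.arccos_lt_pi.2 (abs_lt.1 hlt).1⟩, o',
            ?_, ?_⟩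
          · rintro _ ⟨s, rfl⟩
            exact ⟨o'.mem s, by rw [hz, hcosθ]⟩
          · rw [o'.action_eq, hoT]; exact hoL
        refine h0 (Set.mem_iUnion₂.2 ⟨θ, hS.2 hlow, ?_⟩)
        rw [Set.mem_ofPred_eq, hcosθ, sub_self, abs_zero]
        positivity
      · rcases eq_or_eq_neg_of_abs_eq heq with h1 | h1
        · left
          have := o'.image_eq_poleCircle ht (θ := 0) ⟨le_rfl, Real.pi_pos.le⟩ Real.sin_zero
            (fun s => by rw [hz, h1, Real.cos_zero])
          rwa [him, Real.cos_zero] at this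
        · right; left
          have := o'.image_eq_poleCircle ht (θ := Real.pi) ⟨Real.pi_pos.le, le_rfl⟩ Real.sin_pi
            (fun s => by rw [hz, h1, Real.cos_pi])
          rwa [him, Real.cos_pi] at this
    · right; right
      obtain ⟨θ, hθ, hnear⟩ := exists_mem_interval (c := Real.cos) hρ hsep
        (g := fun s => (o.γ s).2.2)
        (continuous_iff_continuousAt.2 fun s => (o.hasDerivAt_z s).continuousAt)
        (fun s => by simpa using hmem s)
      have hlow := hS.1 hθ
      obtain ⟨hc, hkl, -⟩ := hdata θ hlow
      obtain ⟨-, -, -, hrig, -⟩ := hstrength θ hlow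
      obtain ⟨hw1, hw2, -⟩ := hwidth θ hθ
      refine ⟨⟨θ, hlow⟩, EmbReebOrbit.image_eq_of_near ht hf
        (((contDiff_zBump _ _).comp Real.contDiff_cos).differentiable (by simp)) hc (hF θ hlow)
        (fun q hq hq' => perturbation_coord hρ hθ (hsep θ hθ) hq hq') hkl hrig hw2 hw1.le hoL.le
        hnear (hoh ⟨θ, hlow⟩) (hoe ⟨θ, hlow⟩)⟩
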